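/- **Setting.** Let $\gamma>0$, $\delta>1/2$, $\eta>0$, $0<\alpha<1$, $J_0\in\mathbb N$, $J_0\ge 1$, and $S\in\mathbb N$ with $S>\max(\gamma,1/2)$. Let $\{\psi_{lk}: l\ge J_0-1,\ 0\le k<N_l\}$ be an $S$-regular (CDV wavelet-type) orthonormal basis of the real space $L^2=L^2([0,1])$, that is, an orthonormal basis of functions that are $S$ times differentiable on $[0,1]$ with all derivatives up to order $S$ in $L^2$. Here $N_l=2^l$ for $l\ge J_0$, and the number $N_{J_0-1}$ of scaling functions, placed at level $J_0-1$, is arbitrary (for example $2^{J_0-1}$ or $2^{J_0}$). Put $a_l=\max(2,2^l)$ and $$\|f\|_{s,2,\rho}^2=\sum_{l,k}\frac{a_l^{2s}}{(\log a_l)^{2\rho}}\,|\langle\psi_{lk},f\rangle|^2,\qquad \|f\|_H=\|f\|_{-1/2,2,\delta},\qquad \|f\|_{\gamma,\infty}=\sup_{l,k}2^{l(\gamma+1/2)}|\langle\psi_{lk},f\rangle| .$$ Let $P^n_{f}$ be the law of the white noise observation $dX^{(n)}(t)=f(t)\,dt+n^{-1/2}dW(t)$, $t\in[0,1]$, that is,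 of $\mathbb X^{(n)}=(\langle\psi_{lk},f\rangle+n^{-1/2}\varepsilon_{lk})_{l,k}$ with $\varepsilon_{lk}$ i.i.d. $N(0,1)$. Let $f_0\in C^\gamma$, that is, $f_0$ is continuous on $[0,1]$ and $\|f_0\|_{\gamma,\infty}<\infty$. Let the prior $\Pi$ be the law on $L^2$ of $$G_\gamma=\sum_{l\ge J_0-1}\sum_{0\le k<N_l}2^{-l(\gamma+1/2)}g_{lk}\psi_{lk},$$ where the $g_{lk}$ are i.i.d. with finite variance and with a bounded, everywhere positive Lebesgue density $\varphi$. Assume moreover that there are $\tau>\|f_0\|_{\gamma,\infty}$ and $c>0$ with $\varphi\ge c$ on $(-\tau,\tau)$, and that $\varphi$ is continuous at each point $2^{l(\gamma+1/2)}\langle\psi_{lk},f_0\rangle$ (both hold if $\varphi$ is continuous). Let $\Pi_n=\Pi(\cdot\mid\mathbb X^{(n)})$ be the posterior distribution and $\bar f_n=\int f\,d\Pi_n(f)$ the posterior mean. Define $$M_n=\inf\Big\{M>0:\ \Pi_n\big(f:\big|\|f\|_{\gamma,2,1}-M\big|\le\eta\big)\ge 1-(\log n)^{-1/4}\Big\}\qquad(\inf\emptyset=\infty).$$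 **Claim.** For every $n\ge1$, $P^n_{f_0}$-almost surely the Bochner mean $\bar f_n$ exists and there is $r\ge0$ with $\Pi_n(f:\|f-\bar f_n\|_H\le r/\sqrt n)=1-\alpha$. Let $R_n=R_n(\mathbb X^{(n)})\ge 0$ be any choice of radii such that, for every $n\ge 1$, $\Pi_n(f:\|f-\bar f_n\|_H\le R_n/\sqrt n)=1-\alpha$ holds $P_{f_0}^n$-almost surely, and let $$C''_n=\big\{f\in L^2:\ \|f\|_{\gamma,2,1}\le M_n+4\eta,\ \|f-\bar f_n\|_H\le R_n/\sqrt n\big\}.$$ Then, as $n\to\infty$, $$P^n_{f_0}(f_0\in C''_n)\to1-\alpha,\qquad \Pi_n(C''_n)=1-\alpha+o_P(1),$$ and for some $\kappa>0$ the $L^2$-diameter of $C''_n$ satisfies $$|C''_n|_2=O_P\big(n^{-\gamma/(2\gamma+1)}(\log n)^\kappa\big).$$ Moreover $M_n=O_P(1)$ and $R_n=O_P(1)$. All $o_P$ and $O_P$ are under $P^n_{f_0}$. -/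

import Mathlib

open MeasureTheory ProbabilityTheory Filter Topology Set
open scoped ENNReal NNReal unitInterval RealInnerProductSpace

noncomputable section

namespace WhiteNoise

/-- The Hilbert space `L²([0,1])` of real square integrable functions. -/
abbrev L2 : Type := Lp ℝ 2 (volume : Measure I)

/-- `L²([0,1])` carries its Borel `σ`-algebra. -/
instance instMeasurableSpaceL2 : MeasurableSpace L2 := borel L2

instance instBorelSpaceL2 : BorelSpace L2 := ⟨rfl⟩

instance instFactTwoNeTop : Fact ((2 : ℝ≥0∞) ≠ ∞) := ⟨ENNReal.ofNat_ne_top⟩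

/-! ### Wavelet-type bases -/

/-- The pairs `(l, k)` with level `l ≥ J₀ - 1` and `0 ≤ k < N_l`, where `N_l = 2 ^ l` for `l ≥ J₀`,
and where the lowest level `l = J₀ - 1` (the scaling functions) has `m` elements. -/
abbrev WaveletIndex (J₀ m : ℕ) : Type :=
  {p : ℕ × ℕ // J₀ ≤ p.1 + 1 ∧ p.2 < if p.1 + 1 = J₀ then m else 2 ^ p.1}

/-- An `S`-regular wavelet-type basis of `L²([0,1])`: an orthonormal basis `ψ_{lk}` consisting of
(classes of) functions that are `S` times differentiable on `[0,1]`, with all derivatives up to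
order `S` in `L²`. -/
structure RegularBasis (S J₀ m : ℕ) where
  /-- the functions `ψ_{lk}` -/
  fn : WaveletIndex J₀ m → ℝ → ℝ
  /-- the basis as elements of `L²` -/
  basis : HilbertBasis (WaveletIndex J₀ m) ℝ L2
  basis_ae_eq : ∀ i, (basis i : I → ℝ) =ᵐ[volume] fun x : I => fn i x
  differentiable : ∀ i, ∀ j < S,
    DifferentiableOn ℝ (iteratedDerivWithin j (fn i) (Icc 0 1)) (Icc 0 1)
  memLp_deriv : ∀ i, ∀ j ≤ S,
    MemLp (fun x : I => iteratedDerivWithin j (fn i) (Icc 0 1) (x : ℝ)) 2 volume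

/-- The characteristic sequence `a_l = 2 ^ l`; at `l = 0` the value is `2` in place of `1`, so that
`log a_l` never vanishes. -/
def charSeq (l : ℕ) : ℝ := max 2 (2 ^ l)

variable {S J₀ m : ℕ}

/-- The coefficient `⟨ψ_{lk}, f⟩`. -/
def coef (B : RegularBasis S J₀ m) (f : L2) (i : WaveletIndex J₀ m) : ℝ := ⟪B.basis i, f⟫

/-- The logarithmic Sobolev norm `‖f‖_{s,2,δ}`, the square root of
`∑_{l,k} a_l ^ (2s) (log a_l) ^ (-2δ) |⟨ψ_{lk}, f⟩|²`, with values in `[0,∞]`. -/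
def sobolevNorm (B : RegularBasis S J₀ m) (s δ : ℝ) (f : L2) : ℝ≥0∞ :=
  (∑' i : WaveletIndex J₀ m,
    ENNReal.ofReal (charSeq i.1.1 ^ (2 * s) / Real.log (charSeq i.1.1) ^ (2 * δ) *
      coef B f i ^ 2)) ^ (1 / 2 : ℝ)

/-- The norm `‖f‖_H` of `H = H(δ)`, the logarithmic Sobolev space with `s = -1/2`, on `L²`. -/
def hNorm (B : RegularBasis S J₀ m) (δ : ℝ) (f : L2) : ℝ≥0∞ := sobolevNorm B (-1 / 2) δ f

/-- The Hölder-type norm `‖f‖_{s,∞} = sup_{l,k} 2 ^ (l (s + 1/2)) |⟨ψ_{lk}, f⟩|`, with values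
in `[0,∞]`. -/
def holderNorm (B : RegularBasis S J₀ m) (s : ℝ) (f : L2) : ℝ≥0∞ :=
  ⨆ i : WaveletIndex J₀ m,
    ENNReal.ofReal ((2 : ℝ) ^ ((i.1.1 : ℝ) * (s + 1 / 2)) * |coef B f i|)

/-! ### The observations -/

theorem measurable_shift (B : RegularBasis S J₀ m) (n : ℕ) :
    Measurable fun p : L2 × (WaveletIndex J₀ m → ℝ) =>
      fun i => coef B p.1 i + (√(n : ℝ))⁻¹ * p.2 i := by
  refine measurable_pi_lambda _ fun i => ?_
  have h : Continuous fun f : L2 => coef B f i := by unfold coef; fun_prop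
  exact (h.measurable.comp measurable_fst).add
    (((measurable_pi_apply i).comp measurable_snd).const_mul _)

/-- The white noise experiment `dX(t) = f(t) dt + n ^ (-1/2) dW(t)`, observed through its action
on the basis: `X_{lk} = ⟨ψ_{lk}, f⟩ + n ^ (-1/2) ε_{lk}` with `ε_{lk}` i.i.d. `N(0,1)`.
Its value at `f` is the law `P_f^n` of the observation. -/
def whiteNoise (B : RegularBasis S J₀ m) (n : ℕ) : Kernel L2 (WaveletIndex J₀ m → ℝ) where
  toFun f := (Measure.infinitePi fun _ : WaveletIndex J₀ m => gaussianReal 0 1).map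
    fun ε i => coef B f i + (√(n : ℝ))⁻¹ * ε i
  measurable' := by
    refine Measure.measurable_of_measurable_coe _ fun s hs => ?_
    have h := measurable_shift B n
    have h' : ∀ f : L2, Measurable fun (ε : WaveletIndex J₀ m → ℝ) i =>
        coef B f i + (√(n : ℝ))⁻¹ * ε i := fun f => h.comp measurable_prodMk_left
    have e : (fun f : L2 => (Measure.infinitePi fun _ : WaveletIndex J₀ m => gaussianReal 0 1).map
        (fun ε i => coef B f i + (√(n : ℝ))⁻¹ * ε i) s) = fun f : L2 =>
        (Measure.infinitePi fun _ : WaveletIndex J₀ m => gaussianReal 0 1)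
          (Prod.mk f ⁻¹' ((fun p : L2 × (WaveletIndex J₀ m → ℝ) =>
            fun i => coef B p.1 i + (√(n : ℝ))⁻¹ * p.2 i) ⁻¹' s)) :=
      funext fun f => Measure.map_apply (h' f) hs
    rw [e]
    exact measurable_measure_prodMk_left (h hs)

instance instIsMarkovKernelWhiteNoise (B : RegularBasis S J₀ m) (n : ℕ) :
    IsMarkovKernel (whiteNoise B n) where
  isProbabilityMeasure _ :=
    Measure.isProbabilityMeasure_map
      ((measurable_shift B n).comp measurable_prodMk_left).aemeasurable

/-! ### The prior and the posterior -/

/-- The random series `G_γ = ∑_{l,k} 2 ^ (-l (γ + 1/2)) g_{lk} ψ_{lk}` in `L²`. -/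
def series (B : RegularBasis S J₀ m) (γ : ℝ) (g : WaveletIndex J₀ m → ℝ) : L2 :=
  ∑' i : WaveletIndex J₀ m, ((2 : ℝ) ^ (-((i.1.1 : ℝ) * (γ + 1 / 2))) * g i) • B.basis i

/-- The prior: the law of `G_γ` when the `g_{lk}` are i.i.d. with law `ν`. -/
def prior (B : RegularBasis S J₀ m) (γ : ℝ) (ν : Measure ℝ) [IsProbabilityMeasure ν] :
    Measure L2 :=
  (Measure.infinitePi fun _ : WaveletIndex J₀ m => ν).map (series B γ)

instance instIsFiniteMeasurePrior (B : RegularBasis S J₀ m) (γ : ℝ) (ν : Measure ℝ)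
    [IsProbabilityMeasure ν] : IsFiniteMeasure (prior B γ ν) := by
  unfold prior; infer_instance

/-- The posterior `Π_n = Π(· | X)`: the (regular) conditional law of `f` given the observation `X`,
when `f` has the prior law and `X` given `f` has law `P_f^n`. -/
def post (B : RegularBasis S J₀ m) (γ : ℝ) (ν : Measure ℝ) [IsProbabilityMeasure ν] (n : ℕ) :
    Kernel (WaveletIndex J₀ m → ℝ) L2 :=
  posterior (whiteNoise B n) (prior B γ ν)

/-- The posterior mean, a Bochner integral in `L²`. -/
def postMean (B : RegularBasis S J₀ m) (γ : ℝ) (ν : Measure ℝ) [IsProbabilityMeasure ν] (n : ℕ)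
    (x : WaveletIndex J₀ m → ℝ) : L2 :=
  ∫ f, f ∂(post B γ ν n x)

/-! ### The credible set -/

/-- The ball of `H(δ)` centred at the posterior mean, of radius `r / √n`, intersected with `L²`. -/
def credBall (B : RegularBasis S J₀ m) (γ δ : ℝ) (ν : Measure ℝ) [IsProbabilityMeasure ν] (n : ℕ)
    (x : WaveletIndex J₀ m → ℝ) (r : ℝ) : Set L2 :=
  {f | hNorm B δ (f - postMean B γ ν n x) ≤ ENNReal.ofReal (r / √(n : ℝ))}

/-- The posterior-based bound `M_n`: the infimum of all `M > 0` with
`Π_n(f : |‖f‖_{γ,2,1} - M| ≤ η) ≥ 1 - (log n) ^ (-1/4)`; it is `∞` if there is no such `M`. -/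
def normBound (B : RegularBasis S J₀ m) (γ η : ℝ) (ν : Measure ℝ) [IsProbabilityMeasure ν] (n : ℕ)
    (x : WaveletIndex J₀ m → ℝ) : ℝ≥0∞ :=
  sInf (ENNReal.ofReal '' {M : ℝ | 0 < M ∧
    1 - Real.log n ^ (-(1 / 4) : ℝ) ≤ (post B γ ν n x).real
      {f | sobolevNorm B γ 1 f ≠ ∞ ∧ |(sobolevNorm B γ 1 f).toReal - M| ≤ η}})

/-- The credible set `C''_n`: all `f` with `‖f‖_{γ,2,1} ≤ M_n + 4η` in the credible ball of
radius `r / √n`. -/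
def credSet (B : RegularBasis S J₀ m) (γ δ η : ℝ) (ν : Measure ℝ) [IsProbabilityMeasure ν] (n : ℕ)
    (x : WaveletIndex J₀ m → ℝ) (r : ℝ) : Set L2 :=
  {f | sobolevNorm B γ 1 f ≤ normBound B γ η ν n x + ENNReal.ofReal (4 * η)} ∩
    credBall B γ δ ν n x r

/-! ### Stochastic order symbols -/

/-- `Y_n = O_P(r_n)` for `[0,∞]`-valued `Y_n` under `P_n`, as `n → ∞`. -/
def IsBigOP {Ω : Type*} [MeasurableSpace Ω] (P : ℕ → Measure Ω) (Y : ℕ → Ω → ℝ≥0∞)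
    (r : ℕ → ℝ) : Prop :=
  ∀ ε : ℝ≥0∞, 0 < ε → ∃ K : ℝ, ∀ᶠ n in atTop, P n {ω | ENNReal.ofReal (K * r n) < Y n ω} ≤ ε

/-- `Y_n → c` in `P_n`-probability, as `n → ∞`. -/
def TendstoInProb {Ω : Type*} [MeasurableSpace Ω] (P : ℕ → Measure Ω) (Y : ℕ → Ω → ℝ)
    (c : ℝ) : Prop :=
  ∀ ε : ℝ, 0 < ε → Tendsto (fun n => P n {ω | ε ≤ |Y n ω - c|}) atTop (𝓝 0)

end WhiteNoise

end

/-! The prior coefficients and the noise are independent across the basis, so the posterior is a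
product over coordinates and the analysis is one-dimensional, with signal-to-noise ratio t = √n
2^(-l(γ+1/2)). A conditional law is determined only up to null sets of the marginal law of the data.
Since P_{f₀} is absolutely continuous with respect to P_f for every f in L² (Cameron–Martin), it is
so with respect to that marginal law, and `ae_post_eq` identifies the posterior almost surely under
f₀.

Bernstein–von Mises. In the local coordinate u = t(g - g₀) - ε, which is √n times the coefficient of
f minus its observation, the posterior is N(0,1) reweighted by φ(g₀ + (u + ε)/t). As t → ∞ this
weight flattens, so cylinder probabilities become Gaussian and local means tend to 0. The bound
`tiltRisk_le` controls the expected local second moments uniformly over coordinates, and the weights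
of the H-norm are summable because δ > 1/2. The tails are thus uniformly small, and the posterior
masses of H-balls about the posterior mean converge in probability to Gaussian masses
(`AsympGaussian.negligible_kernelBall_sub` and `AsympGaussian.negligible_sub_kernelBall`). The norm
of the Gaussian limit has no atoms, so R_n is pinned to a quantile; f₀ lies in the ball when ‖ε +
o_P(1)‖ ≤ R_n, which has probability tending to 1 - α (`AsympGaussian.tendsto_coverage`).

Norm constraint. Summing min(1, t^(-2)) against the weights of ‖·‖_{γ,2,1} gives an expected
posterior risk of order (log n)^(-1/2). By Markov's inequality, used twice, the posterior mass at
distance at least η/2 from f₀ is at most (log n)^(-1/4), with probability tending to one. On that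
event M_n lies between ‖f₀‖ - 2η and ‖f₀‖ + η/2 (`normBound_of_post_le`), so the constraint holds at
f₀ and removes a vanishing part of the posterior mass.

Diameter. Two points of the credible set differ by O(n^(-1/2)) in the H-norm and by O(1) in
‖·‖_{γ,2,1}. Cutting the levels where 2^L = n^(1/(2γ+1)) interpolates the L² norm between the two
(`exists_norm_le_of_sobolevNorm_le`). -/

noncomputable section

namespace WhiteNoise

/-! ### Infinite product measures -/

section Product

variable {ι : Type*}

theorem lintegral_infinitePi_prod {X : ι → Type*} [∀ i, MeasurableSpace (X i)]
    (μ : ∀ i, Measure (X i)) [∀ i, IsProbabilityMeasure (μ i)] (s : Finset ι)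
    (f : ∀ i, X i → ℝ≥0∞) (hf : ∀ i, Measurable (f i)) :
    ∫⁻ x, ∏ i ∈ s, f i (x i) ∂(Measure.infinitePi μ) = ∏ i ∈ s, ∫⁻ a, f i a ∂(μ i) := by
  rw [lintegral_prod_eq_prod_lintegral_of_indepFun s (fun i (x : ∀ i, X i) => f i (x i))
    (iIndepFun_infinitePi hf) fun i => (hf i).comp (measurable_pi_apply i)]
  refine Finset.prod_congr rfl fun i _ => ?_
  exact (measurePreserving_eval_infinitePi μ i).lintegral_comp (hf i)

theorem lintegral_infinitePi_eval {X : ι → Type*} [∀ i, MeasurableSpace (X i)]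
    (μ : ∀ i, Measure (X i)) [∀ i, IsProbabilityMeasure (μ i)] (i : ι)
    {f : X i → ℝ≥0∞} (hf : Measurable f) :
    ∫⁻ x, f (x i) ∂(Measure.infinitePi μ) = ∫⁻ a, f a ∂(μ i) :=
  (measurePreserving_eval_infinitePi μ i).lintegral_comp hf

theorem measurable_update_prod [DecidableEq ι] (j : ι) :
    Measurable fun p : ℝ × (ι → ℝ) => Function.update p.2 j p.1 := by
  refine measurable_pi_lambda _ fun i => ?_
  by_cases h : i = j
  · subst h; simpa using measurable_fst
  · simp only [Function.update_of_ne h]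
    exact (measurable_pi_apply i).comp measurable_snd

/-- Resampling one coordinate independently preserves a product measure. -/
theorem map_update_infinitePi [DecidableEq ι] (μ : ι → Measure ℝ)
    [∀ i, IsProbabilityMeasure (μ i)] (j : ι) :
    ((μ j).prod (Measure.infinitePi μ)).map (fun p => Function.update p.2 j p.1) =
      Measure.infinitePi μ := by
  have hm := measurable_update_prod (ι := ι) j
  refine Measure.eq_infinitePi μ fun s t ht => ?_
  rw [Measure.map_apply hm (.pi s.countable_toSet fun i _ => ht i)]
  by_cases hj : j ∈ s
  · have : (fun p : ℝ × (ι → ℝ) => Function.update p.2 j p.1) ⁻¹' ((s : Set ι).pi t) =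
        t j ×ˢ ((s.erase j : Finset ι) : Set ι).pi t := by
      ext p
      simp only [mem_preimage, Set.mem_pi, Finset.mem_coe, mem_prod, Finset.mem_erase]
      constructor
      · intro h
        refine ⟨by simpa using h j hj, fun i hi => ?_⟩
        simpa [Function.update_of_ne hi.1] using h i hi.2
      · rintro ⟨h1, h2⟩ i hi
        by_cases h : i = j
        · subst h; simpa using h1
        · simpa [Function.update_of_ne h] using h2 i ⟨h, hi⟩
    rw [this, Measure.prod_prod, Measure.infinitePi_pi _ fun i _ => ht i,
      Finset.mul_prod_erase s (fun i => μ i (t i)) hj]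
  · have : (fun p : ℝ × (ι → ℝ) => Function.update p.2 j p.1) ⁻¹' ((s : Set ι).pi t) =
        univ ×ˢ (s : Set ι).pi t := by
      ext p
      simp only [mem_preimage, Set.mem_pi, Finset.mem_coe, mem_prod, mem_univ, true_and]
      refine forall₂_congr fun i hi => ?_
      rw [Function.update_of_ne (ne_of_mem_of_not_mem hi hj)]
    rw [this, Measure.prod_prod, Measure.infinitePi_pi _ fun i _ => ht i]
    simp

/-- Fubini in one coordinate: the others are frozen while `z j` is integrated, without splitting `ι`
into `{j}` and its complement. -/
theorem lintegral_infinitePi_update [DecidableEq ι] (μ : ι → Measure ℝ)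
    [∀ i, IsProbabilityMeasure (μ i)] (j : ι) {f : (ι → ℝ) → ℝ≥0∞} (hf : Measurable f) :
    ∫⁻ z, f z ∂(Measure.infinitePi μ) =
      ∫⁻ z, ∫⁻ a, f (Function.update z j a) ∂(μ j) ∂(Measure.infinitePi μ) := by
  conv_lhs => rw [← map_update_infinitePi μ j]
  rw [lintegral_map hf (measurable_update_prod j), lintegral_prod_symm]
  exact (hf.comp (measurable_update_prod j)).aemeasurable

/-- A weighted sum of squares of independent coordinates has no atoms. -/
theorem infinitePi_sum_sq_eq_null [Countable ι] (μ : ι → Measure ℝ)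
    [∀ i, IsProbabilityMeasure (μ i)] (j : ι) [NullSingletonClass (μ j)] (w v : ι → ℝ)
    (hw : 0 < w j)
    (c : ℝ≥0∞) (hc : c ≠ ∞) :
    Measure.infinitePi μ {z | ∑' i, ENNReal.ofReal (w i * (z i - v i) ^ 2) = c} = 0 := by
  classical
  obtain ⟨S, hS⟩ : ∃ S : (ι → ℝ) → ℝ≥0∞,
    S = fun z => ∑' i, ENNReal.ofReal (w i * (z i - v i) ^ 2) := ⟨_, rfl⟩
  have hSm : Measurable S := by rw [hS]; fun_prop
  have hA : MeasurableSet {z | S z = c} := hSm (measurableSet_singleton c)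
  suffices h : Measure.infinitePi μ {z | S z = c} = 0 by rw [hS] at h; exact h
  rw [← lintegral_indicator_one hA, lintegral_infinitePi_update μ j (measurable_one.indicator hA)]
  refine lintegral_eq_zero_of_ae_eq_zero (ae_of_all _ fun z => ?_)
  -- With the other coordinates frozen in `T`, the level set is the solution set of a quadratic
  -- equation in `a`: at most two points, hence null. If `T = ∞` it is empty, since `c` is finite.
  obtain ⟨T, hT⟩ : ∃ T : ℝ≥0∞,
    T = ∑' i, if i = j then 0 else ENNReal.ofReal (w i * (z i - v i) ^ 2) := ⟨_, rfl⟩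
  have key : ∀ a, S (Function.update z j a) = ENNReal.ofReal (w j * (a - v j) ^ 2) + T := by
    intro a
    rw [hS, hT]
    beta_reduce
    have := ENNReal.tsum_eq_add_tsum_ite
      (f := fun i => ENNReal.ofReal (w i * (Function.update z j a i - v i) ^ 2)) j
    rw [this, Function.update_self]
    refine congrArg _ ?_
    refine tsum_congr fun i => ?_
    by_cases h : i = j
    · simp [h]
    · simp [h]
  have hfin : Set.Finite {a : ℝ | ENNReal.ofReal (w j * (a - v j) ^ 2) + T = c} := by
    refine Set.Finite.subset (s := {v j + √((c - T).toReal / w j), v j - √((c - T).toReal / w j)})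
      (by simp) fun a ha => ?_
    have ha' : ENNReal.ofReal (w j * (a - v j) ^ 2) + T = c := ha
    have hTt : T ≠ ∞ := fun h => hc (by rw [← ha', h, add_top])
    have h1 : ENNReal.ofReal (w j * (a - v j) ^ 2) = c - T := by
      rw [← ha', ENNReal.add_sub_cancel_right hTt]
    have h2 : w j * (a - v j) ^ 2 = (c - T).toReal := by
      rw [← h1, ENNReal.toReal_ofReal (by positivity)]
    have h3 : (c - T).toReal / w j = (a - v j) ^ 2 := by rw [← h2]; field_simp
    rw [h3, Real.sqrt_sq_eq_abs]
    rcases abs_cases (a - v j) with h | h <;> rw [h.1]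
    · left; ring
    · right; simp
  have : ∀ a, ({z | S z = c}.indicator (1 : (ι → ℝ) → ℝ≥0∞)) (Function.update z j a) =
      {a : ℝ | ENNReal.ofReal (w j * (a - v j) ^ 2) + T = c}.indicator 1 a := by
    intro a
    simp only [indicator_apply, mem_ofPred_eq, key, Pi.one_apply]
  simp_rw [this]
  rw [lintegral_indicator_one hfin.measurableSet, Pi.zero_apply]
  exact hfin.measure_zero _

/-- It is enough to look at square cylinders, a generating π-system on which the product measure is
a finite product. -/
theorem measurable_infinitePi {X : Type*} [MeasurableSpace X] (ρ : ι → Kernel X ℝ)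
    [∀ i, IsMarkovKernel (ρ i)] :
    Measurable fun x : ι → X => Measure.infinitePi fun i => ρ i (x i) := by
  refine Measurable.measure_of_isPiSystem_of_isProbabilityMeasure
    (generateFrom_squareCylinders (α := fun _ : ι => ℝ)).symm
    (isPiSystem_squareCylinders (fun _ => MeasurableSpace.isPiSystem_measurableSet)
      (fun _ => MeasurableSet.univ (α := ℝ))) ?_
  rintro _ ⟨s, t, ht, rfl⟩
  have ht' : ∀ i, MeasurableSet (t i) := fun i => ht i (mem_univ i)
  simp_rw [Measure.infinitePi_pi _ fun i _ => ht' i]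
  exact Finset.measurable_fun_prod _ fun i _ =>
    ((ρ i).measurable_coe (ht' i)).comp (measurable_pi_apply i)

/-- The product of the Markov kernels `ρ i`, the `i`-th one depending on the `i`-th coordinate. -/
def prodKernel {X : Type*} [MeasurableSpace X] (ρ : ι → Kernel X ℝ)
    [∀ i, IsMarkovKernel (ρ i)] : Kernel (ι → X) (ι → ℝ) where
  toFun x := Measure.infinitePi fun i => ρ i (x i)
  measurable' := measurable_infinitePi ρ

instance {X : Type*} [MeasurableSpace X] (ρ : ι → Kernel X ℝ)
    [∀ i, IsMarkovKernel (ρ i)] : IsMarkovKernel (prodKernel ρ) where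
  isProbabilityMeasure x := by
    change IsProbabilityMeasure (Measure.infinitePi fun i => ρ i (x i))
    infer_instance

theorem prodKernel_apply {X : Type*} [MeasurableSpace X] (ρ : ι → Kernel X ℝ)
    [∀ i, IsMarkovKernel (ρ i)] (x : ι → X) :
    prodKernel ρ x = Measure.infinitePi fun i => ρ i (x i) := rfl

end Product

/-! ### Shifts of Gaussian product measures -/

section Shift

variable {ι : Type*}

/-- The standard Gaussian measure on `ℝ ^ ι`. -/
abbrev stdGaussian (ι : Type*) : Measure (ι → ℝ) :=
  Measure.infinitePi fun _ : ι => gaussianReal 0 1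

theorem lintegral_gaussianReal_eq (f : ℝ → ℝ≥0∞) :
    ∫⁻ x, f x ∂(gaussianReal 0 1) =
      ENNReal.ofReal (√(2 * Real.pi))⁻¹ * ∫⁻ x, ENNReal.ofReal (Real.exp (-x ^ 2 / 2)) * f x := by
  rw [gaussianReal_of_var_ne_zero _ one_ne_zero,
    lintegral_withDensity_eq_lintegral_mul_non_measurable _ (measurable_gaussianPDF 0 1)
      (ae_of_all _ fun x => gaussianPDF_lt_top),
    ← lintegral_const_mul' _ _ ENNReal.ofReal_ne_top]
  refine lintegral_congr fun x => ?_
  simp only [Pi.mul_apply, gaussianPDF, gaussianPDFReal_def, sub_zero, NNReal.coe_one, mul_one]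
  rw [ENNReal.ofReal_mul (by positivity), mul_assoc]

theorem lintegral_gaussianReal_shift {f : ℝ → ℝ≥0∞} (h : ℝ) :
    ∫⁻ x, f (x + h) ∂(gaussianReal 0 1) =
      ∫⁻ x, f x * ENNReal.ofReal (Real.exp (h * x - h ^ 2 / 2)) ∂(gaussianReal 0 1) := by
  rw [lintegral_gaussianReal_eq, lintegral_gaussianReal_eq,
    ← lintegral_sub_right_eq_self _ h]
  congr 1
  refine lintegral_congr fun x => ?_
  rw [sub_add_cancel, mul_comm (f x), ← mul_assoc, ← ENNReal.ofReal_mul (Real.exp_pos _).le,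
    ← Real.exp_add]
  congr 4
  ring

/-- The vector that agrees with `h` on `F` and vanishes off `F`. -/
def cutoff [DecidableEq ι] (F : Finset ι) (h : ι → ℝ) : ι → ℝ := fun i => if i ∈ F then h i else 0

/-- The density of the shift by `cutoff F h`. -/
def shiftDensity (F : Finset ι) (h : ι → ℝ) (z : ι → ℝ) : ℝ≥0∞ :=
  ∏ i ∈ F, ENNReal.ofReal (Real.exp (h i * z i - h i ^ 2 / 2))

theorem measurable_shiftDensity (F : Finset ι) (h : ι → ℝ) : Measurable (shiftDensity F h) := by
  unfold shiftDensity; fun_prop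

/-- The Cameron–Martin formula in finitely many coordinates. Each induction step freezes all
coordinates but the new one and uses the shift formula on the line. -/
theorem lintegral_shift_cutoff [DecidableEq ι] (F : Finset ι) (h : ι → ℝ)
    {f : (ι → ℝ) → ℝ≥0∞} (hf : Measurable f) :
    ∫⁻ z, f (z + cutoff F h) ∂(stdGaussian ι) =
      ∫⁻ z, f z * shiftDensity F h z ∂(stdGaussian ι) := by
  induction F using Finset.induction_on generalizing f with
  | empty =>
    have : cutoff (∅ : Finset ι) h = 0 := by ext; simp [cutoff]
    simp [this, shiftDensity]
  | insert j F hj ih =>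
    have e : ∀ z : ι → ℝ, z + cutoff (insert j F) h =
        (fun z => z + Pi.single j (h j)) (z + cutoff F h) := by
      intro z; ext i
      by_cases hij : i = j
      · subst hij; simp [cutoff, hj]
      · simp [cutoff, hij]
    simp_rw [e]
    have hm : Measurable fun z : ι → ℝ => z + Pi.single j (h j) := by fun_prop
    refine (ih (f := fun z => f (z + Pi.single j (h j))) (hf.comp hm)).trans ?_
    have hS : ∀ (z : ι → ℝ) (a : ℝ), shiftDensity F h (Function.update z j a) =
        shiftDensity F h z := by
      intro z a
      refine Finset.prod_congr rfl fun i hi => ?_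
      rw [Function.update_of_ne (ne_of_mem_of_not_mem hi hj)]
    have hfm : Measurable fun z : ι → ℝ => f (z + (Pi.single j (h j) : ι → ℝ)) :=
      hf.comp hm
    rw [lintegral_infinitePi_update
      (f := fun z => f (z + (Pi.single j (h j) : ι → ℝ)) * shiftDensity F h z) _ j
        (hfm.mul (measurable_shiftDensity F h)),
      lintegral_infinitePi_update (f := fun z => f z * shiftDensity (insert j F) h z) _ j
        (hf.mul (measurable_shiftDensity _ h))]
    refine lintegral_congr fun z => ?_
    have e2 : ∀ a, Function.update z j a + Pi.single j (h j) = Function.update z j (a + h j) := by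
      intro a; ext i
      by_cases hij : i = j
      · subst hij; simp
      · simp [hij]
    have e3 : ∀ a, shiftDensity (insert j F) h (Function.update z j a) =
        ENNReal.ofReal (Real.exp (h j * a - h j ^ 2 / 2)) * shiftDensity F h z := by
      intro a
      rw [shiftDensity, Finset.prod_insert hj, Function.update_self, ← hS z a, shiftDensity]
    simp only [e2, hS, e3]
    rw [lintegral_gaussianReal_shift
      (f := fun a => f (Function.update z j a) * shiftDensity F h z)]
    refine lintegral_congr fun a => ?_
    ring

theorem lintegral_shiftDensity (F : Finset ι) (h : ι → ℝ) :
    ∫⁻ z, shiftDensity F h z ∂(stdGaussian ι) = 1 := by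
  classical
  have := lintegral_shift_cutoff F h (f := fun _ => 1) measurable_const
  simpa using this.symm

/-- Shifting by `cutoff F h` multiplies the density by a constant, so one factor is absorbed by
moving the measure. The value depends on `h` only through `∑ h i ^ 2`, which stays bounded as `F`
exhausts `ι`. -/
theorem lintegral_shiftDensity_sq (F : Finset ι) (h : ι → ℝ) :
    ∫⁻ z, shiftDensity F h z * shiftDensity F h z ∂(stdGaussian ι) =
      ENNReal.ofReal (Real.exp (∑ i ∈ F, h i ^ 2)) := by
  classical
  rw [← lintegral_shift_cutoff F h (measurable_shiftDensity F h)]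
  have : ∀ z : ι → ℝ, shiftDensity F h (z + cutoff F h) =
      ENNReal.ofReal (Real.exp (∑ i ∈ F, h i ^ 2)) * shiftDensity F h z := by
    intro z
    simp only [shiftDensity]
    rw [Real.exp_sum, ENNReal.ofReal_prod_of_nonneg (fun i _ => (Real.exp_pos _).le),
      ← Finset.prod_mul_distrib]
    refine Finset.prod_congr rfl fun i hi => ?_
    rw [← ENNReal.ofReal_mul (Real.exp_pos _).le, ← Real.exp_add]
    simp only [Pi.add_apply, cutoff, hi, if_true]
    congr 2; ring
  simp_rw [this]
  rw [lintegral_const_mul _ (measurable_shiftDensity F h), lintegral_shiftDensity, mul_one]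

/-- Cauchy–Schwarz against the shift density. The constant is uniform in `F`, so this quantitative
form of absolute continuity survives the passage to infinitely many coordinates. -/
theorem measure_shift_cutoff_le [DecidableEq ι] (F : Finset ι) (h : ι → ℝ) {K : ℝ}
    (hK : ∑ i ∈ F, h i ^ 2 ≤ K) {A : Set (ι → ℝ)} (hA : MeasurableSet A) :
    stdGaussian ι {z | z + cutoff F h ∈ A} ≤
      ENNReal.ofReal (Real.exp K) ^ (1 / 2 : ℝ) * stdGaussian ι A ^ (1 / 2 : ℝ) := by
  have hm : Measurable fun z : ι → ℝ => z + cutoff F h := by fun_prop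
  have h1 : stdGaussian ι {z | z + cutoff F h ∈ A} =
      ∫⁻ z, (shiftDensity F h * A.indicator (1 : (ι → ℝ) → ℝ≥0∞)) z ∂(stdGaussian ι) := by
    have := lintegral_shift_cutoff F h (f := A.indicator 1) (measurable_one.indicator hA)
    rw [← lintegral_indicator_one (show MeasurableSet {z | z + cutoff F h ∈ A} from hm hA)]
    simp only [Pi.mul_apply]
    simp_rw [mul_comm (shiftDensity F h _)]
    rw [← this]
    rfl
  rw [h1]
  refine (ENNReal.lintegral_mul_le_Lp_mul_Lq _ Real.HolderConjugate.two_two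
    (measurable_shiftDensity F h).aemeasurable
    (measurable_one.indicator hA).aemeasurable).trans ?_
  gcongr
  · simp only [ENNReal.rpow_two, sq]
    rw [lintegral_shiftDensity_sq]
    gcongr
  · rw [← lintegral_indicator_one hA]
    refine lintegral_mono fun z => ?_
    by_cases hz : z ∈ A <;> simp [hz]

/-- Square summable shifts of the standard Gaussian measure on `ℝ ^ ι` are absolutely
continuous with respect to it. -/
theorem map_shift_stdGaussian_absolutelyContinuous [Countable ι] {h : ι → ℝ}
    (hh : Summable fun i => h i ^ 2) :
    (stdGaussian ι).map (fun z => z + h) ≪ stdGaussian ι := by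
  classical
  set K := ∑' i, h i ^ 2
  set C : ℝ≥0∞ := ENNReal.ofReal (Real.exp K) ^ (1 / 2 : ℝ) with hC
  have hCt : C ≠ ∞ := ENNReal.rpow_ne_top_of_nonneg (by norm_num) ENNReal.ofReal_ne_top
  have hm : Measurable fun z : ι → ℝ => z + h := by fun_prop
  -- For open sets the uniform bound passes to the full shift: the indicator is lower semicontinuous
  -- along `z + cutoff F h → z + h`, and Fatou's lemma applies. Outer regularity then reaches null
  -- sets.
  have hopen : ∀ U : Set (ι → ℝ), IsOpen U →
      stdGaussian ι {z | z + h ∈ U} ≤ C * stdGaussian ι U ^ (1 / 2 : ℝ) := by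
    intro U hU
    have hlim : ∀ z : ι → ℝ, Tendsto (fun F : Finset ι => z + cutoff F h) atTop (𝓝 (z + h)) := by
      intro z
      refine tendsto_const_nhds.add (tendsto_pi_nhds.2 fun i => ?_)
      refine tendsto_const_nhds.congr' ?_
      filter_upwards [eventually_ge_atTop {i}] with F hF
      simp [cutoff, Finset.singleton_subset_iff.1 hF]
    calc stdGaussian ι {z | z + h ∈ U}
        = ∫⁻ z, U.indicator 1 (z + h) ∂(stdGaussian ι) := by
          rw [← lintegral_indicator_one
            (show MeasurableSet {z | z + h ∈ U} from hm hU.measurableSet)]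
          rfl
      _ ≤ ∫⁻ z, liminf (fun F : Finset ι => U.indicator 1 (z + cutoff F h)) atTop
            ∂(stdGaussian ι) := by
          refine lintegral_mono fun z => ?_
          by_cases hz : z + h ∈ U
          · have : (fun F : Finset ι => U.indicator (1 : (ι → ℝ) → ℝ≥0∞) (z + cutoff F h))
                =ᶠ[atTop] fun _ => 1 := by
              filter_upwards [(hlim z).eventually (hU.mem_nhds hz)] with F hF
              rw [indicator_of_mem hF]; rfl
            rw [liminf_congr this]
            simp [hz]
          · simp [hz]
      _ ≤ liminf (fun F : Finset ι => ∫⁻ z, U.indicator 1 (z + cutoff F h) ∂(stdGaussian ι))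
            atTop := by
          refine lintegral_liminf_le' fun F => ?_
          exact ((measurable_one.indicator hU.measurableSet).comp
            (by fun_prop : Measurable fun z : ι → ℝ => z + cutoff F h)).aemeasurable
      _ ≤ C * stdGaussian ι U ^ (1 / 2 : ℝ) := by
          refine liminf_le_of_frequently_le' (Frequently.of_forall fun F => ?_)
          have : Measurable fun z : ι → ℝ => z + cutoff F h := by fun_prop
          refine le_trans (le_of_eq ?_) (measure_shift_cutoff_le F h
            (hh.sum_le_tsum F fun i _ => sq_nonneg _) hU.measurableSet)
          rw [← lintegral_indicator_one
            (show MeasurableSet {z | z + cutoff F h ∈ U} from this hU.measurableSet)]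
          rfl
  refine Measure.AbsolutelyContinuous.mk fun A hA hA0 => ?_
  rw [Measure.map_apply hm hA]
  refine le_antisymm (ENNReal.le_of_forall_pos_le_add fun e he _ => ?_) bot_le
  rw [zero_add]
  -- The mass of `U` below which `C * μ U ^ (1/2)` is at most `e`.
  have hpos : 0 < ((e : ℝ≥0∞) / C) ^ (2 : ℝ) := by
    refine ENNReal.rpow_pos (ENNReal.div_pos (by simpa using he.ne') hCt) ?_
    refine ENNReal.div_ne_top ENNReal.coe_ne_top ?_
    rw [hC]
    exact (ENNReal.rpow_pos (by simpa using Real.exp_pos K) ENNReal.ofReal_ne_top).ne'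
  obtain ⟨U, hAU, hU, hUlt⟩ := A.exists_isOpen_lt_of_lt (μ := stdGaussian ι)
    (((e : ℝ≥0∞) / C) ^ (2 : ℝ)) (hA0 ▸ hpos)
  calc stdGaussian ι ((fun z => z + h) ⁻¹' A) ≤ stdGaussian ι {z | z + h ∈ U} :=
        measure_mono fun z hz => hAU hz
    _ ≤ C * stdGaussian ι U ^ (1 / 2 : ℝ) := hopen U hU
    _ ≤ C * (((e : ℝ≥0∞) / C) ^ (2 : ℝ)) ^ (1 / 2 : ℝ) := by gcongr
    _ = C * ((e : ℝ≥0∞) / C) := by rw [← ENNReal.rpow_mul]; norm_num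
    _ ≤ e := ENNReal.mul_div_le

end Shift

/-! ### Gaussian tilts -/

section Tilt

/-- The likelihood of `g` for the observation `y ∼ N(t g, 1)`, up to a constant. -/
def tiltWeight (t y g : ℝ) : ℝ≥0∞ := ENNReal.ofReal (Real.exp (-(y - t * g) ^ 2 / 2))

theorem measurable_tiltWeight (t : ℝ) : Measurable fun p : ℝ × ℝ => tiltWeight t p.1 p.2 := by
  unfold tiltWeight; fun_prop

theorem measurable_tiltWeight_swap (t : ℝ) :
    Measurable fun p : ℝ × ℝ => tiltWeight t p.2 p.1 := by
  unfold tiltWeight; fun_prop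

theorem measurable_tiltWeight_right (t y : ℝ) : Measurable (tiltWeight t y) := by
  unfold tiltWeight; fun_prop

theorem tiltWeight_pos (t y g : ℝ) : 0 < tiltWeight t y g := by
  simp [tiltWeight, Real.exp_pos]

theorem tiltWeight_le_one (t y g : ℝ) : tiltWeight t y g ≤ 1 := by
  unfold tiltWeight
  rw [ENNReal.ofReal_le_one, Real.exp_le_one_iff]
  have := sq_nonneg (y - t * g)
  linarith

theorem lintegral_gaussianReal_add (a : ℝ) (h : ℝ → ℝ≥0∞) :
    ∫⁻ e, h (a + e) ∂(gaussianReal 0 1) =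
      ENNReal.ofReal (√(2 * Real.pi))⁻¹ *
        ∫⁻ y, ENNReal.ofReal (Real.exp (-(y - a) ^ 2 / 2)) * h y := by
  rw [lintegral_gaussianReal_eq, ← lintegral_sub_right_eq_self _ a]
  simp only [add_sub_cancel]

theorem lintegral_gaussianReal_mul_add (t g : ℝ) (h : ℝ → ℝ≥0∞) :
    ∫⁻ e, h (t * g + e) ∂(gaussianReal 0 1) =
      ENNReal.ofReal (√(2 * Real.pi))⁻¹ * ∫⁻ y, tiltWeight t y g * h y := by
  simp only [tiltWeight]
  exact lintegral_gaussianReal_add (t * g) h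

variable (ν : Measure ℝ) [IsProbabilityMeasure ν]

/-- The marginal likelihood of `y`. -/
def tiltMass (t y : ℝ) : ℝ≥0∞ := ∫⁻ g, tiltWeight t y g ∂ν

theorem measurable_tiltMass (t : ℝ) : Measurable (tiltMass ν t) :=
  (measurable_tiltWeight t).lintegral_prod_right'

theorem tiltMass_ne_zero (t y : ℝ) : tiltMass ν t y ≠ 0 := by
  have h : Function.support (tiltWeight t y) = univ :=
    eq_univ_of_forall fun g => (tiltWeight_pos t y g).ne'
  have := (lintegral_pos_iff_support (μ := ν) (measurable_tiltWeight_right t y)).2 (by simp [h])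
  exact this.ne'

theorem tiltMass_ne_top (t y : ℝ) : tiltMass ν t y ≠ ∞ := by
  refine ((lintegral_mono fun g => tiltWeight_le_one t y g).trans_lt ?_).ne
  simp

/-- The posterior of `g`, with prior `ν`, given `y ∼ N(t g, 1)`. -/
def tilt (t : ℝ) : Kernel ℝ ℝ where
  toFun y := (tiltMass ν t y)⁻¹ • ν.withDensity (tiltWeight t y)
  measurable' := by
    refine Measure.measurable_of_measurable_coe _ fun s hs => ?_
    simp only [Measure.smul_apply, withDensity_apply _ hs, smul_eq_mul]
    exact (measurable_tiltMass ν t).inv.mul (measurable_tiltWeight t).lintegral_prod_right'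

theorem tilt_apply (t y : ℝ) :
    tilt ν t y = (tiltMass ν t y)⁻¹ • ν.withDensity (tiltWeight t y) := rfl

instance (t : ℝ) : IsMarkovKernel (tilt ν t) where
  isProbabilityMeasure y := ⟨by
    rw [tilt_apply, Measure.smul_apply, withDensity_apply _ MeasurableSet.univ, setLIntegral_univ,
      smul_eq_mul]
    exact ENNReal.inv_mul_cancel (tiltMass_ne_zero ν t y) (tiltMass_ne_top ν t y)⟩

theorem lintegral_tilt (t y : ℝ) (f : ℝ → ℝ≥0∞) :
    ∫⁻ g, f g ∂(tilt ν t y) = (tiltMass ν t y)⁻¹ * ∫⁻ g, tiltWeight t y g * f g ∂ν := by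
  rw [tilt_apply, lintegral_smul_measure, smul_eq_mul,
    lintegral_withDensity_eq_lintegral_mul_non_measurable _ (measurable_tiltWeight_right t y)
      (ae_of_all _ fun g => (tiltWeight_le_one t y g).trans_lt ENNReal.one_lt_top)]
  rfl

theorem tilt_absolutelyContinuous (t y : ℝ) : tilt ν t y ≪ ν :=
  (withDensity_absolutelyContinuous _ _).smul_left _

/-- Bayes' formula for a single coordinate. -/
theorem lintegral_bayes (t : ℝ) {f : ℝ × ℝ → ℝ≥0∞} (hf : Measurable f) :
    ∫⁻ g, ∫⁻ e, f (t * g + e, g) ∂(gaussianReal 0 1) ∂ν =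
      ∫⁻ g, ∫⁻ e, ∫⁻ g', f (t * g + e, g') ∂(tilt ν t (t * g + e)) ∂(gaussianReal 0 1) ∂ν := by
  have h1 : ∀ g, ∫⁻ e, f (t * g + e, g) ∂(gaussianReal 0 1) =
      ENNReal.ofReal (√(2 * Real.pi))⁻¹ * ∫⁻ y, tiltWeight t y g * f (y, g) := fun g =>
    lintegral_gaussianReal_mul_add t g fun y => f (y, g)
  have h2 : ∀ g, ∫⁻ e, ∫⁻ g', f (t * g + e, g') ∂(tilt ν t (t * g + e)) ∂(gaussianReal 0 1) =
      ENNReal.ofReal (√(2 * Real.pi))⁻¹ *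
        ∫⁻ y, tiltWeight t y g * ∫⁻ g', f (y, g') ∂(tilt ν t y) := fun g =>
    lintegral_gaussianReal_mul_add t g fun y => ∫⁻ g', f (y, g') ∂(tilt ν t y)
  have hm : Measurable fun y => ∫⁻ g', f (y, g') ∂(tilt ν t y) :=
    hf.lintegral_kernel_prod_right'
  have hw := measurable_tiltWeight_swap t
  have h3 : Measurable fun p : ℝ × ℝ => tiltWeight t p.2 p.1 * f (p.2, p.1) :=
    hw.mul (hf.comp measurable_swap)
  have h4 : Measurable fun p : ℝ × ℝ =>
      tiltWeight t p.2 p.1 * ∫⁻ g', f (p.2, g') ∂(tilt ν t p.2) :=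
    hw.mul (hm.comp measurable_snd)
  have h5 : ∫⁻ g, ∫⁻ y, tiltWeight t y g * f (y, g) ∂volume ∂ν =
      ∫⁻ y, ∫⁻ g, tiltWeight t y g * f (y, g) ∂ν :=
    lintegral_lintegral_swap (f := fun g y => tiltWeight t y g * f (y, g)) h3.aemeasurable
  have h6 : ∫⁻ g, ∫⁻ y, tiltWeight t y g * (∫⁻ g', f (y, g') ∂(tilt ν t y)) ∂volume ∂ν =
      ∫⁻ y, ∫⁻ g, tiltWeight t y g * (∫⁻ g', f (y, g') ∂(tilt ν t y)) ∂ν :=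
    lintegral_lintegral_swap
      (f := fun g y => tiltWeight t y g * ∫⁻ g', f (y, g') ∂(tilt ν t y)) h4.aemeasurable
  -- After Tonelli both sides are integrals over the observation `y`, and integrating the likelihood
  -- over the prior gives the `tiltMass` that cancels the normalisation of `tilt`.
  rw [lintegral_congr h1, lintegral_congr h2, lintegral_const_mul' _ _ ENNReal.ofReal_ne_top,
    lintegral_const_mul' _ _ ENNReal.ofReal_ne_top, h5, h6]
  refine congrArg _ (lintegral_congr fun y => ?_)
  rw [lintegral_mul_const _ (measurable_tiltWeight_right t y), lintegral_tilt, ← mul_assoc,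
    ← tiltMass, ENNReal.mul_inv_cancel (tiltMass_ne_zero ν t y) (tiltMass_ne_top ν t y), one_mul]

/-! ### Bayes' formula for sequences of observations -/

variable {ι : Type*}

/-- The law of the pair `(t g + ε, g)`, with `g ∼ ν` and `ε` standard Gaussian. -/
def pairLaw (t : ℝ) : Measure (ℝ × ℝ) :=
  (ν.prod (gaussianReal 0 1)).map fun p => (t * p.1 + p.2, p.1)

instance (t : ℝ) : IsProbabilityMeasure (pairLaw ν t) :=
  Measure.isProbabilityMeasure_map (by fun_prop)

theorem lintegral_pairLaw (ν : Measure ℝ) (t : ℝ) {f : ℝ × ℝ → ℝ≥0∞} (hf : Measurable f) :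
    ∫⁻ p, f p ∂(pairLaw ν t) = ∫⁻ g, ∫⁻ e, f (t * g + e, g) ∂(gaussianReal 0 1) ∂ν := by
  have : Measurable fun p : ℝ × ℝ => (t * p.1 + p.2, p.1) := by fun_prop
  rw [pairLaw, lintegral_map hf this]
  exact lintegral_prod _ (hf.comp this).aemeasurable

/-- The law of the sequence of observations `t g + ε` together with the sequence `g`. -/
def jointLaw (t : ι → ℝ) : Measure ((ι → ℝ) × (ι → ℝ)) :=
  ((Measure.infinitePi fun _ : ι => ν).prod (stdGaussian ι)).map
    fun p => (fun i => t i * p.1 i + p.2 i, p.1)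

/-- The law of the sequence of observations `t g + ε`. -/
def obsLaw (t : ι → ℝ) : Measure (ι → ℝ) :=
  ((Measure.infinitePi fun _ : ι => ν).prod (stdGaussian ι)).map
    fun p i => t i * p.1 i + p.2 i

theorem measurable_jointMap (t : ι → ℝ) : Measurable fun p : (ι → ℝ) × (ι → ℝ) =>
    ((fun i => t i * p.1 i + p.2 i, p.1) : (ι → ℝ) × (ι → ℝ)) := by fun_prop

theorem measurable_obsMap (t : ι → ℝ) : Measurable fun p : (ι → ℝ) × (ι → ℝ) =>
    (fun i => t i * p.1 i + p.2 i : ι → ℝ) := by fun_prop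

instance (t : ι → ℝ) : IsProbabilityMeasure (obsLaw ν t) :=
  Measure.isProbabilityMeasure_map (measurable_obsMap t).aemeasurable

theorem measurable_zip : Measurable fun (p : (ι → ℝ) × (ι → ℝ)) i => (p.1 i, p.2 i) := by
  fun_prop

/-- Regrouping by coordinates exhibits independent pairs; this is where the independence of the
prior coefficients and of the noise enters. -/
theorem jointLaw_zip (t : ι → ℝ) :
    (jointLaw ν t).map (fun p i => (p.1 i, p.2 i)) =
      Measure.infinitePi fun i => pairLaw ν (t i) := by
  refine Measure.eq_infinitePi _ fun s A hA => ?_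
  have hS : MeasurableSet ((s : Set ι).pi A) := .pi s.countable_toSet fun i _ => hA i
  rw [jointLaw, Measure.map_map measurable_zip (measurable_jointMap t),
    Measure.map_apply (measurable_zip.comp (measurable_jointMap t)) hS,
    Measure.prod_apply ((measurable_zip.comp (measurable_jointMap t)) hS)]
  have hsec : ∀ i, Measurable fun e : ℝ × ℝ => (t i * e.1 + e.2, e.1) := by fun_prop
  have h1 : ∀ g : ι → ℝ, stdGaussian ι (Prod.mk g ⁻¹'
      (((fun (p : (ι → ℝ) × (ι → ℝ)) i => (p.1 i, p.2 i)) ∘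
        fun p : (ι → ℝ) × (ι → ℝ) => (fun i => t i * p.1 i + p.2 i, p.1)) ⁻¹' (s : Set ι).pi A)) =
      ∏ i ∈ s, gaussianReal 0 1 (Prod.mk (g i) ⁻¹' ((fun e : ℝ × ℝ => (t i * e.1 + e.2, e.1)) ⁻¹'
        A i)) := by
    intro g
    rw [← Measure.infinitePi_pi _ fun i _ => measurable_prodMk_left (hsec i (hA i))]
    rfl
  simp_rw [h1]
  rw [lintegral_infinitePi_prod _ s (fun i g => gaussianReal 0 1 (Prod.mk g ⁻¹'
    ((fun e : ℝ × ℝ => (t i * e.1 + e.2, e.1)) ⁻¹' A i)))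
    fun i => measurable_measure_prodMk_left (hsec i (hA i))]
  refine Finset.prod_congr rfl fun i _ => ?_
  rw [pairLaw, Measure.map_apply (hsec i) (hA i), Measure.prod_apply (hsec i (hA i))]

theorem obsLaw_eq (t : ι → ℝ) :
    obsLaw ν t = Measure.infinitePi fun i => (pairLaw ν (t i)).map Prod.fst := by
  have : obsLaw ν t = ((jointLaw ν t).map (fun p i => (p.1 i, p.2 i))).map
      (fun p i => (p i).1) := by
    rw [jointLaw, Measure.map_map measurable_zip (measurable_jointMap t),
      Measure.map_map (by fun_prop) (measurable_zip.comp (measurable_jointMap t))]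
    rfl
  rw [this, jointLaw_zip, Measure.infinitePi_map_pi _ fun _ => measurable_fst]

/-- The posterior of the sequence `g` given the sequence of observations `t g + ε`. -/
def seqPost (t : ι → ℝ) : Kernel (ι → ℝ) (ι → ℝ) := prodKernel fun i => tilt ν (t i)

instance (t : ι → ℝ) : IsMarkovKernel (seqPost ν t) := by unfold seqPost; infer_instance

theorem seqPost_apply (t y : ι → ℝ) :
    seqPost ν t y = Measure.infinitePi fun i => tilt ν (t i) (y i) := rfl

/-- The two joint laws are compared after regrouping into pairs, an invertible map. There a box
reduces to finitely many instances of `lintegral_bayes`, so no likelihood of an infinite sequence is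
written down. -/
theorem obsLaw_compProd_seqPost (t : ι → ℝ) : obsLaw ν t ⊗ₘ seqPost ν t = jointLaw ν t := by
  have hzip : (obsLaw ν t ⊗ₘ seqPost ν t).map (fun p i => (p.1 i, p.2 i)) =
      Measure.infinitePi fun i => pairLaw ν (t i) := by
    refine Measure.eq_infinitePi _ fun s A hA => ?_
    have hS : MeasurableSet ((s : Set ι).pi A) := .pi s.countable_toSet fun i _ => hA i
    rw [Measure.map_apply measurable_zip hS, Measure.compProd_apply (measurable_zip hS)]
    have h1 : ∀ y : ι → ℝ, seqPost ν t y (Prod.mk y ⁻¹'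
        ((fun (p : (ι → ℝ) × (ι → ℝ)) i => (p.1 i, p.2 i)) ⁻¹' (s : Set ι).pi A)) =
        ∏ i ∈ s, tilt ν (t i) (y i) (Prod.mk (y i) ⁻¹' A i) := by
      intro y
      rw [seqPost_apply, ← Measure.infinitePi_pi (fun i => tilt ν (t i) (y i))
        fun i _ => measurable_prodMk_left (hA i)]
      rfl
    simp_rw [h1]
    have hm : ∀ i, Measurable fun y => tilt ν (t i) y (Prod.mk y ⁻¹' A i) := fun i =>
      Kernel.measurable_kernel_prodMk_left (hA i)
    rw [obsLaw_eq]
    have : ∀ i, IsProbabilityMeasure ((pairLaw ν (t i)).map Prod.fst) := fun i =>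
      Measure.isProbabilityMeasure_map (by fun_prop)
    rw [lintegral_infinitePi_prod _ s (fun i y => tilt ν (t i) y (Prod.mk y ⁻¹' A i)) hm]
    refine Finset.prod_congr rfl fun i _ => ?_
    rw [lintegral_map (hm i) measurable_fst, ← lintegral_indicator_one (hA i),
      lintegral_pairLaw ν _ (measurable_one.indicator (hA i)),
      lintegral_pairLaw ν _
        (f := fun p => tilt ν (t i) p.1 (Prod.mk p.1 ⁻¹' A i)) ((hm i).comp measurable_fst),
      lintegral_bayes ν _ (measurable_one.indicator (hA i))]
    refine lintegral_congr fun g => lintegral_congr fun e => ?_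
    rw [← lintegral_indicator_one (measurable_prodMk_left (hA i))]
    rfl
  have hinv : ∀ M : Measure ((ι → ℝ) × (ι → ℝ)),
      (M.map (fun p i => (p.1 i, p.2 i))).map
        (fun q : ι → ℝ × ℝ => ((fun i => (q i).1, fun i => (q i).2) : (ι → ℝ) × (ι → ℝ))) = M := by
    intro M
    rw [Measure.map_map (by fun_prop) measurable_zip]
    exact Measure.map_id
  rw [← hinv (obsLaw ν t ⊗ₘ seqPost ν t), hzip, ← jointLaw_zip, hinv]

end Tilt

/-! ### The random series -/

section Series

variable {S J₀ m : ℕ}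

/-- The standard deviation scale `2 ^ (-l (γ + 1/2))` of the prior coefficients. -/
def scale (γ : ℝ) (i : WaveletIndex J₀ m) : ℝ := (2 : ℝ) ^ (-((i.1.1 : ℝ) * (γ + 1 / 2)))

theorem scale_pos (γ : ℝ) (i : WaveletIndex J₀ m) : 0 < scale γ i := by
  unfold scale; positivity

/-- The squared `L²` norm of the series with coefficients `g`. -/
def energy (γ : ℝ) (g : WaveletIndex J₀ m → ℝ) : ℝ≥0∞ :=
  ∑' i, ENNReal.ofReal ((scale γ i * g i) ^ 2)

theorem measurable_energy (γ : ℝ) : Measurable (energy (J₀ := J₀) (m := m) γ) := by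
  unfold energy; fun_prop

theorem tsum_ofReal_ne_top_iff {ι : Type*} {f : ι → ℝ} (hf : ∀ i, 0 ≤ f i) :
    ∑' i, ENNReal.ofReal (f i) ≠ ∞ ↔ Summable f := by
  constructor
  · intro h
    have := ENNReal.summable_toReal h
    simpa [ENNReal.toReal_ofReal (hf _)] using this
  · intro h
    rw [← ENNReal.ofReal_tsum_of_nonneg hf h]
    exact ENNReal.ofReal_ne_top

variable (B : RegularBasis S J₀ m)

theorem coef_eq_repr (f : L2) (i : WaveletIndex J₀ m) : coef B f i = B.basis.repr f i :=
  (B.basis.repr_apply_apply f i).symm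

theorem hasSum_coef_sq (f : L2) : HasSum (fun i => coef B f i ^ 2) (‖f‖ ^ 2) := by
  have h := B.basis.hasSum_inner_mul_inner f f
  rw [real_inner_self_eq_norm_sq] at h
  have e : (fun i => ⟪f, B.basis i⟫ * ⟪B.basis i, f⟫) = fun i => coef B f i ^ 2 := by
    ext i
    rw [coef, real_inner_comm, sq]
  rwa [e] at h

theorem summable_coef_sq (f : L2) : Summable fun i => coef B f i ^ 2 :=
  (hasSum_coef_sq B f).summable

theorem tsum_ofReal_coef_sq (f : L2) :
    ∑' i, ENNReal.ofReal (coef B f i ^ 2) = ENNReal.ofReal (‖f‖ ^ 2) := by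
  rw [← ENNReal.ofReal_tsum_of_nonneg (fun i => sq_nonneg _) (summable_coef_sq B f),
    (hasSum_coef_sq B f).tsum_eq]

theorem coef_sub (f g : L2) (i : WaveletIndex J₀ m) :
    coef B (f - g) i = coef B f i - coef B g i := inner_sub_right _ _ _

theorem continuous_coef (i : WaveletIndex J₀ m) : Continuous fun f : L2 => coef B f i := by
  unfold coef; fun_prop

variable {B} {γ : ℝ}

theorem hasSum_series {g : WaveletIndex J₀ m → ℝ} (hg : energy γ g ≠ ∞) :
    HasSum (fun i => (scale γ i * g i) • B.basis i) (series B γ g) ∧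
      ∀ i, coef B (series B γ g) i = scale γ i * g i := by
  have hs : Summable fun i => (scale γ i * g i) ^ 2 :=
    (tsum_ofReal_ne_top_iff fun i => sq_nonneg _).1 hg
  have hmem : Memℓp (fun i => scale γ i * g i) 2 := by
    rw [memℓp_gen_iff (by norm_num)]
    simpa only [Real.norm_eq_abs, ENNReal.toReal_ofNat, Real.rpow_two, sq_abs] using hs
  have h := B.basis.hasSum_repr_symm ⟨_, hmem⟩
  have e : series B γ g = B.basis.repr.symm ⟨_, hmem⟩ := h.tsum_eq
  refine ⟨e ▸ h, fun i => ?_⟩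
  rw [coef_eq_repr, e, LinearIsometryEquiv.apply_symm_apply]

theorem coef_series {g : WaveletIndex J₀ m → ℝ} (hg : energy γ g ≠ ∞) (i : WaveletIndex J₀ m) :
    coef B (series B γ g) i = scale γ i * g i := (hasSum_series hg).2 i

theorem series_eq_zero {g : WaveletIndex J₀ m → ℝ} (hg : energy γ g = ∞) :
    series B γ g = 0 := by
  refine tsum_eq_zero_of_not_summable fun h => ?_
  have h2 := (B.basis.orthonormal.orthogonalFamily.summable_iff_norm_sq_summable
    (fun i => scale γ i * g i)).1 h
  refine (tsum_ofReal_ne_top_iff (f := fun i => (scale γ i * g i) ^ 2) fun i => sq_nonneg _).2 ?_ hg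
  simpa only [Real.norm_eq_abs, sq_abs] using h2

variable (B γ) in
theorem measurable_series : Measurable (series B γ) := by
  have hE : MeasurableSet {g : WaveletIndex J₀ m → ℝ | energy γ g ≠ ∞} :=
    measurable_energy γ (measurableSet_singleton ∞).compl
  -- The indicator makes the partial sums converge everywhere: where the energy is infinite, `tsum`
  -- has its default value `0`.
  have hm : ∀ F : Finset (WaveletIndex J₀ m), Measurable
      ({g : WaveletIndex J₀ m → ℝ | energy γ g ≠ ∞}.indicator
        fun g => ∑ i ∈ F, (scale γ i * g i) • B.basis i) := fun F => by
    refine Measurable.indicator (Continuous.measurable ?_) hE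
    fun_prop
  refine measurable_of_tendsto_metrizable' atTop hm (tendsto_pi_nhds.2 fun g => ?_)
  by_cases hg : energy γ g = ∞
  · simp [hg, series_eq_zero hg]
  · simpa [hg] using! (hasSum_series hg).1

theorem norm_series_sq {g : WaveletIndex J₀ m → ℝ} (hg : energy γ g ≠ ∞) :
    ENNReal.ofReal (‖series B γ g‖ ^ 2) = energy γ g := by
  rw [← tsum_ofReal_coef_sq B]
  exact tsum_congr fun i => by rw [coef_series hg]

/-! ### Sums over the levels and the energy of the prior -/

/-- Summing over all indices a function of the level. -/
theorem tsum_level_le (F : ℕ → ℝ≥0∞) :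
    ∑' i : WaveletIndex J₀ m, F i.1.1 ≤ (m + 1) * ∑' l, 2 ^ l * F l := by
  have h1 : ∑' i : WaveletIndex J₀ m, F i.1.1 ≤
      ∑' p : ℕ × ℕ, if p.2 < (m + 1) * 2 ^ p.1 then F p.1 else 0 := by
    refine le_trans (ENNReal.tsum_le_tsum fun i => ?_) (ENNReal.tsum_comp_le_tsum_of_injective
      (Subtype.val_injective (p := fun p : ℕ × ℕ =>
        J₀ ≤ p.1 + 1 ∧ p.2 < if p.1 + 1 = J₀ then m else 2 ^ p.1)) _)
    have h := i.2.2
    -- The factor `m + 1` covers at once the lowest level, with its `m` scaling functions, and the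
    -- dyadic levels.
    have h3 : i.1.2 < (m + 1) * 2 ^ i.1.1 := by
      have h2 : 1 ≤ 2 ^ i.1.1 := Nat.one_le_two_pow
      refine h.trans_le ?_
      split_ifs <;> nlinarith
    rw [if_pos h3]
  refine h1.trans (le_of_eq ?_)
  rw [ENNReal.tsum_prod (f := fun l k => if k < (m + 1) * 2 ^ l then F l else 0),
    ← ENNReal.tsum_mul_left]
  refine tsum_congr fun l => ?_
  rw [tsum_eq_sum (s := Finset.range ((m + 1) * 2 ^ l)) fun k hk => by
    rw [if_neg]; simpa using hk]
  rw [Finset.sum_congr rfl fun k hk => if_pos (Finset.mem_range.1 hk)]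
  simp [mul_assoc]

theorem tsum_two_rpow_neg {a : ℝ} (ha : 0 < a) :
    ∑' l : ℕ, ENNReal.ofReal ((2 : ℝ) ^ (-((l : ℝ) * a))) ≠ ∞ := by
  rw [tsum_ofReal_ne_top_iff fun i => by positivity]
  have : (fun l : ℕ => (2 : ℝ) ^ (-((l : ℝ) * a))) = fun l : ℕ => ((2 : ℝ) ^ (-a)) ^ l := by
    ext l
    rw [← Real.rpow_natCast, ← Real.rpow_mul (by norm_num)]
    congr 1; ring
  rw [this]
  exact summable_geometric_of_lt_one (by positivity)
    (Real.rpow_lt_one_of_one_lt_of_neg (by norm_num) (by linarith))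

theorem scale_sq (i : WaveletIndex J₀ m) :
    scale γ i ^ 2 = (2 : ℝ) ^ (-((i.1.1 : ℝ) * (2 * γ + 1))) := by
  rw [scale, ← Real.rpow_natCast, ← Real.rpow_mul (by norm_num)]
  congr 1; push_cast; ring

theorem two_pow_mul_ofReal (l : ℕ) (x : ℝ) :
    (2 : ℝ≥0∞) ^ l * ENNReal.ofReal x = ENNReal.ofReal ((2 : ℝ) ^ (l : ℝ) * x) := by
  rw [ENNReal.ofReal_mul (by positivity), Real.rpow_natCast, ENNReal.ofReal_pow (by norm_num)]
  simp

theorem tsum_scale_sq_ne_top (hγ : 0 < γ) :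
    ∑' i : WaveletIndex J₀ m, ENNReal.ofReal (scale γ i ^ 2) ≠ ∞ := by
  simp_rw [scale_sq]
  refine ne_top_of_le_ne_top ?_ (tsum_level_le fun l =>
    ENNReal.ofReal ((2 : ℝ) ^ (-((l : ℝ) * (2 * γ + 1)))))
  refine ENNReal.mul_ne_top (by finiteness) ?_
  have := tsum_two_rpow_neg (a := 2 * γ) (by linarith)
  convert this using 4 with l
  rw [two_pow_mul_ofReal, ← Real.rpow_add (by norm_num)]
  congr 2; ring

variable (ν : Measure ℝ) [IsProbabilityMeasure ν]

/-- Level `l` contributes at most a constant times `2 ^ l * 2 ^ (-l (2γ + 1)) = 2 ^ (-2γl)`. Hence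
`γ > 0` and finite variance give the prior finite expected energy, and its series converges almost
surely in `L²`. -/
theorem lintegral_energy_ne_top (hγ : 0 < γ) (hν : MemLp (fun x : ℝ => x) 2 ν) :
    ∫⁻ g, energy (J₀ := J₀) (m := m) γ g ∂(Measure.infinitePi fun _ => ν) ≠ ∞ := by
  have hfin : ∫⁻ x, ENNReal.ofReal (x ^ 2) ∂ν ≠ ∞ := by
    have := (memLp_two_iff_integrable_sq hν.1).1 hν
    exact this.lintegral_lt_top.ne
  unfold energy
  rw [lintegral_tsum fun i => (Measurable.aemeasurable (by fun_prop))]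
  have : ∀ i : WaveletIndex J₀ m, ∫⁻ g, ENNReal.ofReal ((scale γ i * g i) ^ 2)
      ∂(Measure.infinitePi fun _ => ν) =
      ENNReal.ofReal (scale γ i ^ 2) * ∫⁻ x, ENNReal.ofReal (x ^ 2) ∂ν := by
    intro i
    rw [lintegral_infinitePi_eval (fun _ : WaveletIndex J₀ m => ν) i
      (f := fun x => ENNReal.ofReal ((scale γ i * x) ^ 2)) (by fun_prop)]
    simp_rw [mul_pow, ENNReal.ofReal_mul (sq_nonneg (scale γ i))]
    rw [lintegral_const_mul _ (by fun_prop)]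
  simp_rw [this]
  rw [ENNReal.tsum_mul_right]
  exact ENNReal.mul_ne_top (tsum_scale_sq_ne_top hγ) hfin

end Series

/-! ### The posterior -/

section Posterior

variable {S J₀ m : ℕ} (B : RegularBasis S J₀ m) (γ : ℝ) (ν : Measure ℝ) [IsProbabilityMeasure ν]

/-- The signal-to-noise ratios `√n 2 ^ (-l (γ + 1/2))` of the coordinates. -/
def snr (γ : ℝ) (n : ℕ) (i : WaveletIndex J₀ m) : ℝ := √(n : ℝ) * scale γ i

/-- The observation with noise `ε`. -/
def obs (n : ℕ) (f : L2) (ε : WaveletIndex J₀ m → ℝ) : WaveletIndex J₀ m → ℝ :=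
  fun i => coef B f i + (√(n : ℝ))⁻¹ * ε i

theorem measurable_obs (n : ℕ) (f : L2) : Measurable (obs B n f) :=
  (measurable_shift B n).comp measurable_prodMk_left

theorem whiteNoise_apply (n : ℕ) (f : L2) :
    whiteNoise B n f = (stdGaussian (WaveletIndex J₀ m)).map (obs B n f) := rfl

theorem sqrt_pos_of_one_le {n : ℕ} (hn : 1 ≤ n) : 0 < √(n : ℝ) :=
  Real.sqrt_pos.2 (by exact_mod_cast hn)

/-- The two observations differ by a deterministic shift of the noise, which Parseval's identity
makes square summable. -/
theorem whiteNoise_absolutelyContinuous {n : ℕ} (hn : 1 ≤ n) (f₀ f : L2) :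
    whiteNoise B n f₀ ≪ whiteNoise B n f := by
  have hs := sqrt_pos_of_one_le hn
  have h : Summable fun i => (√(n : ℝ) * coef B (f₀ - f) i) ^ 2 := by
    simp_rw [mul_pow]
    exact (summable_coef_sq B (f₀ - f)).mul_left _
  have e : obs B n f₀ = obs B n f ∘ fun z => z + fun i => √(n : ℝ) * coef B (f₀ - f) i := by
    ext ε i
    simp only [obs, Function.comp_apply, Pi.add_apply, coef_sub]
    field_simp
    ring
  rw [whiteNoise_apply, whiteNoise_apply, e,
    ← Measure.map_map (measurable_obs B n f) (by fun_prop)]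
  exact (map_shift_stdGaussian_absolutelyContinuous h).map (measurable_obs B n f)

instance : IsProbabilityMeasure (prior B γ ν) :=
  Measure.isProbabilityMeasure_map (measurable_series B γ).aemeasurable

/-- `posterior` is pinned down only off null sets of this mixture. Such a set is null under `P_f`
for almost every prior draw `f`, so for at least one `f`, and therefore under `f₀`. -/
theorem whiteNoise_absolutelyContinuous_comp {n : ℕ} (hn : 1 ≤ n) (f₀ : L2) :
    whiteNoise B n f₀ ≪ whiteNoise B n ∘ₘ prior B γ ν := by
  refine Measure.AbsolutelyContinuous.mk fun A hA h0 => ?_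
  rw [Measure.bind_apply hA (whiteNoise B n).aemeasurable,
    lintegral_eq_zero_iff ((whiteNoise B n).measurable_coe hA)] at h0
  obtain ⟨f, hf⟩ := h0.exists
  exact whiteNoise_absolutelyContinuous B hn f₀ f hf

/-- The posterior as the law of a random series with independent coefficients. -/
def seriesPost (n : ℕ) : Kernel (WaveletIndex J₀ m → ℝ) L2 :=
  ((seqPost ν (snr γ n)).comap (fun x i => √(n : ℝ) * x i) (by fun_prop)).map (series B γ)

instance (n : ℕ) : IsMarkovKernel (seriesPost B γ ν n) :=
  Kernel.IsMarkovKernel.map _ (measurable_series B γ)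

variable {γ}

/-- The experiment in units of the prior: multiplied by `√n`, the observations are `snr * g + ε`.
The coefficients of the series are the expected ones only where the energy is finite, which is
almost everywhere. -/
theorem lintegral_swap_compProd (hγ : 0 < γ) (hν : MemLp (fun x : ℝ => x) 2 ν) {n : ℕ}
    (hn : 1 ≤ n) {f : (WaveletIndex J₀ m → ℝ) × L2 → ℝ≥0∞} (hf : Measurable f) :
    ∫⁻ p, f p ∂((prior B γ ν ⊗ₘ whiteNoise B n).map Prod.swap) =
      ∫⁻ q, f (fun i => (√(n : ℝ))⁻¹ * q.1 i, series B γ q.2) ∂(jointLaw ν (snr γ n)) := by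
  have hs := sqrt_pos_of_one_le hn
  have hS := measurable_series B γ
  have hf1 : Measurable fun q : (WaveletIndex J₀ m → ℝ) × (WaveletIndex J₀ m → ℝ) =>
      f (fun i => (√(n : ℝ))⁻¹ * q.1 i, series B γ q.2) :=
    hf.comp ((by fun_prop : Measurable fun q : (WaveletIndex J₀ m → ℝ) ×
      (WaveletIndex J₀ m → ℝ) => fun i => (√(n : ℝ))⁻¹ * q.1 i).prodMk (hS.comp measurable_snd))
  have hf2 : Measurable fun h : L2 => ∫⁻ x, f (x, h) ∂(whiteNoise B n h) :=
    (hf.comp measurable_swap).lintegral_kernel_prod_right'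
  rw [lintegral_map hf measurable_swap,
    Measure.lintegral_compProd (f := fun p => f p.swap) (hf.comp measurable_swap),
    jointLaw, lintegral_map hf1 (measurable_jointMap _),
    lintegral_prod _ (by exact (hf1.comp (measurable_jointMap _)).aemeasurable)]
  change ∫⁻ h, ∫⁻ x, f (x, h) ∂(whiteNoise B n h) ∂(prior B γ ν) = _
  rw [prior, lintegral_map hf2 hS]
  refine lintegral_congr_ae ?_
  filter_upwards [ae_lt_top (measurable_energy γ) (lintegral_energy_ne_top ν hγ hν)] with g hg
  have hfg : Measurable fun x => f (x, series B γ g) := hf.comp measurable_prodMk_right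
  rw [whiteNoise_apply, lintegral_map hfg (measurable_obs B n _)]
  refine lintegral_congr fun ε => ?_
  congr 2
  ext i
  simp only [obs, coef_series hg.ne, snr]
  field_simp

theorem lintegral_marginal (hγ : 0 < γ) (hν : MemLp (fun x : ℝ => x) 2 ν) {n : ℕ}
    (hn : 1 ≤ n) {f : (WaveletIndex J₀ m → ℝ) → ℝ≥0∞} (hf : Measurable f) :
    ∫⁻ x, f x ∂(whiteNoise B n ∘ₘ prior B γ ν) =
      ∫⁻ y, f (fun i => (√(n : ℝ))⁻¹ * y i) ∂(obsLaw ν (snr γ n)) := by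
  have h1 := lintegral_swap_compProd B ν hγ hν hn (f := fun p => f p.1) (hf.comp measurable_fst)
  have hf1 : Measurable fun p : (WaveletIndex J₀ m → ℝ) × L2 => f p.1 := hf.comp measurable_fst
  rw [lintegral_map hf1 measurable_swap] at h1
  rw [← Measure.snd_compProd, Measure.snd, lintegral_map hf measurable_snd]
  refine h1.trans ?_
  have hf' : Measurable fun y : WaveletIndex J₀ m → ℝ => f (fun i => (√(n : ℝ))⁻¹ * y i) :=
    hf.comp (by fun_prop)
  have e : obsLaw ν (snr (J₀ := J₀) (m := m) γ n) = (jointLaw ν (snr γ n)).map Prod.fst := by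
    rw [jointLaw, Measure.map_map measurable_fst (measurable_jointMap _)]
    rfl
  rw [e, lintegral_map hf' measurable_fst]

/-- A conditional law is unique given the joint law, so Bayes' formula for sequences, pushed through
`series`, identifies it. -/
theorem seriesPost_ae_eq_post (hγ : 0 < γ) (hν : MemLp (fun x : ℝ => x) 2 ν) {n : ℕ}
    (hn : 1 ≤ n) :
    seriesPost B γ ν n =ᵐ[whiteNoise B n ∘ₘ prior B γ ν] post B γ ν n := by
  have hs := sqrt_pos_of_one_le hn
  refine ae_eq_posterior_of_compProd_eq (Measure.ext_of_lintegral _ fun f hf => ?_)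
  rw [lintegral_swap_compProd B ν hγ hν hn hf, Measure.lintegral_compProd hf,
    lintegral_marginal B ν hγ hν hn hf.lintegral_kernel_prod_right',
    ← obsLaw_compProd_seqPost, Measure.lintegral_compProd]
  · refine lintegral_congr fun y => ?_
    have hfy : Measurable fun b : L2 => f ((fun i => (√(n : ℝ))⁻¹ * y i), b) :=
      hf.comp measurable_prodMk_left
    rw [seriesPost, Kernel.lintegral_map _ (measurable_series B γ) _ hfy, Kernel.comap_apply]
    congr 2
    ext i
    field_simp
  · exact hf.comp ((by fun_prop : Measurable fun q : (WaveletIndex J₀ m → ℝ) ×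
      (WaveletIndex J₀ m → ℝ) => fun i => (√(n : ℝ))⁻¹ * q.1 i).prodMk
      ((measurable_series B γ).comp measurable_snd))

/-- Averaged over the data, the posterior expectation of the energy is its prior expectation, which
is finite. -/
theorem ae_marginal_lintegral_energy_lt_top (hγ : 0 < γ) (hν : MemLp (fun x : ℝ => x) 2 ν) {n : ℕ}
    (hn : 1 ≤ n) :
    ∀ᵐ x ∂(whiteNoise B n ∘ₘ prior B γ ν),
      ∫⁻ g, energy γ g ∂(seqPost ν (snr γ n) fun i => √(n : ℝ) * x i) < ∞ := by
  have hs := sqrt_pos_of_one_le hn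
  have hm : Measurable fun y : WaveletIndex J₀ m → ℝ => ∫⁻ g, energy γ g ∂(seqPost ν (snr γ n) y) :=
    (measurable_energy γ).lintegral_kernel
  have hm' : Measurable fun x : WaveletIndex J₀ m → ℝ =>
      ∫⁻ g, energy γ g ∂(seqPost ν (snr γ n) fun i => √(n : ℝ) * x i) :=
    hm.comp (by fun_prop)
  refine ae_lt_top hm' ?_
  rw [lintegral_marginal B ν hγ hν hn hm']
  have e : ∀ y : WaveletIndex J₀ m → ℝ, (fun i => √(n : ℝ) * ((√(n : ℝ))⁻¹ * y i)) = y := by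
    intro y; ext i; field_simp
  simp_rw [e]
  have hE : Measurable fun q : (WaveletIndex J₀ m → ℝ) × (WaveletIndex J₀ m → ℝ) =>
      energy γ q.2 := (measurable_energy γ).comp measurable_snd
  have h2 := Measure.lintegral_compProd (μ := obsLaw ν (snr γ n)) (κ := seqPost ν (snr γ n)) hE
  rw [← h2, obsLaw_compProd_seqPost, jointLaw,
    lintegral_map hE (measurable_jointMap _),
    lintegral_prod _ (by exact ((measurable_energy γ).comp measurable_fst).aemeasurable)]
  simpa using lintegral_energy_ne_top ν hγ hν

/-- Under the law of the data, the posterior is the law of a random series with independent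
coefficients. -/
theorem ae_post_eq (hγ : 0 < γ) (hν : MemLp (fun x : ℝ => x) 2 ν) {n : ℕ} (hn : 1 ≤ n) (f₀ : L2) :
    ∀ᵐ ε ∂(stdGaussian (WaveletIndex J₀ m)),
      post B γ ν n (obs B n f₀ ε) =
        (seqPost ν (snr γ n) fun i => √(n : ℝ) * obs B n f₀ ε i).map (series B γ) ∧
      ∫⁻ g, energy γ g ∂(seqPost ν (snr γ n) fun i => √(n : ℝ) * obs B n f₀ ε i) < ∞ := by
  have h := (whiteNoise_absolutelyContinuous_comp B γ ν hn f₀).ae_le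
    ((seriesPost_ae_eq_post B ν hγ hν hn).and (ae_marginal_lintegral_energy_lt_top B ν hγ hν hn))
  rw [whiteNoise_apply] at h
  filter_upwards [ae_of_ae_map (measurable_obs B n f₀).aemeasurable h] with ε hε
  refine ⟨?_, hε.2⟩
  rw [← hε.1, seriesPost, Kernel.map_apply _ (measurable_series B γ), Kernel.comap_apply]

end Posterior

/-! ### Second moments of Gaussian tilts -/

section Moment

/-- The unnormalised second moment about `g₀` of the tilt at `t g₀ + ε`. -/
def rawMoment (ν : Measure ℝ) (t g₀ ε : ℝ) : ℝ≥0∞ :=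
  ∫⁻ g, tiltWeight t (t * g₀ + ε) g * ENNReal.ofReal ((g - g₀) ^ 2) ∂ν

theorem lintegral_tilt_sq (ν : Measure ℝ) [IsProbabilityMeasure ν] (t g₀ ε : ℝ) :
    ∫⁻ g, ENNReal.ofReal ((g - g₀) ^ 2) ∂(tilt ν t (t * g₀ + ε)) =
      (tiltMass ν t (t * g₀ + ε))⁻¹ * rawMoment ν t g₀ ε := lintegral_tilt ν t _ _

theorem tiltWeight_shift (t g₀ ε g : ℝ) :
    tiltWeight t (t * g₀ + ε) g = ENNReal.ofReal (Real.exp (-(ε - t * (g - g₀)) ^ 2 / 2)) := by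
  unfold tiltWeight; congr 3; ring

theorem measurable_tiltWeight_shift (t g₀ : ℝ) :
    Measurable fun p : ℝ × ℝ => tiltWeight t (t * g₀ + p.1) p.2 := by
  unfold tiltWeight; fun_prop

theorem measurable_tiltWeight_noise (t g₀ g : ℝ) :
    Measurable fun ε => tiltWeight t (t * g₀ + ε) g := by
  unfold tiltWeight; fun_prop

variable (ν : Measure ℝ) [IsProbabilityMeasure ν]

theorem measurable_rawMoment (t g₀ : ℝ) : Measurable (rawMoment ν t g₀) := by
  have : Measurable fun p : ℝ × ℝ =>
      tiltWeight t (t * g₀ + p.1) p.2 * ENNReal.ofReal ((p.2 - g₀) ^ 2) :=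
    (measurable_tiltWeight_shift t g₀).mul (by fun_prop)
  exact this.lintegral_prod_right'

theorem lintegral_rawMoment_swap (μ : Measure ℝ) [SFinite μ] (t g₀ : ℝ) :
    ∫⁻ ε, rawMoment ν t g₀ ε ∂μ =
      ∫⁻ g, ENNReal.ofReal ((g - g₀) ^ 2) * (∫⁻ ε, tiltWeight t (t * g₀ + ε) g ∂μ) ∂ν := by
  have hm : Measurable fun p : ℝ × ℝ =>
      tiltWeight t (t * g₀ + p.1) p.2 * ENNReal.ofReal ((p.2 - g₀) ^ 2) :=
    (measurable_tiltWeight_shift t g₀).mul (by fun_prop)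
  have h := lintegral_lintegral_swap (μ := μ) (ν := ν)
    (f := fun ε g => tiltWeight t (t * g₀ + ε) g * ENNReal.ofReal ((g - g₀) ^ 2)) hm.aemeasurable
  refine h.trans (lintegral_congr fun g => ?_)
  rw [lintegral_mul_const _ (measurable_tiltWeight_noise t g₀ g), mul_comm]

/-- Under Lebesgue measure in the noise the likelihood integrates to a constant and leaves the prior
second moment. This serves where the noise is large compared with `t`, at the cost of no more than a
finite variance. -/
theorem lintegral_rawMoment_volume (t g₀ : ℝ) :
    ENNReal.ofReal (√(2 * Real.pi))⁻¹ * ∫⁻ ε, rawMoment ν t g₀ ε =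
      ∫⁻ g, ENNReal.ofReal ((g - g₀) ^ 2) ∂ν := by
  rw [lintegral_rawMoment_swap, ← lintegral_const_mul' _ _ ENNReal.ofReal_ne_top]
  refine lintegral_congr fun g => ?_
  have h := lintegral_gaussianReal_add (t * (g - g₀)) fun _ => 1
  simp only [lintegral_const, measure_univ, mul_one] at h
  simp_rw [tiltWeight_shift]
  rw [mul_left_comm, ← h, mul_one]

theorem lintegral_comp_mul {t : ℝ} (ht : 0 < t) {f : ℝ → ℝ≥0∞} (hf : Measurable f) :
    ∫⁻ s, f (t * s) = ENNReal.ofReal t⁻¹ * ∫⁻ s, f s := by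
  have h := Real.map_volume_mul_left ht.ne'
  rw [← lintegral_map hf (measurable_const_mul t), h, lintegral_smul_measure,
    abs_of_pos (inv_pos.2 ht), smul_eq_mul]

theorem lintegral_ofReal_ne_top {f : ℝ → ℝ} (hf : Integrable f) :
    ∫⁻ x, ENNReal.ofReal (f x) ≠ ∞ := hf.lintegral_lt_top.ne

/-- Completing the square in the noise leaves `exp (-(t (g - g₀)) ^ 2 / 4)`. Against a bounded prior
density, a second moment over a window of width `1 / t` is of order `t ^ (-3)`. -/
theorem lintegral_rawMoment_gaussian {φ : ℝ → ℝ} (hφ : Measurable φ)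
    (hν : ν = volume.withDensity fun x => ENNReal.ofReal (φ x)) {C : ℝ} (hC : ∀ x, φ x ≤ C) :
    ∃ K : ℝ≥0∞, K ≠ ∞ ∧ ∀ t g₀ : ℝ, 0 < t →
      ∫⁻ ε, rawMoment ν t g₀ ε ∂(gaussianReal 0 1) ≤ K * ENNReal.ofReal (t⁻¹ ^ 3) := by
  set c := ENNReal.ofReal (√(2 * Real.pi))⁻¹
  set G₁ := ∫⁻ x, ENNReal.ofReal (Real.exp (-x ^ 2)) with hG₁
  set G₂ := ∫⁻ x, ENNReal.ofReal (x ^ 2 * Real.exp (-x ^ 2 / 4)) with hG₂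
  have hG₁t : G₁ ≠ ∞ := by
    refine lintegral_ofReal_ne_top ?_
    simpa using integrable_exp_neg_mul_sq (b := 1) one_pos
  have hG₂t : G₂ ≠ ∞ := by
    refine lintegral_ofReal_ne_top ?_
    have := integrable_rpow_mul_exp_neg_mul_sq (b := 1 / 4) (by norm_num) (s := 2) (by norm_num)
    refine this.congr (ae_of_all _ fun x => ?_)
    simp only [Real.rpow_two]
    congr 2; ring
  refine ⟨ENNReal.ofReal C * (c * G₁ * G₂), by finiteness, fun t g₀ ht => ?_⟩
  have hin : ∀ g, ∫⁻ ε, tiltWeight t (t * g₀ + ε) g ∂(gaussianReal 0 1) =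
      c * (ENNReal.ofReal (Real.exp (-(t * (g - g₀)) ^ 2 / 4)) * G₁) := by
    intro g
    have h0 := lintegral_sub_right_eq_self (fun x => ENNReal.ofReal (Real.exp (-x ^ 2)))
      (μ := volume) (t * (g - g₀) / 2)
    rw [lintegral_gaussianReal_eq, hG₁, ← h0]
    refine congrArg (c * ·) ?_
    rw [← lintegral_const_mul' _ _ ENNReal.ofReal_ne_top]
    refine lintegral_congr fun x => ?_
    rw [tiltWeight_shift, ← ENNReal.ofReal_mul (Real.exp_pos _).le,
      ← ENNReal.ofReal_mul (Real.exp_pos _).le, ← Real.exp_add, ← Real.exp_add]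
    congr 2; ring
  rw [lintegral_rawMoment_swap]
  simp_rw [hin]
  have hm : Measurable fun g => ENNReal.ofReal ((g - g₀) ^ 2) *
      (c * (ENNReal.ofReal (Real.exp (-(t * (g - g₀)) ^ 2 / 4)) * G₁)) := by fun_prop
  rw [hν, lintegral_withDensity_eq_lintegral_mul _ (by fun_prop) hm]
  calc ∫⁻ g, ((fun x => ENNReal.ofReal (φ x)) * fun g => ENNReal.ofReal ((g - g₀) ^ 2) *
        (c * (ENNReal.ofReal (Real.exp (-(t * (g - g₀)) ^ 2 / 4)) * G₁))) g
      ≤ ∫⁻ g, (ENNReal.ofReal C * (c * G₁) * ENNReal.ofReal (t⁻¹ ^ 2)) *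
          (fun s => ENNReal.ofReal ((t * s) ^ 2 * Real.exp (-(t * s) ^ 2 / 4))) (g - g₀) := by
        refine lintegral_mono fun g => ?_
        simp only [Pi.mul_apply]
        have e : ENNReal.ofReal ((g - g₀) ^ 2) *
            ENNReal.ofReal (Real.exp (-(t * (g - g₀)) ^ 2 / 4)) = ENNReal.ofReal (t⁻¹ ^ 2) *
            ENNReal.ofReal ((t * (g - g₀)) ^ 2 * Real.exp (-(t * (g - g₀)) ^ 2 / 4)) := by
          rw [← ENNReal.ofReal_mul (by positivity), ← ENNReal.ofReal_mul (by positivity)]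
          congr 1; field_simp
        calc _ ≤ ENNReal.ofReal C * (ENNReal.ofReal ((g - g₀) ^ 2) *
              (c * (ENNReal.ofReal (Real.exp (-(t * (g - g₀)) ^ 2 / 4)) * G₁))) := by
              gcongr; exact hC g
          _ = ENNReal.ofReal C * (c * G₁) * (ENNReal.ofReal ((g - g₀) ^ 2) *
              ENNReal.ofReal (Real.exp (-(t * (g - g₀)) ^ 2 / 4))) := by ring
          _ = _ := by rw [e]; ring
          _ ≤ _ := le_rfl
    _ = ENNReal.ofReal C * (c * G₁) * ENNReal.ofReal (t⁻¹ ^ 2) *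
          (ENNReal.ofReal t⁻¹ * G₂) := by
        rw [lintegral_const_mul' _ _ (by finiteness), lintegral_sub_right_eq_self
          (fun s => ENNReal.ofReal ((t * s) ^ 2 * Real.exp (-(t * s) ^ 2 / 4))) g₀,
          lintegral_comp_mul ht
            (f := fun x => ENNReal.ofReal (x ^ 2 * Real.exp (-x ^ 2 / 4))) (by fun_prop)]
    _ = ENNReal.ofReal C * (c * G₁ * G₂) * ENNReal.ofReal (t⁻¹ ^ 3) := by
        rw [pow_succ t⁻¹ 2, ENNReal.ofReal_mul (by positivity)]; ring

/-! ### Lower bounds on the marginal likelihood -/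

variable {ν}

/-- A lower bound on the marginal likelihood, from an interval on which both the prior density and
the likelihood are bounded below. -/
theorem le_tiltMass {ν : Measure ℝ} {φ : ℝ → ℝ} (hφ : Measurable φ)
    (hν : ν = volume.withDensity fun x => ENNReal.ofReal (φ x)) {c g₀ d t ε a₁ a₂ q : ℝ}
    (hc : 0 ≤ c) (hlow : ∀ x, |x - g₀| < d → c ≤ φ x) (h₁ : -d ≤ a₁) (h₂ : a₂ ≤ d)
    (hq : ∀ s, a₁ < s → s < a₂ → (ε - t * s) ^ 2 ≤ q) :
    ENNReal.ofReal (c * (a₂ - a₁) * Real.exp (-q / 2)) ≤ tiltMass ν t (t * g₀ + ε) := by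
  have hle : ∀ g ∈ Ioo (g₀ + a₁) (g₀ + a₂), ENNReal.ofReal (c * Real.exp (-q / 2)) ≤
      ENNReal.ofReal (φ g) * tiltWeight t (t * g₀ + ε) g := by
    intro g hg
    rw [tiltWeight_shift, ENNReal.ofReal_mul hc]
    have h3 := hq (g - g₀) (by linarith [hg.1]) (by linarith [hg.2])
    gcongr
    exact hlow g (abs_lt.2 ⟨by linarith [hg.1], by linarith [hg.2]⟩)
  rw [tiltMass, hν, lintegral_withDensity_eq_lintegral_mul _ (by fun_prop)
    (measurable_tiltWeight_right _ _)]
  calc ENNReal.ofReal (c * (a₂ - a₁) * Real.exp (-q / 2))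
      = ∫⁻ _ in Ioo (g₀ + a₁) (g₀ + a₂), ENNReal.ofReal (c * Real.exp (-q / 2)) := by
        rw [setLIntegral_const, Real.volume_Ioo, ← ENNReal.ofReal_mul (by positivity)]
        congr 1; ring
    _ ≤ ∫⁻ g in Ioo (g₀ + a₁) (g₀ + a₂),
          ((fun x => ENNReal.ofReal (φ x)) * tiltWeight t (t * g₀ + ε)) g :=
        setLIntegral_mono' measurableSet_Ioo hle
    _ ≤ _ := setLIntegral_le_lintegral _ _

theorem ofReal_mul_inv_le {x a : ℝ} {Z : ℝ≥0∞} {b : ℝ} (hb : 0 < b)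
    (hZ : ENNReal.ofReal b ≤ Z) (h : x ≤ a * b) :
    ENNReal.ofReal x * Z⁻¹ ≤ ENNReal.ofReal a := by
  calc ENNReal.ofReal x * Z⁻¹ ≤ ENNReal.ofReal (a * b) * (ENNReal.ofReal b)⁻¹ := by
        gcongr
    _ = ENNReal.ofReal a := by
        rw [← ENNReal.ofReal_inv_of_pos hb, ← ENNReal.ofReal_mul' (inv_pos.2 hb).le]
        congr 1; field_simp

/-- Each regime applies `le_tiltMass` on its own interval. For `d t ≤ |ε|`, the outer half interval
on the side of `ε` lowers the residual by `d t / 2`, which gains the exponential factor. For `t ≤ 1`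
the whole interval serves. For `1 ≤ t` and `|ε| ≤ d t`, an interval of length `d / t` with residual
at most `d` gives a marginal likelihood of order at least `1 / t`. -/
theorem exp_mul_inv_tiltMass_le {ν : Measure ℝ} {φ : ℝ → ℝ} (hφ : Measurable φ)
    (hν : ν = volume.withDensity fun x => ENNReal.ofReal (φ x)) {c g₀ d t : ℝ}
    (hc : 0 < c) (hd : 0 < d) (ht : 0 < t) (hlow : ∀ x, |x - g₀| < d → c ≤ φ x) (ε : ℝ) :
    (d * t ≤ |ε| → ENNReal.ofReal (Real.exp (-ε ^ 2 / 2)) * (tiltMass ν t (t * g₀ + ε))⁻¹ ≤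
      ENNReal.ofReal (2 / (c * d) * Real.exp (-(3 * d ^ 2 * t ^ 2 / 8)))) ∧
    (|ε| ≤ d * t → t ≤ 1 →
      ENNReal.ofReal (Real.exp (-ε ^ 2 / 2)) * (tiltMass ν t (t * g₀ + ε))⁻¹ ≤
      ENNReal.ofReal ((2 * c * d)⁻¹ * Real.exp (2 * d ^ 2))) ∧
    (|ε| ≤ d * t → 1 ≤ t → (tiltMass ν t (t * g₀ + ε))⁻¹ ≤
      ENNReal.ofReal ((c * d)⁻¹ * Real.exp (d ^ 2 / 2) * t)) := by
  refine ⟨fun h => ?_, fun h h1 => ?_, fun h h1 => ?_⟩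
  · have hlow' : ENNReal.ofReal (c * (d / 2) * Real.exp (-(|ε| - d * t / 2) ^ 2 / 2)) ≤
        tiltMass ν t (t * g₀ + ε) := by
      have hdt : 0 < d * t := by positivity
      rcases abs_cases ε with h' | h'
      · have := le_tiltMass (ε := ε) (t := t) (q := (|ε| - d * t / 2) ^ 2) hφ hν hc.le hlow
          (a₁ := d / 2) (a₂ := d) (by linarith) le_rfl fun s h2 h3 => by
            rw [h'.1] at h ⊢
            have e1 : t * (d / 2) ≤ t * s := by gcongr
            have e2 : t * s ≤ t * d := by gcongr
            exact pow_le_pow_left₀ (by linarith) (by linarith) 2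
        convert this using 4; ring
      · have := le_tiltMass (ε := ε) (t := t) (q := (|ε| - d * t / 2) ^ 2) hφ hν hc.le hlow
          (a₁ := -d) (a₂ := -(d / 2)) le_rfl (by linarith) fun s h2 h3 => by
            rw [h'.1] at h ⊢
            have e1 : t * (d / 2) ≤ t * (-s) := by gcongr; linarith
            have e2 : t * (-s) ≤ t * d := by gcongr; linarith
            rw [← neg_sq]
            exact pow_le_pow_left₀ (by linarith) (by linarith) 2
        convert this using 4; ring
    refine ofReal_mul_inv_le (by positivity) hlow' ?_
    have : 2 / (c * d) * Real.exp (-(3 * d ^ 2 * t ^ 2 / 8)) *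
        (c * (d / 2) * Real.exp (-(|ε| - d * t / 2) ^ 2 / 2)) =
        Real.exp (-(3 * d ^ 2 * t ^ 2 / 8) + -(|ε| - d * t / 2) ^ 2 / 2) := by
      rw [Real.exp_add]; field_simp
    rw [this, Real.exp_le_exp]
    have h4 : ε ^ 2 = |ε| ^ 2 := (sq_abs ε).symm
    rw [h4]
    have hdt : 0 < d * t := by positivity
    nlinarith [mul_le_mul_of_nonneg_left h hdt.le]
  · have hlow' := le_tiltMass (ε := ε) (t := t) (q := 4 * d ^ 2) hφ hν hc.le hlow
      (a₁ := -d) (a₂ := d) le_rfl le_rfl fun s h2 h3 => by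
        have hs : |t * s| ≤ d := by
          rw [abs_mul, abs_of_pos ht]
          have : |s| ≤ d := abs_le.2 ⟨h2.le, h3.le⟩
          nlinarith [abs_nonneg s]
        have he : |ε| ≤ d := h.trans (by nlinarith)
        have h5 : |ε - t * s| ≤ 2 * d := (abs_sub _ _).trans (by linarith)
        rw [← sq_abs]
        calc |ε - t * s| ^ 2 ≤ (2 * d) ^ 2 := by gcongr
          _ = 4 * d ^ 2 := by ring
    have h2d : 0 < d - -d := by linarith
    refine ofReal_mul_inv_le (by positivity) hlow' ?_
    have : (2 * c * d)⁻¹ * Real.exp (2 * d ^ 2) * (c * (d - -d) * Real.exp (-(4 * d ^ 2) / 2)) =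
        Real.exp (2 * d ^ 2 + -(4 * d ^ 2) / 2) := by
      rw [Real.exp_add]; field_simp; ring
    rw [this, Real.exp_le_exp]
    nlinarith [sq_nonneg ε]
  · have hlow' : ENNReal.ofReal (c * (d / t) * Real.exp (-d ^ 2 / 2)) ≤
        tiltMass ν t (t * g₀ + ε) := by
      have h2 := abs_le.1 h
      rcases le_total 0 ε with h' | h'
      · have := le_tiltMass (ε := ε) (t := t) (q := d ^ 2) hφ hν hc.le hlow
          (a₁ := (ε - d) / t) (a₂ := ε / t) (by rw [le_div_iff₀ ht]; nlinarith)
          (by rw [div_le_iff₀ ht]; linarith) fun s h3 h4 => by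
            rw [div_lt_iff₀ ht] at h3
            rw [lt_div_iff₀ ht] at h4
            exact pow_le_pow_left₀ (by linarith) (by linarith) 2
        convert this using 4; ring
      · have := le_tiltMass (ε := ε) (t := t) (q := d ^ 2) hφ hν hc.le hlow
          (a₁ := ε / t) (a₂ := (ε + d) / t) (by rw [le_div_iff₀ ht]; linarith)
          (by rw [div_le_iff₀ ht]; nlinarith) fun s h3 h4 => by
            rw [div_lt_iff₀ ht] at h3
            rw [lt_div_iff₀ ht] at h4
            rw [← neg_sq]
            exact pow_le_pow_left₀ (by linarith) (by linarith) 2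
        convert this using 4; ring
    have := ofReal_mul_inv_le (x := 1) (a := (c * d)⁻¹ * Real.exp (d ^ 2 / 2) * t)
      (by positivity) hlow' (le_of_eq ?_)
    · simpa using this
    · have e : (c * d)⁻¹ * Real.exp (d ^ 2 / 2) * t * (c * (d / t) * Real.exp (-d ^ 2 / 2)) =
        Real.exp (d ^ 2 / 2 + -d ^ 2 / 2) := by
        rw [Real.exp_add]; field_simp
      rw [e]
      simp [← add_div]

/-! ### The risk of a single coefficient -/

variable (ν) in
/-- The expectation, over the noise, of the second moment about the truth of the posterior of a
single coefficient. -/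
def tiltRisk (t g₀ : ℝ) : ℝ≥0∞ :=
  ∫⁻ ε, ∫⁻ g, ENNReal.ofReal ((g - g₀) ^ 2) ∂(tilt ν t (t * g₀ + ε)) ∂(gaussianReal 0 1)

/-- The ratio of the noise density to the marginal likelihood is split into a bounded part `a`,
integrated against Lebesgue measure, and a part `b` that keeps the Gaussian factor. Each part meets
one of the two integrals of `rawMoment` computed above. -/
theorem tiltRisk_le_of_bound {t g₀ : ℝ} {a b : ℝ≥0∞} (ha : a ≠ ∞) (hb : b ≠ ∞)
    (h : ∀ ε, ENNReal.ofReal (Real.exp (-ε ^ 2 / 2)) * (tiltMass ν t (t * g₀ + ε))⁻¹ ≤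
      a + ENNReal.ofReal (Real.exp (-ε ^ 2 / 2)) * b) :
    tiltRisk ν t g₀ ≤ a * ∫⁻ g, ENNReal.ofReal ((g - g₀) ^ 2) ∂ν +
      b * ∫⁻ ε, rawMoment ν t g₀ ε ∂(gaussianReal 0 1) := by
  unfold tiltRisk
  simp_rw [lintegral_tilt_sq]
  have hm := measurable_rawMoment ν t g₀
  rw [lintegral_gaussianReal_eq, lintegral_gaussianReal_eq, ← lintegral_rawMoment_volume ν t g₀]
  calc ENNReal.ofReal (√(2 * Real.pi))⁻¹ * ∫⁻ ε, ENNReal.ofReal (Real.exp (-ε ^ 2 / 2)) *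
        ((tiltMass ν t (t * g₀ + ε))⁻¹ * rawMoment ν t g₀ ε)
      ≤ ENNReal.ofReal (√(2 * Real.pi))⁻¹ * ∫⁻ ε, (a * rawMoment ν t g₀ ε +
          b * (ENNReal.ofReal (Real.exp (-ε ^ 2 / 2)) * rawMoment ν t g₀ ε)) := by
        gcongr with ε
        rw [← mul_assoc]
        refine (mul_le_mul_left (h ε) _).trans (le_of_eq ?_)
        ring
    _ = _ := by
        rw [lintegral_add_left (hm.const_mul _), lintegral_const_mul' _ _ ha,
          lintegral_const_mul' _ _ hb]
        ring

/-- For `t ≥ 1`, large noise costs an exponential in `t ^ 2` against the prior second moment, while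
moderate noise gives the inverse marginal likelihood, of order `t`, times a raw moment of order `t ^
(-3)`. For `t ≤ 1` everything is bounded. The margin `τ - b` is a fixed radius around every `g₀` on
which the prior density is at least `c`. -/
theorem tiltRisk_le {φ : ℝ → ℝ} (hφ : Measurable φ)
    (hν : ν = volume.withDensity fun x => ENNReal.ofReal (φ x)) {C : ℝ} (hC : ∀ x, φ x ≤ C)
    (hν2 : MemLp (fun x : ℝ => x) 2 ν) {b τ c : ℝ} (hbτ : b < τ) (hc : 0 < c)
    (hlow : ∀ x, |x| < τ → c ≤ φ x) :
    ∃ K : ℝ≥0∞, K ≠ ∞ ∧ ∀ t g₀ : ℝ, 0 < t → |g₀| ≤ b →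
      tiltRisk ν t g₀ ≤ K * ENNReal.ofReal (min 1 (t⁻¹ ^ 2)) := by
  obtain ⟨K₀, hK₀, hraw⟩ := lintegral_rawMoment_gaussian ν hφ hν hC
  set d := τ - b with hd_def
  have hd : 0 < d := by linarith
  set M : ℝ≥0∞ := ∫⁻ x, ENNReal.ofReal (2 * x ^ 2 + 2 * b ^ 2) ∂ν with hM
  have hMt : M ≠ ∞ := by
    have h1 := (memLp_two_iff_integrable_sq hν2.1).1 hν2
    exact ((h1.const_mul 2).add (integrable_const (2 * b ^ 2))).lintegral_lt_top.ne
  have hMle : ∀ g₀, |g₀| ≤ b → ∫⁻ g, ENNReal.ofReal ((g - g₀) ^ 2) ∂ν ≤ M := by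
    intro g₀ hg
    refine lintegral_mono fun x => ENNReal.ofReal_le_ofReal ?_
    have : g₀ ^ 2 ≤ b ^ 2 := by rw [← sq_abs g₀]; gcongr
    nlinarith [sq_nonneg (x + g₀)]
  set k₁ := 2 / (c * d) with hk₁
  set k₂ := (2 * c * d)⁻¹ * Real.exp (2 * d ^ 2) with hk₂
  set k₃ := (c * d)⁻¹ * Real.exp (d ^ 2 / 2) with hk₃
  have hk₁p : 0 < k₁ := by positivity
  have hk₂p : 0 < k₂ := by positivity
  have hk₃p : 0 < k₃ := by positivity
  refine ⟨ENNReal.ofReal (k₁ + k₂ + k₁ * (8 / (3 * d ^ 2))) * M + ENNReal.ofReal k₃ * K₀,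
    by finiteness, fun t g₀ ht hg => ?_⟩
  have hlow' : ∀ x, |x - g₀| < d → c ≤ φ x := fun x hx => hlow x (by
    have := abs_add_le (x - g₀) g₀
    rw [sub_add_cancel] at this
    linarith)
  have hmass := exp_mul_inv_tiltMass_le hφ hν hc hd ht hlow'
  rcases le_total t 1 with h1 | h1
  · have hmin : min 1 (t⁻¹ ^ 2) = 1 := min_eq_left (one_le_pow₀ ((one_le_inv₀ ht).2 h1))
    have := tiltRisk_le_of_bound (ν := ν) (t := t) (g₀ := g₀) (a := ENNReal.ofReal (k₁ + k₂))
      (b := 0) ENNReal.ofReal_ne_top ENNReal.zero_ne_top fun ε => by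
        rw [mul_zero, add_zero]
        rcases le_total (d * t) |ε| with h | h
        · refine ((hmass ε).1 h).trans (ENNReal.ofReal_le_ofReal ?_)
          have : Real.exp (-(3 * d ^ 2 * t ^ 2 / 8)) ≤ 1 := by
            rw [Real.exp_le_one_iff]
            have : 0 ≤ 3 * d ^ 2 * t ^ 2 / 8 := by positivity
            linarith
          nlinarith
        · exact ((hmass ε).2.1 h h1).trans (ENNReal.ofReal_le_ofReal (by linarith))
    rw [hmin, ENNReal.ofReal_one, mul_one]
    refine this.trans ?_
    rw [zero_mul, add_zero]
    refine le_trans ?_ le_self_add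
    have : 0 < k₁ * (8 / (3 * d ^ 2)) := by positivity
    exact mul_le_mul' (ENNReal.ofReal_le_ofReal (by linarith)) (hMle g₀ hg)
  · have hmin : min 1 (t⁻¹ ^ 2) = t⁻¹ ^ 2 :=
      min_eq_right (pow_le_one₀ (by positivity) (inv_le_one_of_one_le₀ h1))
    have := tiltRisk_le_of_bound (ν := ν) (t := t) (g₀ := g₀)
      (a := ENNReal.ofReal (k₁ * (8 / (3 * d ^ 2)) * t⁻¹ ^ 2))
      (b := ENNReal.ofReal (k₃ * t)) ENNReal.ofReal_ne_top ENNReal.ofReal_ne_top fun ε => by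
        rcases le_total (d * t) |ε| with h | h
        · refine (((hmass ε).1 h).trans (ENNReal.ofReal_le_ofReal ?_)).trans le_self_add
          rw [mul_assoc k₁]
          refine mul_le_mul_of_nonneg_left ?_ hk₁p.le
          -- Polynomial decay is enough: `exp (-x) ≤ 1 / x`.
          have hx : 0 < 3 * d ^ 2 * t ^ 2 / 8 := by positivity
          rw [Real.exp_neg]
          calc (Real.exp (3 * d ^ 2 * t ^ 2 / 8))⁻¹ ≤ (3 * d ^ 2 * t ^ 2 / 8)⁻¹ := by
                gcongr
                linarith [Real.add_one_le_exp (3 * d ^ 2 * t ^ 2 / 8)]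
            _ = 8 / (3 * d ^ 2) * t⁻¹ ^ 2 := by field_simp
        · refine le_trans ?_ le_add_self
          gcongr
          exact (hmass ε).2.2 h h1
    rw [hmin]
    refine this.trans ?_
    rw [add_mul]
    gcongr ?_ + ?_
    · calc ENNReal.ofReal (k₁ * (8 / (3 * d ^ 2)) * t⁻¹ ^ 2) *
            ∫⁻ g, ENNReal.ofReal ((g - g₀) ^ 2) ∂ν
          ≤ ENNReal.ofReal ((k₁ + k₂ + k₁ * (8 / (3 * d ^ 2))) * t⁻¹ ^ 2) * M := by
            refine mul_le_mul' (ENNReal.ofReal_le_ofReal ?_) (hMle g₀ hg)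
            refine mul_le_mul_of_nonneg_right ?_ (by positivity)
            linarith
        _ = _ := by rw [ENNReal.ofReal_mul (by positivity)]; ring
    · calc ENNReal.ofReal (k₃ * t) * ∫⁻ ε, rawMoment ν t g₀ ε ∂(gaussianReal 0 1)
          ≤ ENNReal.ofReal (k₃ * t) * (K₀ * ENNReal.ofReal (t⁻¹ ^ 3)) := by
            gcongr; exact hraw t g₀ ht
        _ = ENNReal.ofReal k₃ * K₀ * ENNReal.ofReal (t * t⁻¹ ^ 3) := by
            rw [ENNReal.ofReal_mul hk₃p.le, ENNReal.ofReal_mul ht.le]; ring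
        _ = _ := by congr 2; field_simp

end Moment

/-! ### Gaussian limits of the coordinates of the posterior -/

section Coordinate

variable (ν : Measure ℝ) [IsProbabilityMeasure ν]

/-- The posterior law of the rescaled and recentred coordinate `u = t (g - g₀) - ε`, given the
observation `t g₀ + ε`. -/
def coordLaw (t g₀ ε : ℝ) : Measure ℝ :=
  (tilt ν t (t * g₀ + ε)).map fun g => t * (g - g₀) - ε

instance (t g₀ ε : ℝ) : IsProbabilityMeasure (coordLaw ν t g₀ ε) :=
  Measure.isProbabilityMeasure_map (by fun_prop)

/-- The normalising constant of the density of `coordLaw`. -/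
def coordMass (φ : ℝ → ℝ) (t g₀ ε : ℝ) : ℝ≥0∞ :=
  ∫⁻ u, ENNReal.ofReal (φ (g₀ + (u + ε) / t)) ∂(gaussianReal 0 1)

/-- The density of `coordLaw` with respect to the standard Gaussian law. -/
def coordDensity (φ : ℝ → ℝ) (t g₀ ε u : ℝ) : ℝ≥0∞ :=
  (coordMass φ t g₀ ε)⁻¹ * ENNReal.ofReal (φ (g₀ + (u + ε) / t))

theorem measurable_coordDensity {φ : ℝ → ℝ} (hφ : Measurable φ) (t g₀ ε : ℝ) :
    Measurable (coordDensity φ t g₀ ε) := by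
  unfold coordDensity; fun_prop

variable {ν}

/-- Substituting `u = t (g - g₀) - ε` turns the likelihood into `exp (-u ^ 2 / 2)`. Recentring by
the noise as well as by the truth makes the standard Gaussian law the reference, with the prior
density as the only weight. -/
theorem lintegral_tiltWeight_mul {ν : Measure ℝ} {φ : ℝ → ℝ} (hφ : Measurable φ)
    (hν : ν = volume.withDensity fun x => ENNReal.ofReal (φ x)) {t : ℝ} (ht : 0 < t) (g₀ ε : ℝ)
    {h : ℝ → ℝ≥0∞}
    (hh : Measurable h) :
    ∫⁻ g, tiltWeight t (t * g₀ + ε) g * h (t * (g - g₀) - ε) ∂ν =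
      ENNReal.ofReal (t⁻¹ * √(2 * Real.pi)) *
        ∫⁻ u, ENNReal.ofReal (φ (g₀ + (u + ε) / t)) * h u ∂(gaussianReal 0 1) := by
  have hpi : 0 < √(2 * Real.pi) := by positivity
  have hm : Measurable fun g => tiltWeight t (t * g₀ + ε) g * h (t * (g - g₀) - ε) :=
    (measurable_tiltWeight_right _ _).mul (hh.comp (by fun_prop))
  rw [hν, lintegral_withDensity_eq_lintegral_mul _ (by fun_prop) hm, lintegral_gaussianReal_eq,
    ENNReal.ofReal_mul (by positivity), mul_assoc, ← mul_assoc (ENNReal.ofReal √(2 * Real.pi)),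
    ← ENNReal.ofReal_mul hpi.le, mul_inv_cancel₀ hpi.ne', ENNReal.ofReal_one, one_mul]
  set k : ℝ → ℝ≥0∞ := fun u => ENNReal.ofReal (Real.exp (-u ^ 2 / 2)) *
    (ENNReal.ofReal (φ (g₀ + (u + ε) / t)) * h u) with hk
  have hkm : Measurable k := by fun_prop
  rw [← lintegral_sub_right_eq_self k ε,
    ← lintegral_comp_mul ht (f := fun s => k (s - ε)) (hkm.comp (by fun_prop)),
    ← lintegral_sub_right_eq_self (fun s => k (t * s - ε)) g₀]
  refine lintegral_congr fun g => ?_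
  have e : g₀ + (t * (g - g₀) - ε + ε) / t = g := by field_simp; ring
  simp only [Pi.mul_apply, hk, e, tiltWeight_shift]
  rw [← neg_sub ε (t * (g - g₀)), neg_sq]
  ring

theorem coordLaw_eq {φ : ℝ → ℝ} (hφ : Measurable φ)
    (hν : ν = volume.withDensity fun x => ENNReal.ofReal (φ x))
    {t : ℝ} (ht : 0 < t) (g₀ ε : ℝ) :
    coordLaw ν t g₀ ε = (gaussianReal 0 1).withDensity (coordDensity φ t g₀ ε) := by
  have hpi : 0 < t⁻¹ * √(2 * Real.pi) := by positivity
  refine Measure.ext_of_lintegral _ fun h hh => ?_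
  have h1 := lintegral_tiltWeight_mul hφ hν ht g₀ ε (h := fun _ => 1) measurable_const
  simp only [mul_one] at h1
  have hden := measurable_coordDensity hφ t g₀ ε
  rw [coordLaw, lintegral_map hh (by fun_prop), lintegral_tilt,
    lintegral_tiltWeight_mul hφ hν ht g₀ ε hh, tiltMass, h1,
    lintegral_withDensity_eq_lintegral_mul _ hden hh]
  simp only [Pi.mul_apply, coordDensity, mul_assoc]
  have hm : Measurable fun u => ENNReal.ofReal (φ (g₀ + (u + ε) / t)) * h u := by fun_prop
  rw [lintegral_const_mul _ hm, ← coordMass,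
    ENNReal.mul_inv (Or.inl (by simpa using hpi)) (Or.inl ENNReal.ofReal_ne_top)]
  set k := ENNReal.ofReal (t⁻¹ * √(2 * Real.pi))
  set J := ∫⁻ u, ENNReal.ofReal (φ (g₀ + (u + ε) / t)) * h u ∂(gaussianReal 0 1)
  calc k⁻¹ * (coordMass φ t g₀ ε)⁻¹ * (k * J) = k⁻¹ * k * ((coordMass φ t g₀ ε)⁻¹ * J) := by ring
    _ = (coordMass φ t g₀ ε)⁻¹ * J := by
      rw [ENNReal.inv_mul_cancel (by simpa [k] using hpi) ENNReal.ofReal_ne_top, one_mul]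

theorem tendsto_affine {t : ℕ → ℝ} (ht : Tendsto t atTop atTop) (g₀ ε u : ℝ) :
    Tendsto (fun n => g₀ + (u + ε) / t n) atTop (𝓝 g₀) := by
  simpa using tendsto_const_nhds.add (tendsto_const_nhds.div_atTop ht)

theorem tendsto_coordMass {φ : ℝ → ℝ} (hφ : Measurable φ) {C : ℝ} (hC : ∀ x, φ x ≤ C)
    {t : ℕ → ℝ} (ht : Tendsto t atTop atTop) {g₀ : ℝ}
    (hcont : ContinuousAt φ g₀) (ε : ℝ) :
    Tendsto (fun n => coordMass φ (t n) g₀ ε) atTop (𝓝 (ENNReal.ofReal (φ g₀))) := by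
  have := tendsto_lintegral_of_dominated_convergence (μ := gaussianReal 0 1)
    (F := fun n u => ENNReal.ofReal (φ (g₀ + (u + ε) / t n)))
    (f := fun _ => ENNReal.ofReal (φ g₀)) (fun _ => ENNReal.ofReal C) (fun n => by fun_prop)
    (fun n => ae_of_all _ fun u => ENNReal.ofReal_le_ofReal (hC _)) (by simp)
    (ae_of_all _ fun u => (ENNReal.continuous_ofReal.tendsto _).comp
      (hcont.tendsto.comp (tendsto_affine ht g₀ ε u)))
  simpa [coordMass] using this

/-- As `t` grows, the prior density is evaluated at points converging to `g₀`; continuity there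
makes the prior locally flat, and the constant `φ g₀` cancels in the normalisation. -/
theorem tendsto_coordDensity {φ : ℝ → ℝ} (hφ : Measurable φ) {C : ℝ} (hC : ∀ x, φ x ≤ C)
    {t : ℕ → ℝ} (ht : Tendsto t atTop atTop) {g₀ : ℝ}
    (hcont : ContinuousAt φ g₀) (hpos : 0 < φ g₀) (ε u : ℝ) :
    Tendsto (fun n => coordDensity φ (t n) g₀ ε u) atTop (𝓝 1) := by
  have h0 : ENNReal.ofReal (φ g₀) ≠ 0 := by simpa using hpos
  have h1 := (tendsto_coordMass hφ hC ht hcont ε).inv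
  have h2 : Tendsto (fun n => ENNReal.ofReal (φ (g₀ + (u + ε) / t n))) atTop
      (𝓝 (ENNReal.ofReal (φ g₀))) := (ENNReal.continuous_ofReal.tendsto _).comp
      (hcont.tendsto.comp (tendsto_affine ht g₀ ε u))
  have := ENNReal.Tendsto.mul h1 (Or.inr ENNReal.ofReal_ne_top) h2
    (Or.inr (by simpa using hpos))
  rwa [ENNReal.inv_mul_cancel h0 ENNReal.ofReal_ne_top] at this

/-- The normalising constant is eventually above `φ g₀ / 2`, so `2 C / φ g₀` dominates uniformly in
`u`. This is the majorant for the convergence of cylinder masses and of means. -/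
theorem eventually_coordDensity_le {φ : ℝ → ℝ} (hφ : Measurable φ) {C : ℝ} (hC : ∀ x, φ x ≤ C)
    {t : ℕ → ℝ} (ht : Tendsto t atTop atTop) {g₀ : ℝ}
    (hcont : ContinuousAt φ g₀) (hpos : 0 < φ g₀) (ε : ℝ) :
    ∃ K : ℝ≥0, ∀ᶠ n in atTop, ∀ u, coordDensity φ (t n) g₀ ε u ≤ K := by
  have h2 : (ENNReal.ofReal (φ g₀ / 2))⁻¹ * ENNReal.ofReal C ≠ ∞ := by
    refine ENNReal.mul_ne_top (ENNReal.inv_ne_top.2 ?_) ENNReal.ofReal_ne_top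
    simpa using hpos
  refine ⟨((ENNReal.ofReal (φ g₀ / 2))⁻¹ * ENNReal.ofReal C).toNNReal, ?_⟩
  have h1 : ENNReal.ofReal (φ g₀ / 2) < ENNReal.ofReal (φ g₀) :=
    (ENNReal.ofReal_lt_ofReal_iff hpos).2 (by linarith)
  filter_upwards [(tendsto_coordMass hφ hC ht hcont ε).eventually (lt_mem_nhds h1)] with n hn u
  rw [ENNReal.coe_toNNReal h2, coordDensity]
  gcongr
  exact hC _

variable (ν) in
/-- The posterior mean of the rescaled and recentred coordinate. -/
def coordMean (t g₀ ε : ℝ) : ℝ := ∫ u, u ∂(coordLaw ν t g₀ ε)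

theorem tendsto_coordMean {φ : ℝ → ℝ} (hφ : Measurable φ)
    (hν : ν = volume.withDensity fun x => ENNReal.ofReal (φ x)) {C : ℝ} (hC : ∀ x, φ x ≤ C)
    {t : ℕ → ℝ} (ht : Tendsto t atTop atTop) {g₀ : ℝ}
    (hcont : ContinuousAt φ g₀) (hpos : 0 < φ g₀) (ε : ℝ) :
    Tendsto (fun n => coordMean ν (t n) g₀ ε) atTop (𝓝 0) := by
  obtain ⟨K, hK⟩ := eventually_coordDensity_le hφ hC ht hcont hpos ε
  have hid : Integrable (fun u : ℝ => u) (gaussianReal 0 1) :=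
    (memLp_id_gaussianReal 1).integrable le_rfl
  have hlim : Tendsto (fun n => ∫ u, (coordDensity φ (t n) g₀ ε u).toReal * u ∂(gaussianReal 0 1))
      atTop (𝓝 (∫ u, u ∂(gaussianReal 0 1))) := by
    refine tendsto_integral_filter_of_dominated_convergence (fun u => (K : ℝ) * |u|)
      (Eventually.of_forall fun n => ?_) ?_ (hid.abs.const_mul _) (ae_of_all _ fun u => ?_)
    · have := measurable_coordDensity hφ (t n) g₀ ε
      exact (this.ennreal_toReal.mul measurable_id).aestronglyMeasurable
    · filter_upwards [hK] with n hn
      refine ae_of_all _ fun u => ?_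
      rw [norm_mul, Real.norm_eq_abs, Real.norm_eq_abs, abs_of_nonneg ENNReal.toReal_nonneg]
      gcongr
      exact ENNReal.toReal_le_coe_of_le_coe (hn u)
    · have h := (ENNReal.tendsto_toReal ENNReal.one_ne_top).comp
        (tendsto_coordDensity hφ hC ht hcont hpos ε u)
      simpa using h.mul_const u
  rw [integral_id_gaussianReal] at hlim
  refine hlim.congr' ?_
  filter_upwards [hK, ht.eventually (eventually_gt_atTop 0)] with n hn hn0
  rw [coordMean, coordLaw_eq hφ hν hn0, integral_withDensity_eq_integral_toReal_smul
    (measurable_coordDensity hφ _ _ _)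
    (ae_of_all _ fun u => (hn u).trans_lt ENNReal.coe_lt_top)]
  rfl

variable (ν) in
/-- The second moment of the rescaled and recentred coordinate under the posterior. -/
def coordMoment (t g₀ ε : ℝ) : ℝ≥0∞ := ∫⁻ u, ENNReal.ofReal (u ^ 2) ∂(coordLaw ν t g₀ ε)

theorem coordMoment_eq (t g₀ ε : ℝ) : coordMoment ν t g₀ ε =
    ∫⁻ g, ENNReal.ofReal ((t * (g - g₀) - ε) ^ 2) ∂(tilt ν t (t * g₀ + ε)) := by
  rw [coordMoment, coordLaw, lintegral_map (by fun_prop) (by fun_prop)]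

theorem lintegral_gaussianReal_sq_ne_top :
    ∫⁻ ε, ENNReal.ofReal (ε ^ 2) ∂(gaussianReal 0 1) ≠ ∞ := by
  have h : MemLp (fun x : ℝ => x) 2 (gaussianReal 0 1) := memLp_id_gaussianReal 2
  exact ((memLp_two_iff_integrable_sq h.1).1 h).lintegral_lt_top.ne

/-- From `(a - ε) ^ 2 ≤ 2 a ^ 2 + 2 ε ^ 2`. Combined with a risk of order `t ^ (-2)`, it bounds the
local second moments uniformly over all coordinates. -/
theorem lintegral_coordMoment_le (t g₀ : ℝ) :
    ∫⁻ ε, coordMoment ν t g₀ ε ∂(gaussianReal 0 1) ≤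
      ENNReal.ofReal (2 * t ^ 2) * tiltRisk ν t g₀ +
        2 * ∫⁻ ε, ENNReal.ofReal (ε ^ 2) ∂(gaussianReal 0 1) := by
  have h : ∀ ε, coordMoment ν t g₀ ε ≤ ENNReal.ofReal (2 * t ^ 2) *
      (∫⁻ g, ENNReal.ofReal ((g - g₀) ^ 2) ∂(tilt ν t (t * g₀ + ε))) +
      2 * ENNReal.ofReal (ε ^ 2) := by
    intro ε
    rw [coordMoment_eq]
    calc _ ≤ ∫⁻ g, (ENNReal.ofReal (2 * t ^ 2) * ENNReal.ofReal ((g - g₀) ^ 2) +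
          2 * ENNReal.ofReal (ε ^ 2)) ∂(tilt ν t (t * g₀ + ε)) := by
          refine lintegral_mono fun g => ?_
          rw [← ENNReal.ofReal_mul (by positivity), ← ENNReal.ofReal_ofNat,
            ← ENNReal.ofReal_mul (by norm_num), ← ENNReal.ofReal_add (by positivity)
            (by positivity)]
          refine ENNReal.ofReal_le_ofReal ?_
          nlinarith [sq_nonneg (t * (g - g₀) + ε)]
      _ = _ := by
          rw [lintegral_add_right _ measurable_const, lintegral_const_mul' _ _
            ENNReal.ofReal_ne_top]
          simp
  refine (lintegral_mono h).trans (le_of_eq ?_)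
  rw [lintegral_add_right _ (by fun_prop), lintegral_const_mul' _ _ ENNReal.ofReal_ne_top,
    lintegral_const_mul _ (by fun_prop), tiltRisk]

end Coordinate

/-! ### Convergence of finitely many coordinates -/

section Cylinder

variable {ι : Type*}

theorem pi_withDensity {F : Type*} [Fintype F] (μ : F → Measure ℝ)
    [∀ i, IsProbabilityMeasure (μ i)] (ρ : F → ℝ → ℝ≥0∞) (hρ : ∀ i, Measurable (ρ i))
    [∀ i, IsProbabilityMeasure ((μ i).withDensity (ρ i))] :
    Measure.pi (fun i => (μ i).withDensity (ρ i)) =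
      (Measure.pi μ).withDensity fun x => ∏ i, ρ i (x i) := by
  refine Measure.pi_eq fun s hs => ?_
  rw [withDensity_apply _ (MeasurableSet.univ_pi hs),
    ← lintegral_indicator (MeasurableSet.univ_pi hs), ← Measure.infinitePi_eq_pi]
  have e : ∀ x : F → ℝ, (univ.pi s).indicator (fun x => ∏ i, ρ i (x i)) x =
      ∏ i, (s i).indicator (ρ i) (x i) := by
    intro x
    by_cases hx : x ∈ univ.pi s
    · rw [indicator_of_mem hx]
      exact Finset.prod_congr rfl fun i _ => (indicator_of_mem (hx i (mem_univ i)) _).symm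
    · rw [indicator_of_notMem hx]
      simp only [Set.mem_pi, mem_univ, true_imp_iff, not_forall] at hx
      obtain ⟨i, hi⟩ := hx
      exact (Finset.prod_eq_zero (Finset.mem_univ i) (indicator_of_notMem hi _)).symm
  simp_rw [e]
  rw [lintegral_infinitePi_prod μ Finset.univ (fun i => (s i).indicator (ρ i))
    fun i => (hρ i).indicator (hs i)]
  refine Finset.prod_congr rfl fun i _ => ?_
  rw [lintegral_indicator (hs i), withDensity_apply _ (hs i)]

/-- Only the finitely many coordinates in `F` matter, and there the product density tends to `1`
boundedly. Convergence of densities handles every measurable `A`, with no condition on its boundary.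
-/
theorem tendsto_infinitePi_cylinder (μ : ℕ → ι → Measure ℝ)
    [∀ n i, IsProbabilityMeasure (μ n i)] (F : Finset ι) (ρ : ℕ → ι → ℝ → ℝ≥0∞)
    (hρ : ∀ n i, Measurable (ρ n i))
    (hμ : ∀ᶠ n in atTop, ∀ i, μ n i = (gaussianReal 0 1).withDensity (ρ n i))
    (hlim : ∀ i u, Tendsto (fun n => ρ n i u) atTop (𝓝 1))
    (hbdd : ∀ i, ∃ K : ℝ≥0, ∀ᶠ n in atTop, ∀ u, ρ n i u ≤ K)
    {A : Set (F → ℝ)} (hA : MeasurableSet A) :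
    Tendsto (fun n => Measure.infinitePi (μ n) (F.restrict ⁻¹' A)) atTop
      (𝓝 (stdGaussian ι (F.restrict ⁻¹' A))) := by
  have hF := fun (μ : ι → Measure ℝ) [∀ i, IsProbabilityMeasure (μ i)] =>
    show Measure.infinitePi μ (F.restrict ⁻¹' A) = Measure.pi (fun i : F => μ i) A by
      rw [← Measure.infinitePi_map_restrict, Measure.map_apply (Finset.measurable_restrict F) hA]
  rw [hF]
  simp_rw [hF]
  choose K hK using hbdd
  have hlim' : Tendsto (fun n => ∫⁻ x in A, ∏ i : F, ρ n i (x i)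
      ∂(Measure.pi fun _ : F => gaussianReal 0 1)) atTop
      (𝓝 (∫⁻ _ in A, 1 ∂(Measure.pi fun _ : F => gaussianReal 0 1))) := by
    refine tendsto_lintegral_filter_of_dominated_convergence (fun _ => ∏ i : F, (K i : ℝ≥0∞))
      (Eventually.of_forall fun n => ?_) ?_ ?_ (ae_of_all _ fun x => ?_)
    · exact Finset.measurable_fun_prod _ fun i _ => (hρ n i).comp (measurable_pi_apply i)
    · filter_upwards [(Finset.eventually_all F).2 fun i _ => hK i] with n hn
      exact ae_of_all _ fun x => Finset.prod_le_prod' fun i _ => hn i i.2 (x i)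
    · rw [lintegral_const]
      exact ENNReal.mul_ne_top (ENNReal.prod_ne_top fun i _ => ENNReal.coe_ne_top)
        (measure_ne_top _ _)
    · have := ENNReal.tendsto_finsetProd_of_ne_top (Finset.univ : Finset F)
        (f := fun (i : F) n => ρ n i (x i)) (a := fun _ => 1) (x := atTop)
        (fun i _ => hlim i (x i)) (fun _ _ => ENNReal.one_ne_top)
      simpa using this
  rw [setLIntegral_one] at hlim'
  refine hlim'.congr' ?_
  filter_upwards [hμ] with n hn
  have : ∀ i : F, IsProbabilityMeasure ((gaussianReal 0 1).withDensity (ρ n i)) := fun i => by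
    rw [← hn i]; infer_instance
  simp_rw [hn]
  rw [pi_withDensity (fun _ : F => gaussianReal 0 1) (fun i => ρ n i) fun i => hρ n i,
    withDensity_apply _ hA]

end Cylinder

/-! ### Weighted `ℓ²` norms -/

section WeightedNorm

variable {ι : Type*}

/-- The weighted `ℓ²` norm with weights `w`. -/
def wnorm (w a : ι → ℝ) : ℝ≥0∞ := (∑' i, ENNReal.ofReal (w i * a i ^ 2)) ^ (1 / 2 : ℝ)

theorem measurable_wnorm [Countable ι] (w : ι → ℝ) : Measurable (wnorm w) := by
  unfold wnorm; fun_prop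

theorem wnorm_sq (w a : ι → ℝ) : wnorm w a ^ 2 = ∑' i, ENNReal.ofReal (w i * a i ^ 2) := by
  rw [wnorm, ← ENNReal.rpow_natCast, ← ENNReal.rpow_mul]; norm_num

theorem wnorm_eq_iff (w a : ι → ℝ) (c : ℝ≥0∞) :
    wnorm w a = c ↔ ∑' i, ENNReal.ofReal (w i * a i ^ 2) = c ^ 2 := by
  rw [← wnorm_sq]
  exact (ENNReal.pow_right_strictMono two_ne_zero).injective.eq_iff.symm

theorem wnorm_ne_top_iff (w a : ι → ℝ) :
    wnorm w a ≠ ∞ ↔ ∑' i, ENNReal.ofReal (w i * a i ^ 2) ≠ ∞ := by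
  rw [← wnorm_sq, not_iff_not]
  simp

/-- Minkowski's inequality for counting measure, with `√(w i)` absorbed in the function. -/
theorem wnorm_add_le [Countable ι] {w : ι → ℝ} (hw : ∀ i, 0 ≤ w i) (a b : ι → ℝ) :
    wnorm w (a + b) ≤ wnorm w a + wnorm w b := by
  let _ : MeasurableSpace ι := ⊤
  have e : ∀ a : ι → ℝ, wnorm w a =
      (∫⁻ i, (fun i => ENNReal.ofReal (√(w i) * |a i|)) i ^ (2 : ℝ) ∂Measure.count) ^
        (1 / 2 : ℝ) := by
    intro a
    rw [lintegral_count, wnorm]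
    congr 2
    ext i
    rw [ENNReal.rpow_two, ← ENNReal.ofReal_pow (by positivity), mul_pow,
      Real.sq_sqrt (hw i), sq_abs]
  rw [e, e, e]
  refine le_trans ?_ (ENNReal.lintegral_Lp_add_le (measurable_from_top).aemeasurable
    (measurable_from_top).aemeasurable one_le_two)
  gcongr with i
  simp only [Pi.add_apply]
  rw [← ENNReal.ofReal_add (by positivity) (by positivity), ← mul_add]
  gcongr
  exact abs_add_le _ _

theorem wnorm_const_mul (w : ι → ℝ) (c : ℝ) (a : ι → ℝ) :
    wnorm w (fun i => c * a i) = ENNReal.ofReal |c| * wnorm w a := by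
  have h : ∀ i, ENNReal.ofReal (w i * (c * a i) ^ 2) =
      ENNReal.ofReal (c ^ 2) * ENNReal.ofReal (w i * a i ^ 2) := by
    intro i
    rw [← ENNReal.ofReal_mul (sq_nonneg c)]
    congr 1; ring
  simp_rw [wnorm, h]
  rw [ENNReal.tsum_mul_left, ENNReal.mul_rpow_of_nonneg _ _ (by norm_num),
    ENNReal.ofReal_rpow_of_nonneg (sq_nonneg c) (by norm_num), ← Real.sqrt_eq_rpow,
    Real.sqrt_sq_eq_abs]

theorem wnorm_neg (w a : ι → ℝ) : wnorm w (-a) = wnorm w a := by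
  simp [wnorm]

theorem wnorm_sub_le [Countable ι] {w : ι → ℝ} (hw : ∀ i, 0 ≤ w i) (a b : ι → ℝ) :
    wnorm w (a - b) ≤ wnorm w a + wnorm w b := by
  rw [sub_eq_add_neg, ← wnorm_neg w b]
  exact wnorm_add_le hw _ _

theorem wnorm_le_add_sub [Countable ι] {w : ι → ℝ} (hw : ∀ i, 0 ≤ w i) (a b : ι → ℝ) :
    wnorm w a ≤ wnorm w b + wnorm w (a - b) := by
  simpa using wnorm_add_le hw b (a - b)

theorem wnorm_mono {w a b : ι → ℝ} (hw : ∀ i, 0 ≤ w i) (h : ∀ i, |a i| ≤ |b i|) :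
    wnorm w a ≤ wnorm w b := by
  exact ENNReal.rpow_le_rpow (ENNReal.tsum_le_tsum fun i => ENNReal.ofReal_le_ofReal
    (mul_le_mul_of_nonneg_left (sq_le_sq.2 (h i)) (hw i))) (by norm_num)

/-- The part of `a` off `F`. -/
def tailPart [DecidableEq ι] (F : Finset ι) (a : ι → ℝ) : ι → ℝ := fun i => if i ∈ F then 0 else a i

theorem cutoff_add_tailPart [DecidableEq ι] (F : Finset ι) (a : ι → ℝ) :
    cutoff F a + tailPart F a = a := by
  ext i
  by_cases h : i ∈ F <;> simp [cutoff, tailPart, h]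

theorem wnorm_cutoff_sq [DecidableEq ι] (w a : ι → ℝ) (F : Finset ι) :
    wnorm w (cutoff F a) ^ 2 = ∑ i ∈ F, ENNReal.ofReal (w i * a i ^ 2) := by
  rw [wnorm_sq, tsum_eq_sum (s := F) fun i hi => by simp [cutoff, hi]]
  exact Finset.sum_congr rfl fun i hi => by simp [cutoff, hi]

theorem wnorm_tailPart_sq [DecidableEq ι] (w a : ι → ℝ) (F : Finset ι) :
    wnorm w (tailPart F a) ^ 2 = ∑' i : {i // i ∉ F}, ENNReal.ofReal (w i * a i ^ 2) := by
  rw [wnorm_sq, ← tsum_subtype_eq_of_support_subset (s := {i | i ∉ F})]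
  · exact tsum_congr fun i => by rw [tailPart, if_neg i.2]
  · intro i hi
    simp only [tailPart, Function.mem_support] at hi
    intro hF
    simp [hF] at hi

theorem measurable_cutoff [DecidableEq ι] (F : Finset ι) :
    Measurable (cutoff F : (ι → ℝ) → ι → ℝ) := by
  refine measurable_pi_lambda _ fun i => ?_
  by_cases h : i ∈ F
  · simpa [cutoff, h] using! measurable_pi_apply i
  · simp [cutoff, h]

end WeightedNorm

/-! ### Continuous distribution functions -/

section Quantile

variable {Ω : Type*} [MeasurableSpace Ω] {μ : Measure Ω} [IsProbabilityMeasure μ] {T : Ω → ℝ≥0∞}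

/-- As `r` varies near `r₀`, the indicator of the event is locally constant except on the null set
where `T` equals `ENNReal.ofReal r₀`. -/
theorem continuous_measure_le (hT : Measurable T) (hatom : ∀ c, c ≠ ∞ → μ {ω | T ω = c} = 0) :
    Continuous fun r : ℝ => μ {ω | T ω ≤ ENNReal.ofReal r} := by
  refine continuous_iff_continuousAt.2 fun r₀ => ?_
  have hm : ∀ r : ℝ, MeasurableSet {ω | T ω ≤ ENNReal.ofReal r} := fun r =>
    measurableSet_le hT measurable_const
  have e : ∀ r : ℝ, μ {ω | T ω ≤ ENNReal.ofReal r} =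
      ∫⁻ ω, {ω | T ω ≤ ENNReal.ofReal r}.indicator 1 ω ∂μ := fun r =>
    (lintegral_indicator_one (hm r)).symm
  unfold ContinuousAt
  simp_rw [e]
  refine tendsto_lintegral_filter_of_dominated_convergence (fun _ => 1)
    (Eventually.of_forall fun r => measurable_one.indicator (hm r))
    (Eventually.of_forall fun r => ae_of_all _ fun ω => indicator_le_self' (by simp) ω)
    (by simp) ?_
  have hne : ∀ᵐ ω ∂μ, T ω ≠ ENNReal.ofReal r₀ := by
    rw [ae_iff]; simpa using hatom _ ENNReal.ofReal_ne_top
  have hc : Tendsto ENNReal.ofReal (𝓝 r₀) (𝓝 (ENNReal.ofReal r₀)) :=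
    ENNReal.continuous_ofReal.tendsto r₀
  filter_upwards [hne] with ω hω
  rcases hω.lt_or_gt with h | h
  · refine tendsto_const_nhds.congr' ?_
    filter_upwards [hc.eventually (lt_mem_nhds h)] with r hr
    rw [indicator_of_mem (show ω ∈ {ω | T ω ≤ ENNReal.ofReal r₀} from h.le),
      indicator_of_mem (show ω ∈ {ω | T ω ≤ ENNReal.ofReal r} from hr.le)]
  · refine tendsto_const_nhds.congr' ?_
    filter_upwards [hc.eventually (gt_mem_nhds h)] with r hr
    rw [indicator_of_notMem (show ω ∉ {ω | T ω ≤ ENNReal.ofReal r₀} from not_le.2 h),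
      indicator_of_notMem (show ω ∉ {ω | T ω ≤ ENNReal.ofReal r} from not_le.2 hr)]

theorem tendsto_measure_le (hT : Measurable T) (hfin : ∀ᵐ ω ∂μ, T ω ≠ ∞) :
    Tendsto (fun r : ℝ => μ {ω | T ω ≤ ENNReal.ofReal r}) atTop (𝓝 1) := by
  have hm : ∀ r : ℝ, MeasurableSet {ω | T ω ≤ ENNReal.ofReal r} := fun r =>
    measurableSet_le hT measurable_const
  have e : ∀ r : ℝ, μ {ω | T ω ≤ ENNReal.ofReal r} =
      ∫⁻ ω, {ω | T ω ≤ ENNReal.ofReal r}.indicator 1 ω ∂μ := fun r =>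
    (lintegral_indicator_one (hm r)).symm
  simp_rw [e]
  have h1 : (1 : ℝ≥0∞) = ∫⁻ _, 1 ∂μ := by simp
  rw [h1]
  refine tendsto_lintegral_filter_of_dominated_convergence (fun _ => 1)
    (Eventually.of_forall fun r => measurable_one.indicator (hm r))
    (Eventually.of_forall fun r => ae_of_all _ fun ω => indicator_le_self' (by simp) ω)
    (by simp) ?_
  filter_upwards [hfin] with ω hω
  refine tendsto_const_nhds.congr' ?_
  filter_upwards [eventually_ge_atTop (T ω).toReal] with r hr
  rw [indicator_of_mem]
  · rfl
  · exact (ENNReal.le_ofReal_iff_toReal_le hω (ENNReal.toReal_nonneg.trans hr)).2 hr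

/-- The intermediate value theorem: the distribution function is continuous, starts at `0` since
there is no atom at zero, and tends to `1` since `T` is almost surely finite. -/
theorem exists_measure_le_eq (hT : Measurable T) (hatom : ∀ c, c ≠ ∞ → μ {ω | T ω = c} = 0)
    (hfin : ∀ᵐ ω ∂μ, T ω ≠ ∞) {p : ℝ≥0∞} (hp0 : 0 < p) (hp1 : p < 1) :
    ∃ r : ℝ, 0 < r ∧ μ {ω | T ω ≤ ENNReal.ofReal r} = p := by
  have h0 : μ {ω | T ω ≤ ENNReal.ofReal 0} = 0 := by
    simpa using hatom 0 ENNReal.zero_ne_top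
  obtain ⟨R, hR, hR0⟩ := (((tendsto_measure_le hT hfin).eventually (lt_mem_nhds hp1)).and
    (eventually_ge_atTop 0)).exists
  obtain ⟨r, hr, he⟩ := intermediate_value_Icc hR0 (continuous_measure_le hT hatom).continuousOn
    (show p ∈ Icc (μ {ω | T ω ≤ ENNReal.ofReal 0}) (μ {ω | T ω ≤ ENNReal.ofReal R}) from
      ⟨by rw [h0]; exact bot_le, hR.le⟩)
  refine ⟨r, lt_of_le_of_ne hr.1 ?_, he⟩
  rintro rfl
  have he' : μ {ω | T ω ≤ ENNReal.ofReal 0} = p := he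
  rw [h0] at he'
  exact hp0.ne he'

end Quantile

/-! ### Convergence to zero in probability -/

section Negligible

variable {Ω : Type*} [MeasurableSpace Ω] {P : Measure Ω}

/-- `X n → 0` in `P`-probability, for `[0,∞]`-valued `X n` that need not be measurable. -/
def Negligible (P : Measure Ω) (X : ℕ → Ω → ℝ≥0∞) : Prop :=
  ∀ e : ℝ≥0∞, e ≠ 0 → Tendsto (fun n => P {ω | e ≤ X n ω}) atTop (𝓝 0)

theorem Negligible.add {X Y : ℕ → Ω → ℝ≥0∞} (hX : Negligible P X) (hY : Negligible P Y) :
    Negligible P fun n ω => X n ω + Y n ω := by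
  intro e he
  by_cases het : e = ∞
  · refine tendsto_of_tendsto_of_tendsto_of_le_of_le tendsto_const_nhds
      (by simpa using (hX ∞ ENNReal.top_ne_zero).add (hY ∞ ENNReal.top_ne_zero))
      (fun _ => bot_le) fun n => (measure_mono fun ω hω => ?_).trans (measure_union_le _ _)
    simpa [het] using hω
  have h2 : e / 2 ≠ 0 := by simpa using he
  refine tendsto_of_tendsto_of_tendsto_of_le_of_le tendsto_const_nhds
    (by simpa using (hX (e / 2) h2).add (hY (e / 2) h2))
    (fun _ => bot_le) fun n => (measure_mono fun ω hω => ?_).trans (measure_union_le _ _)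
  by_contra hcon
  simp only [mem_union, mem_ofPred_eq, not_or, not_le] at hcon hω
  have := ENNReal.add_lt_add hcon.1 hcon.2
  rw [ENNReal.add_halves] at this
  exact absurd hω (not_le.2 this)

/-- Approximation by negligible sequences up to an error of small expectation. -/
theorem negligible_of_approx {X : ℕ → Ω → ℝ≥0∞}
    (h : ∀ κ : ℝ≥0∞, 0 < κ → ∃ Y Z : ℕ → Ω → ℝ≥0∞, Negligible P Y ∧ (∀ n, Measurable (Z n)) ∧
      (∀ᶠ n in atTop, ∫⁻ ω, Z n ω ∂P ≤ κ) ∧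
      ∀ᶠ n in atTop, ∀ ω, X n ω ≤ Y n ω + Z n ω) : Negligible P X := by
  intro e he
  wlog het : e ≠ ∞ generalizing e with H
  · refine tendsto_of_tendsto_of_tendsto_of_le_of_le tendsto_const_nhds
      (H 1 one_ne_zero ENNReal.one_ne_top) (fun _ => bot_le) fun n => measure_mono fun ω hω => ?_
    push Not at het
    simp only [het, top_le_iff, mem_ofPred_eq] at hω ⊢
    simp [hω]
  have h2 : e / 2 ≠ 0 := by simpa using he
  have h2t : e / 2 ≠ ∞ := by finiteness
  rw [ENNReal.tendsto_nhds_zero]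
  intro κ hκ
  obtain ⟨Y, Z, hY, hZm, hZ, hX⟩ := h (κ / 2 * (e / 2))
    (ENNReal.mul_pos (by simpa using hκ.ne') h2)
  have hY' := (ENNReal.tendsto_nhds_zero.1 (hY (e / 2) h2)) (κ / 2) (by simpa using hκ.ne')
  filter_upwards [hY', hZ, hX] with n h1 h3 h4
  calc P {ω | e ≤ X n ω} ≤ P ({ω | e / 2 ≤ Y n ω} ∪ {ω | e / 2 ≤ Z n ω}) := by
        refine measure_mono fun ω hω => ?_
        by_contra hcon
        simp only [mem_union, mem_ofPred_eq, not_or, not_le] at hcon hω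
        have := ENNReal.add_lt_add hcon.1 hcon.2
        rw [ENNReal.add_halves] at this
        exact absurd (hω.trans (h4 ω)) (not_le.2 this)
    _ ≤ P {ω | e / 2 ≤ Y n ω} + P {ω | e / 2 ≤ Z n ω} := measure_union_le _ _
    _ ≤ κ / 2 + κ / 2 := by
        refine add_le_add h1 ((meas_ge_le_lintegral_div (hZm n).aemeasurable h2 h2t).trans ?_)
        exact ENNReal.div_le_of_le_mul h3
    _ = κ := ENNReal.add_halves κ

theorem negligible_of_tendsto [IsFiniteMeasure P] {X : ℕ → Ω → ℝ≥0∞} (hX : ∀ n, Measurable (X n))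
    (h : ∀ ω, Tendsto (fun n => X n ω) atTop (𝓝 0)) : Negligible P X := by
  intro e he
  have hm : ∀ n, MeasurableSet {ω | e ≤ X n ω} := fun n => measurableSet_le measurable_const (hX n)
  simp_rw [← lintegral_indicator_one (hm _)]
  have := tendsto_lintegral_of_dominated_convergence (μ := P)
    (F := fun n => {ω | e ≤ X n ω}.indicator (1 : Ω → ℝ≥0∞)) (f := fun _ => 0) (fun _ => 1)
    (fun n => measurable_one.indicator (hm n))
    (fun n => ae_of_all _ fun ω => indicator_le_self' (by simp) ω) (by simp)
    (ae_of_all _ fun ω => ?_)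
  · simpa using this
  · refine tendsto_const_nhds.congr' ?_
    filter_upwards [(h ω).eventually (gt_mem_nhds (pos_iff_ne_zero.2 he))] with n hn
    rw [indicator_of_notMem]
    exact not_le.2 hn

theorem Negligible.indicator {X : ℕ → Ω → ℝ≥0∞} (hX : Negligible P X) {e : ℝ≥0∞} (he : e ≠ 0) :
    Negligible P fun n => {ω | e ≤ X n ω}.indicator fun _ => 1 := by
  intro e' he'
  refine tendsto_of_tendsto_of_tendsto_of_le_of_le tendsto_const_nhds (hX e he)
    (fun _ => bot_le) fun n => measure_mono fun ω hω => ?_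
  by_contra h
  have h1 : ({ω | e ≤ X n ω}.indicator (fun _ => (1 : ℝ≥0∞)) ω) = 0 := indicator_of_notMem h _
  simp only [mem_ofPred_eq, h1, nonpos_iff_eq_zero] at hω
  exact he' hω

end Negligible

/-! ### Product kernels with Gaussian limits -/

section GaussianLimit

variable {ι : Type*}

theorem wnorm_le_iff (w a : ι → ℝ) (c : ℝ≥0∞) :
    wnorm w a ≤ c ↔ ∑' i, ENNReal.ofReal (w i * a i ^ 2) ≤ c ^ 2 := by
  rw [← wnorm_sq]
  exact (ENNReal.pow_right_strictMono two_ne_zero).le_iff_le.symm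

theorem le_wnorm_iff (w a : ι → ℝ) (c : ℝ≥0∞) :
    c ≤ wnorm w a ↔ c ^ 2 ≤ ∑' i, ENNReal.ofReal (w i * a i ^ 2) := by
  rw [← wnorm_sq]
  exact (ENNReal.pow_right_strictMono two_ne_zero).le_iff_le.symm

theorem lintegral_tsum_infinitePi [Countable ι] (μ : ι → Measure ℝ)
    [∀ i, IsProbabilityMeasure (μ i)] {w : ι → ℝ} (hw : ∀ i, 0 ≤ w i) (F : Finset ι) :
    ∫⁻ z, ∑' i : {i // i ∉ F}, ENNReal.ofReal (w i * z i ^ 2) ∂(Measure.infinitePi μ) =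
      ∑' i : {i // i ∉ F}, ENNReal.ofReal (w i) * ∫⁻ u, ENNReal.ofReal (u ^ 2) ∂(μ i) := by
  have h : ∀ i : {i // i ∉ F}, Measurable fun z : ι → ℝ => ENNReal.ofReal (w i * z i ^ 2) :=
    fun i => (((measurable_pi_apply (i : ι)).pow_const 2).const_mul _).ennreal_ofReal
  rw [lintegral_tsum fun i => (h i).aemeasurable]
  refine tsum_congr fun i => ?_
  simp_rw [fun z : ι → ℝ => ENNReal.ofReal_mul (q := z i ^ 2) (hw i)]
  rw [lintegral_const_mul' _ _ ENNReal.ofReal_ne_top,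
    lintegral_infinitePi_eval μ (i : ι) (f := fun u => ENNReal.ofReal (u ^ 2)) (by fun_prop)]

theorem measure_le_wnorm_tailPart [Countable ι] [DecidableEq ι] (μ : ι → Measure ℝ)
    [∀ i, IsProbabilityMeasure (μ i)] {w : ι → ℝ} (hw : ∀ i, 0 ≤ w i) (F : Finset ι) {e : ℝ≥0∞}
    (he : e ≠ 0) (het : e ≠ ∞) :
    Measure.infinitePi μ {z | e ≤ wnorm w (tailPart F z)} ≤
      (e ^ 2)⁻¹ * ∑' i : {i // i ∉ F}, ENNReal.ofReal (w i) *
        ∫⁻ u, ENNReal.ofReal (u ^ 2) ∂(μ i) := by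
  have h1 : {z : ι → ℝ | e ≤ wnorm w (tailPart F z)} =
      {z | e ^ 2 ≤ ∑' i : {i // i ∉ F}, ENNReal.ofReal (w i * z i ^ 2)} := by
    ext z
    rw [mem_ofPred_eq, mem_ofPred_eq, ← wnorm_tailPart_sq]
    exact (ENNReal.pow_right_strictMono two_ne_zero).le_iff_le.symm
  rw [h1, mul_comm, ← div_eq_mul_inv, ← lintegral_tsum_infinitePi μ hw F]
  have h : ∀ i : {i // i ∉ F}, Measurable fun z : ι → ℝ => ENNReal.ofReal (w i * z i ^ 2) :=
    fun i => (((measurable_pi_apply (i : ι)).pow_const 2).const_mul _).ennreal_ofReal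
  exact meas_ge_le_lintegral_div (Measurable.tsum h).aemeasurable (by positivity) (by finiteness)

theorem wnorm_cutoff_le_preimage [DecidableEq ι] (w : ι → ℝ) (F : Finset ι) (c : ℝ≥0∞) :
    {z : ι → ℝ | wnorm w (cutoff F z) ≤ c} =
      F.restrict ⁻¹' {x : F → ℝ | ∑ i : F, ENNReal.ofReal (w i * x i ^ 2) ≤ c ^ 2} := by
  ext z
  rw [mem_ofPred_eq, mem_preimage, mem_ofPred_eq,
    ← (ENNReal.pow_right_strictMono two_ne_zero).le_iff_le]
  simp only [wnorm_cutoff_sq, Finset.restrict]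
  rw [← Finset.sum_coe_sort F fun i => ENNReal.ofReal (w i * z i ^ 2)]

theorem wnorm_cutoff_le [DecidableEq ι] {w : ι → ℝ} (hw : ∀ i, 0 ≤ w i) (F : Finset ι)
    (a : ι → ℝ) : wnorm w (cutoff F a) ≤ wnorm w a :=
  wnorm_mono hw fun i => by
    by_cases h : i ∈ F <;> simp [cutoff, h]

theorem wnorm_le_cutoff_add_tailPart [Countable ι] [DecidableEq ι] {w : ι → ℝ}
    (hw : ∀ i, 0 ≤ w i) (F : Finset ι) (a : ι → ℝ) :
    wnorm w a ≤ wnorm w (cutoff F a) + wnorm w (tailPart F a) := by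
  conv_lhs => rw [← cutoff_add_tailPart F a]
  exact wnorm_add_le hw _ _

theorem exists_finset_tsum_le {w : ι → ℝ} (hws : ∑' i, ENNReal.ofReal (w i) ≠ ∞) {K κ : ℝ≥0∞}
    (hK : K ≠ ∞) (hκ : 0 < κ) :
    ∃ F : Finset ι, ∑' i : {i // i ∉ F}, ENNReal.ofReal (w i) * K ≤ κ := by
  have h := ENNReal.tendsto_tsum_compl_atTop_zero (f := fun i => ENNReal.ofReal (w i) * K)
    (by rw [ENNReal.tsum_mul_right]; exact ENNReal.mul_ne_top hws hK)
  exact (ENNReal.tendsto_nhds_zero.1 h κ hκ).exists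

/-- The coordinatewise means of a product kernel. -/
def kernelMean (ρ : ι → Kernel ℝ ℝ) (ε : ι → ℝ) : ι → ℝ := fun i => ∫ u, u ∂(ρ i (ε i))

/-- Markov kernels on the coordinates that are asymptotically standard Gaussian: all finite
dimensional distributions of the products converge, the means tend to zero, and the second moments
are bounded on average. -/
structure AsympGaussian (ρ : ℕ → ι → Kernel ℝ ℝ) [∀ n i, IsMarkovKernel (ρ n i)] : Prop where
  cylinder : ∀ (ε : ι → ℝ) (F : Finset ι) (A : Set (F → ℝ)), MeasurableSet A →
    Tendsto (fun n => prodKernel (ρ n) ε (F.restrict ⁻¹' A)) atTop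
      (𝓝 (stdGaussian ι (F.restrict ⁻¹' A)))
  mean : ∀ i ε, Tendsto (fun n => ∫ u, u ∂(ρ n i ε)) atTop (𝓝 0)
  moment : ∃ K : ℝ≥0∞, K ≠ ∞ ∧ ∀ᶠ n in atTop, ∀ i,
    ∫⁻ ε, ∫⁻ u, ENNReal.ofReal (u ^ 2) ∂(ρ n i ε) ∂(gaussianReal 0 1) ≤ K

theorem mean_sq_le_moment (μ : Measure ℝ) [IsProbabilityMeasure μ] :
    ENNReal.ofReal ((∫ u, u ∂μ) ^ 2) ≤ ∫⁻ u, ENNReal.ofReal (u ^ 2) ∂μ := by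
  by_cases h : ∫⁻ u, ENNReal.ofReal (u ^ 2) ∂μ = ∞
  · simp [h]
  have hint : Integrable (fun u : ℝ => u ^ 2) μ := by
    refine ⟨by fun_prop, ?_⟩
    rw [hasFiniteIntegral_iff_ofReal (ae_of_all _ fun u => sq_nonneg u)]
    exact lt_top_iff_ne_top.2 h
  have hL : MemLp (fun u : ℝ => u) 2 μ := (memLp_two_iff_integrable_sq (by fun_prop)).2 hint
  have hv := variance_nonneg (fun u : ℝ => u) μ
  rw [variance_eq_sub hL] at hv
  rw [← ofReal_integral_eq_lintegral_ofReal hint (ae_of_all _ fun u => sq_nonneg u)]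
  refine ENNReal.ofReal_le_ofReal ?_
  simpa using hv

theorem measurable_kernelMean (ρ : ι → Kernel ℝ ℝ) [∀ i, IsMarkovKernel (ρ i)] :
    Measurable (kernelMean ρ) := by
  refine measurable_pi_lambda _ fun i => ?_
  have h : Measurable fun ε : ℝ => ∫ u, u ∂(ρ i ε) :=
    (StronglyMeasurable.integral_kernel (κ := ρ i) (f := fun u : ℝ => u)
      stronglyMeasurable_id).measurable
  exact h.comp (measurable_pi_apply i)

theorem Negligible.of_sq {Ω : Type*} [MeasurableSpace Ω] {P : Measure Ω} {X : ℕ → Ω → ℝ≥0∞}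
    (h : Negligible P fun n ω => X n ω ^ 2) : Negligible P X := by
  intro e he
  have := h (e ^ 2) (by positivity)
  simpa only [(ENNReal.pow_right_strictMono two_ne_zero).le_iff_le] using this

variable [Countable ι] {w : ι → ℝ} {ρ : ℕ → ι → Kernel ℝ ℝ} [∀ n i, IsMarkovKernel (ρ n i)]

theorem measurable_tail_moment (ρ : ι → Kernel ℝ ℝ) [∀ i, IsMarkovKernel (ρ i)] (F : Finset ι) :
    Measurable fun ε : ι → ℝ => ∑' i : {i // i ∉ F}, ENNReal.ofReal (w i) *
      ∫⁻ u, ENNReal.ofReal (u ^ 2) ∂(ρ i (ε i)) := by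
  refine Measurable.tsum fun i => Measurable.const_mul ?_ _
  have h : Measurable fun ε : ℝ => ∫⁻ u, ENNReal.ofReal (u ^ 2) ∂(ρ i ε) :=
    Measurable.lintegral_kernel (by fun_prop)
  exact h.comp (measurable_pi_apply (i : ι))

theorem lintegral_tail_moment_le (ρ : ι → Kernel ℝ ℝ) [∀ i, IsMarkovKernel (ρ i)] (F : Finset ι)
    {K : ℝ≥0∞}
    (hK : ∀ i, ∫⁻ ε, ∫⁻ u, ENNReal.ofReal (u ^ 2) ∂(ρ i ε) ∂(gaussianReal 0 1) ≤ K) :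
    ∫⁻ ε, ∑' i : {i // i ∉ F}, ENNReal.ofReal (w i) * ∫⁻ u, ENNReal.ofReal (u ^ 2) ∂(ρ i (ε i))
      ∂(stdGaussian ι) ≤ ∑' i : {i // i ∉ F}, ENNReal.ofReal (w i) * K := by
  have h : ∀ i : ι, Measurable fun ε : ℝ => ∫⁻ u, ENNReal.ofReal (u ^ 2) ∂(ρ i ε) := fun i =>
    Measurable.lintegral_kernel (by fun_prop)
  have h' : ∀ i : ι, Measurable fun ε : ι → ℝ => ∫⁻ u, ENNReal.ofReal (u ^ 2) ∂(ρ i (ε i)) :=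
    fun i => (h i).comp (measurable_pi_apply i)
  rw [lintegral_tsum fun i : {i // i ∉ F} => ((h' i).const_mul _).aemeasurable]
  refine ENNReal.tsum_le_tsum fun i => ?_
  rw [lintegral_const_mul' _ _ ENNReal.ofReal_ne_top]
  exact mul_le_mul' le_rfl ((lintegral_infinitePi_eval (fun _ : ι => gaussianReal 0 1) (i : ι)
    (h i)).trans_le (hK i))

/-- The mean of the kernels vanishes in the weighted norm. -/
theorem AsympGaussian.negligible_mean (hρ : AsympGaussian ρ) (hw : ∀ i, 0 ≤ w i)
    (hws : ∑' i, ENNReal.ofReal (w i) ≠ ∞) :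
    Negligible (stdGaussian ι) fun n ε => wnorm w (kernelMean (ρ n) ε) := by
  classical
  refine Negligible.of_sq (negligible_of_approx fun κ hκ => ?_)
  obtain ⟨K, hKt, hK⟩ := hρ.moment
  obtain ⟨F, hF⟩ := exists_finset_tsum_le hws hKt hκ
  -- On `F` the finitely many means tend to zero for every noise. Off `F` squared means are at most
  -- second moments, whose weighted sum has small expectation by the choice of `F`.
  refine ⟨fun n ε => ∑ i ∈ F, ENNReal.ofReal (w i * kernelMean (ρ n) ε i ^ 2),
    fun n ε => ∑' i : {i // i ∉ F}, ENNReal.ofReal (w i) *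
      ∫⁻ u, ENNReal.ofReal (u ^ 2) ∂(ρ n i (ε i)),
    negligible_of_tendsto (fun n => ?_) fun ε => ?_,
    fun n => measurable_tail_moment (ρ n) F, ?_, Eventually.of_forall fun n ε => ?_⟩
  · refine Finset.measurable_sum _ fun i _ => ?_
    have : Measurable fun ε => kernelMean (ρ n) ε i :=
      (measurable_pi_apply i).comp (measurable_kernelMean (ρ n))
    fun_prop
  · have h0 : (0 : ℝ≥0∞) = ∑ i ∈ F, ENNReal.ofReal (w i * 0 ^ 2) := by simp
    rw [h0]
    refine tendsto_finsetSum _ fun i _ => ENNReal.tendsto_ofReal ?_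
    have h := ((hρ.mean i (ε i)).pow 2).const_mul (w i)
    exact h
  · filter_upwards [hK] with n hn
    exact (lintegral_tail_moment_le (ρ n) F hn).trans hF
  · rw [wnorm_sq, ← ENNReal.sum_add_tsum_compl F]
    refine add_le_add le_rfl (ENNReal.tsum_le_tsum fun i => ?_)
    rw [ENNReal.ofReal_mul (hw i)]
    exact mul_le_mul' le_rfl (mean_sq_le_moment _)

end GaussianLimit

/-! ### Convergence of the probabilities of balls -/

section Balls

variable {ι : Type*} [Countable ι] {w : ι → ℝ} {ρ : ℕ → ι → Kernel ℝ ℝ}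
  [∀ n i, IsMarkovKernel (ρ n i)]

/-- The mass that the standard Gaussian law gives to a ball centred at zero. -/
def gaussBall (w : ι → ℝ) (r : ℝ) : ℝ≥0∞ := stdGaussian ι {z | wnorm w z ≤ ENNReal.ofReal r}

/-- The mass that the product kernel gives to a ball centred at its mean. -/
def kernelBall (w : ι → ℝ) (ρ : ι → Kernel ℝ ℝ) [∀ i, IsMarkovKernel (ρ i)] (ε : ι → ℝ) (r : ℝ) :
    ℝ≥0∞ := prodKernel ρ ε {u | wnorm w (u - kernelMean ρ ε) ≤ ENNReal.ofReal r}

theorem infinitePi_wnorm_eq_null (μ : ι → Measure ℝ) [∀ i, IsProbabilityMeasure (μ i)]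
    {j : ι} (hj : 0 < w j) [NullSingletonClass (μ j)] (v : ι → ℝ) {c : ℝ≥0∞} (hc : c ≠ ∞) :
    Measure.infinitePi μ {z | wnorm w (z - v) = c} = 0 := by
  simp_rw [wnorm_eq_iff]
  exact infinitePi_sum_sq_eq_null μ j w v hj (c ^ 2) (by finiteness)

theorem infinitePi_wnorm_ne_top (μ : ι → Measure ℝ) [∀ i, IsProbabilityMeasure (μ i)]
    (hw : ∀ i, 0 ≤ w i)
    (h : ∑' i, ENNReal.ofReal (w i) * ∫⁻ u, ENNReal.ofReal (u ^ 2) ∂(μ i) ≠ ∞) :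
    ∀ᵐ z ∂(Measure.infinitePi μ), wnorm w z ≠ ∞ := by
  simp_rw [wnorm_ne_top_iff]
  have e : ∀ i : ι, ∫⁻ z : ι → ℝ, ENNReal.ofReal (w i * z i ^ 2) ∂(Measure.infinitePi μ) =
      ENNReal.ofReal (w i) * ∫⁻ u, ENNReal.ofReal (u ^ 2) ∂(μ i) := by
    intro i
    simp_rw [fun z : ι → ℝ => ENNReal.ofReal_mul (q := z i ^ 2) (hw i)]
    rw [lintegral_const_mul' _ _ ENNReal.ofReal_ne_top,
      lintegral_infinitePi_eval μ i (f := fun u => ENNReal.ofReal (u ^ 2)) (by fun_prop)]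
  have h2 : ∫⁻ z : ι → ℝ, ∑' i, ENNReal.ofReal (w i * z i ^ 2) ∂(Measure.infinitePi μ) ≠ ∞ := by
    have hm : ∀ i, Measurable fun z : ι → ℝ => ENNReal.ofReal (w i * z i ^ 2) := fun i => by
      fun_prop
    rw [lintegral_tsum fun i => (hm i).aemeasurable]
    simp_rw [e]
    exact h
  filter_upwards [ae_lt_top (by fun_prop) h2] with z hz using hz.ne

theorem stdGaussian_wnorm_ne_top (hw : ∀ i, 0 ≤ w i) (hws : ∑' i, ENNReal.ofReal (w i) ≠ ∞) :
    ∀ᵐ z ∂(stdGaussian ι), wnorm w z ≠ ∞ := by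
  refine infinitePi_wnorm_ne_top _ hw ?_
  rw [ENNReal.tsum_mul_right]
  exact ENNReal.mul_ne_top hws lintegral_gaussianReal_sq_ne_top

instance : NullSingletonClass (gaussianReal 0 1) := nullSingletonClass_gaussianReal one_ne_zero

theorem stdGaussian_wnorm_eq_null {j : ι} (hj : 0 < w j) (c : ℝ≥0∞) (hc : c ≠ ∞) :
    stdGaussian ι {z | wnorm w z = c} = 0 := by
  simpa using infinitePi_wnorm_eq_null (fun _ : ι => gaussianReal 0 1) hj 0 hc

theorem continuous_gaussBall {j : ι} (hj : 0 < w j) : Continuous (gaussBall w) :=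
  continuous_measure_le (measurable_wnorm w) (stdGaussian_wnorm_eq_null hj)

theorem exists_gaussBall_eq (hw : ∀ i, 0 ≤ w i) (hws : ∑' i, ENNReal.ofReal (w i) ≠ ∞) {j : ι}
    (hj : 0 < w j) {p : ℝ≥0∞} (hp0 : 0 < p) (hp1 : p < 1) : ∃ r : ℝ, 0 < r ∧ gaussBall w r = p :=
  exists_measure_le_eq (measurable_wnorm w) (stdGaussian_wnorm_eq_null hj)
    (stdGaussian_wnorm_ne_top hw hws) hp0 hp1

theorem gaussBall_mono {ι : Type*} (w : ι → ℝ) : Monotone (gaussBall w) := fun _ _ h =>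
  measure_mono fun _ hz => le_trans hz (ENNReal.ofReal_le_ofReal h)

theorem AsympGaussian.tendsto_cutoff {ι : Type*} {w : ι → ℝ} {ρ : ℕ → ι → Kernel ℝ ℝ}
    [∀ n i, IsMarkovKernel (ρ n i)] [DecidableEq ι] (hρ : AsympGaussian ρ) (F : Finset ι)
    (c : ℝ≥0∞) (ε : ι → ℝ) :
    Tendsto (fun n => prodKernel (ρ n) ε {u | wnorm w (cutoff F u) ≤ c}) atTop
      (𝓝 (stdGaussian ι {u | wnorm w (cutoff F u) ≤ c})) := by
  simp_rw [wnorm_cutoff_le_preimage]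
  exact hρ.cylinder ε F _ (measurableSet_le (by fun_prop) measurable_const)

theorem tendsto_tsub_zero {u : ℕ → ℝ≥0∞} {a : ℝ≥0∞} (ha : a ≠ ∞) (h : Tendsto u atTop (𝓝 a)) :
    Tendsto (fun n => u n - a) atTop (𝓝 0) ∧ Tendsto (fun n => a - u n) atTop (𝓝 0) := by
  have h1 := ENNReal.Tendsto.sub h (tendsto_const_nhds (x := a)) (Or.inr ha)
  have h2 := ENNReal.Tendsto.sub (tendsto_const_nhds (x := a)) h (Or.inl ha)
  simp only [tsub_self] at h1 h2
  exact ⟨h1, h2⟩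

theorem measurable_cutoff_ball [DecidableEq ι] (w : ι → ℝ) (F : Finset ι) (c : ℝ≥0∞) :
    MeasurableSet {u : ι → ℝ | wnorm w (cutoff F u) ≤ c} := by
  have h : Measurable fun u : ι → ℝ => wnorm w (cutoff F u) :=
    (measurable_wnorm w).comp (measurable_cutoff F)
  exact measurableSet_le h measurable_const

theorem AsympGaussian.negligible_cutoff [DecidableEq ι] (hρ : AsympGaussian ρ) (F : Finset ι)
    (c : ℝ≥0∞) :
    (Negligible (stdGaussian ι) fun n ε => prodKernel (ρ n) ε {u | wnorm w (cutoff F u) ≤ c} -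
      stdGaussian ι {u | wnorm w (cutoff F u) ≤ c}) ∧
    Negligible (stdGaussian ι) fun n ε => stdGaussian ι {u | wnorm w (cutoff F u) ≤ c} -
      prodKernel (ρ n) ε {u | wnorm w (cutoff F u) ≤ c} := by
  have hm : ∀ n, Measurable fun ε => prodKernel (ρ n) ε {u | wnorm w (cutoff F u) ≤ c} := fun n =>
    Kernel.measurable_coe _ (measurable_cutoff_ball w F c)
  exact ⟨negligible_of_tendsto (fun n => (hm n).sub_const _) fun ε =>
    (tendsto_tsub_zero (measure_ne_top _ _) (hρ.tendsto_cutoff F c ε)).1,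
    negligible_of_tendsto (fun n => (hm n).const_sub _) fun ε =>
    (tendsto_tsub_zero (measure_ne_top _ _) (hρ.tendsto_cutoff F c ε)).2⟩

/-- The mass of a ball is asymptotically at most its Gaussian mass. -/
theorem AsympGaussian.negligible_kernelBall_sub (hρ : AsympGaussian ρ) (hw : ∀ i, 0 ≤ w i)
    (hws : ∑' i, ENNReal.ofReal (w i) ≠ ∞) {j : ι} (hj : 0 < w j) {r : ℝ} (hr : 0 < r) :
    Negligible (stdGaussian ι) fun n ε => kernelBall w (ρ n) ε r - gaussBall w r := by
  classical
  refine negligible_of_approx fun κ hκ => ?_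
  wlog hκt : κ ≠ ∞ generalizing κ with H
  · obtain ⟨Y, Z, h⟩ := H 1 one_pos ENNReal.one_ne_top
    exact ⟨Y, Z, h.1, h.2.1, h.2.2.1.mono fun n hn => hn.trans (by push Not at hκt; simp [hκt]),
      h.2.2.2⟩
  have hκ2 : 0 < κ / 2 := ENNReal.half_pos hκ.ne'
  -- One `e` pays for moving the centre from the mean to the origin, the other for the Gaussian tail
  -- off `F`. Continuity of `gaussBall` makes the enlargement cheap.
  obtain ⟨e, he0, he⟩ : ∃ e : ℝ, 0 < e ∧ gaussBall w (r + 2 * e) ≤ gaussBall w r + κ / 2 := by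
    have hc : Tendsto (fun e : ℝ => gaussBall w (r + 2 * e)) (𝓝[>] 0) (𝓝 (gaussBall w r)) := by
      have := ((continuous_gaussBall hj).comp (show Continuous fun e : ℝ => r + 2 * e by
        fun_prop)).tendsto 0
      simp only [Function.comp_def, mul_zero, add_zero] at this
      exact this.mono_left nhdsWithin_le_nhds
    have h := (hc.eventually (gt_mem_nhds (ENNReal.lt_add_right (measure_ne_top _ _)
      hκ2.ne'))).and self_mem_nhdsWithin
    obtain ⟨e, h1, h2⟩ := h.exists
    exact ⟨e, h2, h1.le⟩
  set e' := ENNReal.ofReal e with he'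
  have he'0 : e' ≠ 0 := by simpa [he'] using he0
  have he't : e' ≠ ∞ := ENNReal.ofReal_ne_top
  obtain ⟨F, hF⟩ := exists_finset_tsum_le hws lintegral_gaussianReal_sq_ne_top
    (κ := e' ^ 2 * (κ / 2)) (ENNReal.mul_pos (by positivity) hκ2.ne')
  have htail : stdGaussian ι {z | e' ≤ wnorm w (tailPart F z)} ≤ κ / 2 := by
    refine (measure_le_wnorm_tailPart (fun _ : ι => gaussianReal 0 1) hw F he'0 he't).trans ?_
    rw [mul_comm, ← div_eq_mul_inv]
    exact ENNReal.div_le_of_le_mul (by rwa [mul_comm])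
  have hcut : stdGaussian ι {z | wnorm w (cutoff F z) ≤ ENNReal.ofReal (r + e)} ≤
      gaussBall w r + κ := by
    calc _ ≤ stdGaussian ι ({z | wnorm w z ≤ ENNReal.ofReal (r + 2 * e)} ∪
          {z | e' ≤ wnorm w (tailPart F z)}) := by
          refine measure_mono fun z hz => ?_
          by_contra hcon
          simp only [mem_union, mem_ofPred_eq, not_or, not_le] at hcon hz
          have h := (wnorm_le_cutoff_add_tailPart hw F z).trans (add_le_add hz hcon.2.le)
          rw [← ENNReal.ofReal_add (by positivity) he0.le] at h
          exact absurd h (not_le.2 (by convert hcon.1 using 2; ring))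
      _ ≤ gaussBall w (r + 2 * e) + κ / 2 := (measure_union_le _ _).trans (add_le_add le_rfl htail)
      _ ≤ gaussBall w r + κ / 2 + κ / 2 := by gcongr
      _ = gaussBall w r + κ := by rw [add_assoc, ENNReal.add_halves]
  refine ⟨_, fun _ _ => κ,
    (hρ.negligible_cutoff (w := w) F (ENNReal.ofReal (r + e))).1.add
      ((hρ.negligible_mean hw hws).indicator he'0),
    fun _ => measurable_const, Eventually.of_forall fun n => by simp,
    Eventually.of_forall fun n ε => ?_⟩
  -- When the mean is not small, the indicator term equals `1` and dominates any probability.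
  by_cases hm : e' ≤ wnorm w (kernelMean (ρ n) ε)
  · rw [indicator_of_mem (show ε ∈ {ε | e' ≤ wnorm w (kernelMean (ρ n) ε)} from hm)]
    exact (tsub_le_self.trans prob_le_one).trans (le_add_right le_add_self)
  · rw [indicator_of_notMem (show ε ∉ {ε | e' ≤ wnorm w (kernelMean (ρ n) ε)} from hm), add_zero,
      tsub_le_iff_right, add_assoc, add_comm κ]
    refine le_trans (measure_mono fun u hu => ?_)
      (le_tsub_add.trans (add_le_add le_rfl hcut))
    refine (wnorm_cutoff_le hw F u).trans ((wnorm_le_add_sub hw u (kernelMean (ρ n) ε)).trans ?_)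
    rw [add_comm r, ENNReal.ofReal_add he0.le hr.le]
    exact add_le_add (not_le.1 hm).le hu

/-- The mass of a ball is asymptotically at least its Gaussian mass. -/
theorem AsympGaussian.negligible_sub_kernelBall (hρ : AsympGaussian ρ) (hw : ∀ i, 0 ≤ w i)
    (hws : ∑' i, ENNReal.ofReal (w i) ≠ ∞) {j : ι} (hj : 0 < w j) {r : ℝ} (hr : 0 < r) :
    Negligible (stdGaussian ι) fun n ε => gaussBall w r - kernelBall w (ρ n) ε r := by
  classical
  refine negligible_of_approx fun κ hκ => ?_
  have hκ2 : 0 < κ / 2 := ENNReal.half_pos hκ.ne'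
  -- Again one `e` is for the mean and one for the tail. The tail is now taken under the kernel, so
  -- it is controlled in expectation over the noise, through `moment`.
  obtain ⟨e, he0, her, he⟩ : ∃ e : ℝ, 0 < e ∧ 0 ≤ r - 2 * e ∧
      gaussBall w r ≤ gaussBall w (r - 2 * e) + κ / 2 := by
    have hc : Tendsto (fun e : ℝ => gaussBall w (r - 2 * e) + κ / 2) (𝓝[>] 0)
        (𝓝 (gaussBall w r + κ / 2)) := by
      have := ((continuous_gaussBall hj).comp (show Continuous fun e : ℝ => r - 2 * e by
        fun_prop)).tendsto 0
      simp only [Function.comp_def, mul_zero, sub_zero] at this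
      exact (this.mono_left nhdsWithin_le_nhds).add_const _
    have h := (hc.eventually (lt_mem_nhds (ENNReal.lt_add_right (measure_ne_top _ _)
      hκ2.ne'))).and (Ioo_mem_nhdsGT (show 0 < r / 2 by positivity))
    obtain ⟨e, h1, h2⟩ := h.exists
    exact ⟨e, h2.1, by linarith [h2.2], h1.le⟩
  set e' := ENNReal.ofReal e with he'
  have he'0 : e' ≠ 0 := by simpa [he'] using he0
  have he't : e' ≠ ∞ := ENNReal.ofReal_ne_top
  obtain ⟨K, hKt, hK⟩ := hρ.moment
  obtain ⟨F, hF⟩ := exists_finset_tsum_le hws hKt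
    (κ := e' ^ 2 * (κ / 2)) (ENNReal.mul_pos (by positivity) hκ2.ne')
  refine ⟨_, fun n ε => κ / 2 + (e' ^ 2)⁻¹ * ∑' i : {i // i ∉ F}, ENNReal.ofReal (w i) *
      ∫⁻ u, ENNReal.ofReal (u ^ 2) ∂(ρ n i (ε i)),
    (hρ.negligible_cutoff (w := w) F (ENNReal.ofReal (r - 2 * e))).2.add
      ((hρ.negligible_mean hw hws).indicator he'0),
    fun n => ((measurable_tail_moment (ρ n) F).const_mul _).const_add _, ?_,
    Eventually.of_forall fun n ε => ?_⟩
  · filter_upwards [hK] with n hn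
    rw [lintegral_add_left measurable_const, lintegral_const_mul _ (measurable_tail_moment (ρ n) F),
      lintegral_const, measure_univ, mul_one]
    calc _ ≤ κ / 2 + κ / 2 := by
          refine add_le_add le_rfl ?_
          rw [mul_comm, ← div_eq_mul_inv]
          refine ENNReal.div_le_of_le_mul ?_
          rw [mul_comm]
          exact (lintegral_tail_moment_le (ρ n) F hn).trans hF
      _ = κ := ENNReal.add_halves κ
  · by_cases hm : e' ≤ wnorm w (kernelMean (ρ n) ε)
    · rw [indicator_of_mem (show ε ∈ {ε | e' ≤ wnorm w (kernelMean (ρ n) ε)} from hm)]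
      exact (tsub_le_self.trans prob_le_one).trans (le_add_right le_add_self)
    · rw [indicator_of_notMem (show ε ∉ {ε | e' ≤ wnorm w (kernelMean (ρ n) ε)} from hm), add_zero,
        tsub_le_iff_right]
      have h1 : gaussBall w (r - 2 * e) ≤
          stdGaussian ι {u | wnorm w (cutoff F u) ≤ ENNReal.ofReal (r - 2 * e)} :=
        measure_mono fun u hu => (wnorm_cutoff_le hw F u).trans hu
      have h2 : prodKernel (ρ n) ε {u | wnorm w (cutoff F u) ≤ ENNReal.ofReal (r - 2 * e)} ≤
          kernelBall w (ρ n) ε r + prodKernel (ρ n) ε {u | e' ≤ wnorm w (tailPart F u)} := by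
        refine le_trans (measure_mono fun u hu => ?_) (measure_union_le _ _)
        by_contra hcon
        simp only [mem_union, mem_ofPred_eq, not_or, not_le] at hcon hu
        refine absurd ?_ (not_le.2 hcon.1)
        calc wnorm w (u - kernelMean (ρ n) ε) ≤ wnorm w u + wnorm w (kernelMean (ρ n) ε) :=
              wnorm_sub_le hw _ _
          _ ≤ ENNReal.ofReal (r - 2 * e) + e' + e' :=
              add_le_add ((wnorm_le_cutoff_add_tailPart hw F u).trans (add_le_add hu hcon.2.le))
                (not_le.1 hm).le
          _ = ENNReal.ofReal r := by
              rw [← ENNReal.ofReal_add her he0.le, ← ENNReal.ofReal_add (by positivity) he0.le]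
              congr 1; ring
      have h3 := measure_le_wnorm_tailPart (fun i => ρ n i (ε i)) hw F he'0 he't
      calc gaussBall w r ≤ gaussBall w (r - 2 * e) + κ / 2 := he
        _ ≤ stdGaussian ι {u | wnorm w (cutoff F u) ≤ ENNReal.ofReal (r - 2 * e)} + κ / 2 := by
            gcongr
        _ ≤ stdGaussian ι {u | wnorm w (cutoff F u) ≤ ENNReal.ofReal (r - 2 * e)} -
              prodKernel (ρ n) ε {u | wnorm w (cutoff F u) ≤ ENNReal.ofReal (r - 2 * e)} +
              (kernelBall w (ρ n) ε r + (e' ^ 2)⁻¹ * ∑' i : {i // i ∉ F}, ENNReal.ofReal (w i) *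
                ∫⁻ u, ENNReal.ofReal (u ^ 2) ∂(ρ n i (ε i))) + κ / 2 := by
            gcongr
            exact le_tsub_add.trans (add_le_add le_rfl (h2.trans (add_le_add le_rfl h3)))
        _ = _ := by ring

end Balls

/-! ### Quantiles and coverage -/

section Coverage

variable {ι : Type*} [Countable ι] {w : ι → ℝ} {ρ : ℕ → ι → Kernel ℝ ℝ}
  [∀ n i, IsMarkovKernel (ρ n i)]

theorem kernelBall_mono {ι : Type*} (w : ι → ℝ) (ρ : ι → Kernel ℝ ℝ) [∀ i, IsMarkovKernel (ρ i)]
    (ε : ι → ℝ) : Monotone (kernelBall w ρ ε) := fun _ _ h =>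
  measure_mono fun _ hz => le_trans hz (ENNReal.ofReal_le_ofReal h)

theorem tendsto_measure_zero_of_ae_imp {Ω : Type*} [MeasurableSpace Ω] {P : Measure Ω}
    {s t : ℕ → Set Ω} (ht : Tendsto (fun n => P (t n)) atTop (𝓝 0))
    (h : ∀ᶠ n in atTop, ∀ᵐ ω ∂P, ω ∈ s n → ω ∈ t n) :
    Tendsto (fun n => P (s n)) atTop (𝓝 0) :=
  tendsto_of_tendsto_of_tendsto_of_le_of_le' tendsto_const_nhds ht
    (Eventually.of_forall fun _ => bot_le) (h.mono fun _ hn => measure_mono_ae hn)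

variable {p : ℝ≥0∞} {R : ℕ → (ι → ℝ) → ℝ}

/-- If the radius is below `r`, the ball of radius `r` has mass at least `p`, exceeding its Gaussian
mass by a fixed amount; this has vanishing probability. The argument asks no measurability of `R`.
-/
theorem AsympGaussian.tendsto_radius_lt (hρ : AsympGaussian ρ) (hw : ∀ i, 0 ≤ w i)
    (hws : ∑' i, ENNReal.ofReal (w i) ≠ ∞) {j : ι} (hj : 0 < w j)
    (hR : ∀ᶠ n in atTop, ∀ᵐ ε ∂(stdGaussian ι), kernelBall w (ρ n) ε (R n ε) = p)
    {r : ℝ} (hr : 0 < r) (hrp : gaussBall w r < p) :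
    Tendsto (fun n => stdGaussian ι {ε | R n ε < r}) atTop (𝓝 0) := by
  refine tendsto_measure_zero_of_ae_imp
    (hρ.negligible_kernelBall_sub hw hws hj hr (p - gaussBall w r) (tsub_pos_of_lt hrp).ne')
    (hR.mono fun n hn => ?_)
  filter_upwards [hn] with ε h1 h2
  exact tsub_le_tsub_right (h1.symm.trans_le (kernelBall_mono w (ρ n) ε (le_of_lt h2))) _

theorem AsympGaussian.tendsto_lt_radius (hρ : AsympGaussian ρ) (hw : ∀ i, 0 ≤ w i)
    (hws : ∑' i, ENNReal.ofReal (w i) ≠ ∞) {j : ι} (hj : 0 < w j)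
    (hR : ∀ᶠ n in atTop, ∀ᵐ ε ∂(stdGaussian ι), kernelBall w (ρ n) ε (R n ε) = p)
    {r : ℝ} (hr : 0 < r) (hrp : p < gaussBall w r) :
    Tendsto (fun n => stdGaussian ι {ε | r < R n ε}) atTop (𝓝 0) := by
  refine tendsto_measure_zero_of_ae_imp
    (hρ.negligible_sub_kernelBall hw hws hj hr (gaussBall w r - p) (tsub_pos_of_lt hrp).ne')
    (hR.mono fun n hn => ?_)
  filter_upwards [hn] with ε h1 h2
  exact tsub_le_tsub_left ((kernelBall_mono w (ρ n) ε (le_of_lt h2)).trans_eq h1) _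

/-- The balls centred at the mean that have mass `p` cover the origin with probability tending
to `p`. -/
theorem AsympGaussian.tendsto_coverage (hρ : AsympGaussian ρ) (hw : ∀ i, 0 ≤ w i)
    (hws : ∑' i, ENNReal.ofReal (w i) ≠ ∞) {j : ι} (hj : 0 < w j) (hp1 : p < 1)
    (hR : ∀ᶠ n in atTop, ∀ᵐ ε ∂(stdGaussian ι), kernelBall w (ρ n) ε (R n ε) = p) :
    Tendsto (fun n => stdGaussian ι {ε | wnorm w (ε + kernelMean (ρ n) ε) ≤
      ENNReal.ofReal (R n ε)}) atTop (𝓝 p) := by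
  have hmean := hρ.negligible_mean hw hws
  refine tendsto_order.2 ⟨fun a ha => ?_, fun a ha => ?_⟩
  -- Two levels below `p`: `r₁` is a lower bound for the radii with probability tending to one, and
  -- the gap `r₁ - r₀` absorbs the mean.
  · obtain ⟨p₁, hp₁, hp₁p⟩ := exists_between ha
    obtain ⟨p₀, hp₀, hp₀₁⟩ := exists_between hp₁
    obtain ⟨r₁, hr₁, e₁⟩ := exists_gaussBall_eq hw hws hj (bot_le.trans_lt hp₁) (hp₁p.trans hp1)
    obtain ⟨r₀, hr₀, e₀⟩ := exists_gaussBall_eq hw hws hj (bot_le.trans_lt hp₀)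
      (hp₀₁.trans (hp₁p.trans hp1))
    have hr : r₀ < r₁ := (gaussBall_mono w).reflect_lt (by rwa [e₀, e₁])
    have hd : ENNReal.ofReal (r₁ - r₀) ≠ 0 := by simpa using hr
    have hs := (hmean _ hd).add
      (hρ.tendsto_radius_lt hw hws hj hR hr₁ (e₁.trans_lt hp₁p))
    rw [add_zero] at hs
    have h : ∀ n, p₀ ≤ stdGaussian ι {ε | wnorm w (ε + kernelMean (ρ n) ε) ≤
        ENNReal.ofReal (R n ε)} + (stdGaussian ι {ε | ENNReal.ofReal (r₁ - r₀) ≤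
          wnorm w (kernelMean (ρ n) ε)} + stdGaussian ι {ε | R n ε < r₁}) := by
      intro n
      rw [← e₀]
      refine le_trans (measure_mono fun ε hε => ?_) ((measure_union_le _ _).trans
        (add_le_add le_rfl (measure_union_le _ _)))
      by_contra hcon
      simp only [mem_union, mem_ofPred_eq, not_or, not_le, not_lt] at hcon hε
      refine absurd ?_ (not_le.2 hcon.1)
      calc wnorm w (ε + kernelMean (ρ n) ε) ≤ wnorm w ε + wnorm w (kernelMean (ρ n) ε) :=
            wnorm_add_le hw _ _
        _ ≤ ENNReal.ofReal r₀ + ENNReal.ofReal (r₁ - r₀) := add_le_add hε hcon.2.1.le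
        _ = ENNReal.ofReal r₁ := by
            rw [← ENNReal.ofReal_add hr₀.le (sub_pos.2 hr).le]; congr 1; ring
        _ ≤ ENNReal.ofReal (R n ε) := ENNReal.ofReal_le_ofReal hcon.2.2
    have hp0t : p₀ ≠ ∞ := (hp₀₁.trans (hp₁p.trans hp1)).ne_top
    have hlim := ENNReal.Tendsto.sub (tendsto_const_nhds (x := p₀)) hs (Or.inl hp0t)
    rw [tsub_zero] at hlim
    filter_upwards [hlim.eventually (lt_mem_nhds hp₀)] with n hn
    exact hn.trans_le (tsub_le_iff_right.2 (h n))
  -- Two levels above `p`: `r₁` bounds the radii from above and the gap `r₂ - r₁` absorbs the mean.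
  -- The minimum with `1` keeps both levels attainable as masses of Gaussian balls.
  · obtain ⟨p₁, hp₁, hp₁p⟩ := exists_between (lt_min ha hp1)
    obtain ⟨p₂, hp₂, hp₂₁⟩ := exists_between hp₁p
    obtain ⟨ha₂, h1₂⟩ := lt_min_iff.1 hp₂₁
    obtain ⟨r₁, hr₁, e₁⟩ := exists_gaussBall_eq hw hws hj (bot_le.trans_lt hp₁) (hp₂.trans h1₂)
    obtain ⟨r₂, hr₂, e₂⟩ := exists_gaussBall_eq hw hws hj (bot_le.trans_lt hp₂) h1₂
    have hr : r₁ < r₂ := (gaussBall_mono w).reflect_lt (by rwa [e₁, e₂])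
    have hd : ENNReal.ofReal (r₂ - r₁) ≠ 0 := by simpa using hr
    have hs := (hmean _ hd).add
      (hρ.tendsto_lt_radius hw hws hj hR hr₁ (hp₁.trans_eq e₁.symm))
    rw [add_zero] at hs
    have h : ∀ n, stdGaussian ι {ε | wnorm w (ε + kernelMean (ρ n) ε) ≤
        ENNReal.ofReal (R n ε)} ≤ p₂ + (stdGaussian ι {ε | ENNReal.ofReal (r₂ - r₁) ≤
          wnorm w (kernelMean (ρ n) ε)} + stdGaussian ι {ε | r₁ < R n ε}) := by
      intro n
      rw [← e₂]
      refine le_trans (measure_mono fun ε hε => ?_) ((measure_union_le _ _).trans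
        (add_le_add le_rfl (measure_union_le _ _)))
      by_contra hcon
      simp only [mem_union, mem_ofPred_eq, not_or, not_le, not_lt] at hcon hε
      refine absurd ?_ (not_le.2 hcon.1)
      calc wnorm w ε = wnorm w (ε + kernelMean (ρ n) ε - kernelMean (ρ n) ε) := by
            rw [add_sub_cancel_right]
        _ ≤ wnorm w (ε + kernelMean (ρ n) ε) + wnorm w (kernelMean (ρ n) ε) :=
            wnorm_sub_le hw _ _
        _ ≤ ENNReal.ofReal r₁ + ENNReal.ofReal (r₂ - r₁) :=
            add_le_add (hε.trans (ENNReal.ofReal_le_ofReal hcon.2.2)) hcon.2.1.le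
        _ = ENNReal.ofReal r₂ := by
            rw [← ENNReal.ofReal_add hr₁.le (sub_pos.2 hr).le]; congr 1; ring
    have hlim := (tendsto_const_nhds (x := p₂)).add hs
    rw [add_zero] at hlim
    filter_upwards [hlim.eventually (gt_mem_nhds ha₂)] with n hn
    exact (h n).trans_lt hn

end Coverage

/-! ### The local posterior kernels -/

section LocalKernel

variable (ν : Measure ℝ) [IsProbabilityMeasure ν]

/-- The laws `coordLaw ν t g₀ ε` as a kernel in the noise `ε`. -/
def coordKernel (t g₀ : ℝ) : Kernel ℝ ℝ where
  toFun ε := coordLaw ν t g₀ ε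
  measurable' := by
    refine Measure.measurable_of_measurable_coe _ fun s hs => ?_
    have h1 : Measurable fun p : ℝ × ℝ => t * (p.2 - g₀) - p.1 := by fun_prop
    have h2 : Measurable fun ε : ℝ => t * g₀ + ε := by fun_prop
    have e : (fun ε => coordLaw ν t g₀ ε s) = fun ε => ((tilt ν t).comap _ h2) ε
        (Prod.mk ε ⁻¹' ((fun p : ℝ × ℝ => t * (p.2 - g₀) - p.1) ⁻¹' s)) := by
      ext ε
      rw [coordLaw, Measure.map_apply (by fun_prop) hs, Kernel.comap_apply]
      rfl
    rw [e]
    exact Kernel.measurable_kernel_prodMk_left (h1 hs)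

instance (t g₀ : ℝ) : IsMarkovKernel (coordKernel ν t g₀) :=
  ⟨fun ε => inferInstanceAs (IsProbabilityMeasure (coordLaw ν t g₀ ε))⟩

variable {ν}

/-- The ratios `t n i` tend to infinity for each fixed `i`, not uniformly, which suffices for
cylinders and means. Uniformity in `i` is needed for the moments alone, where `2 t ^ 2 * min 1 (t ^
(-2)) ≤ 2`. -/
theorem asympGaussian_coordKernel {ι : Type*} {φ : ℝ → ℝ} (hφ : Measurable φ)
    (hν : ν = volume.withDensity fun x => ENNReal.ofReal (φ x)) {C : ℝ} (hC : ∀ x, φ x ≤ C)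
    (hpos : ∀ x, 0 < φ x) {t : ℕ → ι → ℝ} (ht : ∀ i, Tendsto (fun n => t n i) atTop atTop)
    (ht0 : ∀ᶠ n in atTop, ∀ i, 0 < t n i) {g₀ : ι → ℝ} (hcont : ∀ i, ContinuousAt φ (g₀ i))
    {K : ℝ≥0∞} (hK : K ≠ ∞)
    (hrisk : ∀ᶠ n in atTop, ∀ i, tiltRisk ν (t n i) (g₀ i) ≤
      K * ENNReal.ofReal (min 1 ((t n i)⁻¹ ^ 2))) :
    AsympGaussian fun n i => coordKernel ν (t n i) (g₀ i) where
  cylinder ε F A hA := by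
    refine tendsto_infinitePi_cylinder (fun n i => coordLaw ν (t n i) (g₀ i) (ε i)) F
      (fun n i => coordDensity φ (t n i) (g₀ i) (ε i)) (fun n i => measurable_coordDensity hφ _ _ _)
      (ht0.mono fun n hn i => coordLaw_eq hφ hν (hn i) _ _)
      (fun i u => tendsto_coordDensity hφ hC (ht i) (hcont i) (hpos _) _ _)
      (fun i => eventually_coordDensity_le hφ hC (ht i) (hcont i) (hpos _) _) hA
  mean i ε := tendsto_coordMean hφ hν hC (ht i) (hcont i) (hpos _) ε
  moment := by
    refine ⟨2 * K + 2 * ∫⁻ ε, ENNReal.ofReal (ε ^ 2) ∂(gaussianReal 0 1), ?_, ?_⟩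
    · have := lintegral_gaussianReal_sq_ne_top
      finiteness
    · filter_upwards [hrisk, ht0] with n hn hn0 i
      refine (lintegral_coordMoment_le (t n i) (g₀ i)).trans (add_le_add ?_ le_rfl)
      refine (mul_le_mul' le_rfl (hn i)).trans ?_
      rw [mul_left_comm, ← ENNReal.ofReal_mul (by positivity), mul_comm]
      refine mul_le_mul' ?_ le_rfl
      rw [← ENNReal.ofReal_ofNat]
      refine ENNReal.ofReal_le_ofReal ?_
      calc 2 * t n i ^ 2 * min 1 ((t n i)⁻¹ ^ 2) ≤ 2 * t n i ^ 2 * (t n i)⁻¹ ^ 2 := by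
            gcongr; exact min_le_right _ _
        _ = 2 := by have := (hn0 i).ne'; field_simp

end LocalKernel

/-! ### The posterior in local coordinates -/

section Local

variable {S J₀ m : ℕ}

/-- The weights of the logarithmic Sobolev norm. -/
def sobolevWeight (s δ : ℝ) (i : WaveletIndex J₀ m) : ℝ :=
  charSeq i.1.1 ^ (2 * s) / Real.log (charSeq i.1.1) ^ (2 * δ)

theorem two_le_charSeq (l : ℕ) : 2 ≤ charSeq l := le_max_left _ _

theorem log_charSeq_pos (l : ℕ) : 0 < Real.log (charSeq l) :=
  Real.log_pos (by linarith [two_le_charSeq l])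

theorem charSeq_pos (l : ℕ) : 0 < charSeq l := by linarith [two_le_charSeq l]

theorem sobolevWeight_pos (s δ : ℝ) (i : WaveletIndex J₀ m) : 0 < sobolevWeight s δ i :=
  div_pos (Real.rpow_pos_of_pos (charSeq_pos _) _) (Real.rpow_pos_of_pos (log_charSeq_pos _) _)

variable (B : RegularBasis S J₀ m)

theorem sobolevNorm_eq (s δ : ℝ) (f : L2) :
    sobolevNorm B s δ f = wnorm (sobolevWeight s δ) (coef B f) := rfl

theorem measurable_coef : Measurable (coef B) :=
  measurable_pi_lambda _ fun i => (continuous_coef B i).measurable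

theorem measurable_sobolevNorm (s δ : ℝ) : Measurable (sobolevNorm B s δ) :=
  (measurable_wnorm (sobolevWeight s δ)).comp (measurable_coef B)

/-- The true coefficients in units of the scales of the prior. -/
def rescaled (γ : ℝ) (f₀ : L2) (i : WaveletIndex J₀ m) : ℝ :=
  (2 : ℝ) ^ ((i.1.1 : ℝ) * (γ + 1 / 2)) * coef B f₀ i

theorem scale_mul_rescaled (γ : ℝ) (f₀ : L2) (i : WaveletIndex J₀ m) :
    scale γ i * rescaled B γ f₀ i = coef B f₀ i := by
  rw [scale, rescaled, ← mul_assoc, ← Real.rpow_add (by norm_num)]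
  simp

theorem snr_pos (γ : ℝ) {n : ℕ} (hn : 1 ≤ n) (i : WaveletIndex J₀ m) : 0 < snr γ n i :=
  mul_pos (sqrt_pos_of_one_le hn) (scale_pos γ i)

theorem sqrt_mul_obs (γ : ℝ) {n : ℕ} (hn : 1 ≤ n) (f₀ : L2) (ε : WaveletIndex J₀ m → ℝ)
    (i : WaveletIndex J₀ m) :
    √(n : ℝ) * obs B n f₀ ε i = snr γ n i * rescaled B γ f₀ i + ε i := by
  have hs := sqrt_pos_of_one_le hn
  rw [obs, ← scale_mul_rescaled B γ f₀ i, snr]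
  field_simp

variable (γ : ℝ) (ν : Measure ℝ) [IsProbabilityMeasure ν]

/-- The coordinate kernels of the rescaled and recentred posterior. -/
def localKernel (n : ℕ) (f₀ : L2) (i : WaveletIndex J₀ m) : Kernel ℝ ℝ :=
  coordKernel ν (snr γ n i) (rescaled B γ f₀ i)

instance (n : ℕ) (f₀ : L2) (i : WaveletIndex J₀ m) : IsMarkovKernel (localKernel B γ ν n f₀ i) :=
  inferInstanceAs (IsMarkovKernel (coordKernel _ _ _))

theorem prodKernel_localKernel {n : ℕ} (hn : 1 ≤ n) (f₀ : L2) (ε : WaveletIndex J₀ m → ℝ) :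
    prodKernel (localKernel B γ ν n f₀) ε =
      (seqPost ν (snr γ n) fun i => √(n : ℝ) * obs B n f₀ ε i).map
        fun g i => snr γ n i * (g i - rescaled B γ f₀ i) - ε i := by
  have hs := sqrt_pos_of_one_le hn
  rw [seqPost_apply, prodKernel_apply]
  have h := Measure.infinitePi_map_pi
    (μ := fun i => tilt ν (snr γ n i) (√(n : ℝ) * obs B n f₀ ε i))
    (f := fun i g => snr γ n i * (g - rescaled B γ f₀ i) - ε i) (fun i => by fun_prop)
  rw [h]
  congr 1
  ext1 i
  have e := sqrt_mul_obs B γ hn f₀ ε i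
  rw [e]
  rfl

variable {γ ν} {B} {f₀ : L2} {n : ℕ} {ε : WaveletIndex J₀ m → ℝ}

theorem integrable_post (hpost : post B γ ν n (obs B n f₀ ε) =
        (seqPost ν (snr γ n) fun i => √(n : ℝ) * obs B n f₀ ε i).map (series B γ))
    (hen : ∫⁻ g, energy γ g ∂(seqPost ν (snr γ n) fun i => √(n : ℝ) * obs B n f₀ ε i) < ∞) :
    Integrable (fun f : L2 => f) (post B γ ν n (obs B n f₀ ε)) := by
  have hS := measurable_series B γ
  have hP : IsProbabilityMeasure (post B γ ν n (obs B n f₀ ε)) := by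
    rw [hpost]; exact Measure.isProbabilityMeasure_map hS.aemeasurable
  have h2 : MemLp (fun f : L2 => f) 2 (post B γ ν n (obs B n f₀ ε)) := by
    refine ⟨aestronglyMeasurable_id, ?_⟩
    rw [eLpNorm_lt_top_iff_lintegral_rpow_enorm_lt_top (by norm_num) (by norm_num), hpost,
      lintegral_map (by fun_prop) hS]
    refine lt_of_eq_of_lt (lintegral_congr_ae ?_) hen
    filter_upwards [ae_lt_top (measurable_energy γ) hen.ne] with g hg
    rw [← norm_series_sq (B := B) hg.ne, ENNReal.toReal_ofNat, ENNReal.rpow_two,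
      ENNReal.ofReal_pow (norm_nonneg _), ofReal_norm]
  exact h2.integrable one_le_two

theorem integrable_tilt
    (hen : ∫⁻ g, energy γ g ∂(seqPost ν (snr γ n) fun i => √(n : ℝ) * obs B n f₀ ε i) < ∞)
    (i : WaveletIndex J₀ m) :
    Integrable (fun g : ℝ => g) (tilt ν (snr γ n i) (√(n : ℝ) * obs B n f₀ ε i)) := by
  have h1 : ∫⁻ g, ENNReal.ofReal ((scale γ i * g) ^ 2)
      ∂(tilt ν (snr γ n i) (√(n : ℝ) * obs B n f₀ ε i)) < ∞ := by
    rw [← lintegral_infinitePi_eval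
      (fun i => tilt ν (snr γ n i) (√(n : ℝ) * obs B n f₀ ε i)) i
      (f := fun g => ENNReal.ofReal ((scale γ i * g) ^ 2)) (by fun_prop), ← seqPost_apply]
    exact (lintegral_mono fun g : WaveletIndex J₀ m → ℝ => ENNReal.le_tsum (f := fun i =>
      ENNReal.ofReal ((scale γ i * g i) ^ 2)) i).trans_lt hen
  have h2 : MemLp (fun g : ℝ => scale γ i * g) 2
      (tilt ν (snr γ n i) (√(n : ℝ) * obs B n f₀ ε i)) := by
    rw [memLp_two_iff_integrable_sq (by fun_prop)]
    exact ⟨by fun_prop, (hasFiniteIntegral_iff_ofReal (ae_of_all _ fun _ => sq_nonneg _)).2 h1⟩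
  have h3 := (h2.integrable one_le_two).const_mul (scale γ i)⁻¹
  simpa [← mul_assoc, inv_mul_cancel₀ (scale_pos γ i).ne'] using h3

theorem coef_postMean (hpost : post B γ ν n (obs B n f₀ ε) =
        (seqPost ν (snr γ n) fun i => √(n : ℝ) * obs B n f₀ ε i).map (series B γ))
    (hen : ∫⁻ g, energy γ g ∂(seqPost ν (snr γ n) fun i => √(n : ℝ) * obs B n f₀ ε i) < ∞)
    (i : WaveletIndex J₀ m) :
    coef B (postMean B γ ν n (obs B n f₀ ε)) i =
      scale γ i * ∫ g, g ∂(tilt ν (snr γ n i) (√(n : ℝ) * obs B n f₀ ε i)) := by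
  have hS := measurable_series B γ
  rw [postMean, coef, ← integral_inner (integrable_post hpost hen), hpost,
    integral_map hS.aemeasurable (by fun_prop)]
  have h1 : ∫ g, ⟪B.basis i, series B γ g⟫ ∂(seqPost ν (snr γ n) fun i => √(n : ℝ) *
      obs B n f₀ ε i) = ∫ g, scale γ i * g i ∂(seqPost ν (snr γ n) fun i => √(n : ℝ) *
      obs B n f₀ ε i) := by
    refine integral_congr_ae ?_
    filter_upwards [ae_lt_top (measurable_energy γ) hen.ne] with g hg
    exact coef_series hg.ne i
  rw [h1, integral_const_mul]
  congr 1
  have hmp := measurePreserving_eval_infinitePi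
    (fun i => tilt ν (snr γ n i) (√(n : ℝ) * obs B n f₀ ε i)) i
  rw [seqPost_apply, ← hmp.map_eq, integral_map (measurable_pi_apply i).aemeasurable (by fun_prop)]

/-- The right side is `√n` times the posterior mean minus the observation. That it is negligible in
the weighted norm says that the posterior mean is asymptotically as good as the observation itself.
-/
theorem kernelMean_localKernel (hn : 1 ≤ n)
    (hpost : post B γ ν n (obs B n f₀ ε) =
        (seqPost ν (snr γ n) fun i => √(n : ℝ) * obs B n f₀ ε i).map (series B γ))
    (hen : ∫⁻ g, energy γ g ∂(seqPost ν (snr γ n) fun i => √(n : ℝ) * obs B n f₀ ε i) < ∞)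
    (i : WaveletIndex J₀ m) :
    kernelMean (localKernel B γ ν n f₀) ε i =
      √(n : ℝ) * (coef B (postMean B γ ν n (obs B n f₀ ε)) i - coef B f₀ i) - ε i := by
  have hs := sqrt_pos_of_one_le hn
  have e := sqrt_mul_obs B γ hn f₀ ε i
  have hint := integrable_tilt hen i
  have hint' : Integrable (fun g : ℝ => g - rescaled B γ f₀ i)
    (tilt ν (snr γ n i) (√(n : ℝ) * obs B n f₀ ε i)) := hint.sub (integrable_const _)
  rw [coef_postMean hpost hen, kernelMean]
  change ∫ u, u ∂(coordLaw ν (snr γ n i) (rescaled B γ f₀ i) (ε i)) = _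
  rw [coordLaw, integral_map (by fun_prop) (by fun_prop), ← e,
    integral_sub (hint'.const_mul _) (integrable_const _),
    integral_const_mul, integral_sub hint (integrable_const _), ← scale_mul_rescaled B γ f₀ i, snr]
  simp
  ring

/-- The local form of the truth lying in a credible ball. -/
theorem hNorm_sub_postMean (hn : 1 ≤ n) (δ : ℝ)
    (hpost : post B γ ν n (obs B n f₀ ε) =
        (seqPost ν (snr γ n) fun i => √(n : ℝ) * obs B n f₀ ε i).map (series B γ))
    (hen : ∫⁻ g, energy γ g ∂(seqPost ν (snr γ n) fun i => √(n : ℝ) * obs B n f₀ ε i) < ∞) :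
    hNorm B δ (f₀ - postMean B γ ν n (obs B n f₀ ε)) = ENNReal.ofReal (√(n : ℝ))⁻¹ *
      wnorm (sobolevWeight (-1 / 2) δ) (ε + kernelMean (localKernel B γ ν n f₀) ε) := by
  have hs := sqrt_pos_of_one_le hn
  rw [hNorm, sobolevNorm_eq, ← abs_of_pos (inv_pos.2 hs), ← abs_neg, ← wnorm_const_mul]
  congr 1
  ext i
  rw [coef_sub, Pi.add_apply, kernelMean_localKernel hn hpost hen]
  field_simp
  ring

/-- In the difference from the posterior mean both the truth and the noise cancel. Stated for laws,
the identity yields the masses of balls and also the finiteness of the norm. -/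
theorem map_hNorm_sub_postMean (hn : 1 ≤ n) (δ : ℝ)
    (hpost : post B γ ν n (obs B n f₀ ε) =
        (seqPost ν (snr γ n) fun i => √(n : ℝ) * obs B n f₀ ε i).map (series B γ))
    (hen : ∫⁻ g, energy γ g ∂(seqPost ν (snr γ n) fun i => √(n : ℝ) * obs B n f₀ ε i) < ∞) :
    (post B γ ν n (obs B n f₀ ε)).map
        (fun f => hNorm B δ (f - postMean B γ ν n (obs B n f₀ ε))) =
      (prodKernel (localKernel B γ ν n f₀) ε).map fun u => ENNReal.ofReal (√(n : ℝ))⁻¹ *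
        wnorm (sobolevWeight (-1 / 2) δ) (u - kernelMean (localKernel B γ ν n f₀) ε) := by
  have hs := sqrt_pos_of_one_le hn
  have hS := measurable_series B γ
  have h1 : Measurable fun f : L2 => hNorm B δ (f - postMean B γ ν n (obs B n f₀ ε)) :=
    (measurable_sobolevNorm B (-1 / 2) δ).comp (measurable_id.sub_const _)
  have h2 : Measurable fun u : WaveletIndex J₀ m → ℝ => ENNReal.ofReal (√(n : ℝ))⁻¹ *
      wnorm (sobolevWeight (-1 / 2) δ) (u - kernelMean (localKernel B γ ν n f₀) ε) :=
    ((measurable_wnorm _).comp (measurable_id.sub_const _)).const_mul _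
  rw [hpost, Measure.map_map h1 hS, prodKernel_localKernel B γ ν hn f₀ ε,
    Measure.map_map h2 (by fun_prop)]
  refine Measure.map_congr ?_
  filter_upwards [ae_lt_top (measurable_energy γ) hen.ne] with g hg
  simp only [Function.comp_apply]
  rw [hNorm, sobolevNorm_eq, ← abs_of_pos (inv_pos.2 hs), ← wnorm_const_mul]
  congr 1
  ext i
  rw [coef_sub, Pi.sub_apply, kernelMean_localKernel hn hpost hen, coef_series hg.ne, snr,
    ← scale_mul_rescaled B γ f₀ i]
  field_simp
  ring

theorem ofReal_inv_mul_le_iff {s : ℝ} (hs : 0 < s) (x : ℝ≥0∞) (r : ℝ) :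
    ENNReal.ofReal s⁻¹ * x ≤ ENNReal.ofReal (r / s) ↔ x ≤ ENNReal.ofReal r := by
  rw [div_eq_inv_mul, ENNReal.ofReal_mul (inv_pos.2 hs).le,
    ENNReal.mul_le_mul_iff_right (by simpa using hs) ENNReal.ofReal_ne_top]

theorem post_credBall (hn : 1 ≤ n) (δ : ℝ)
    (hpost : post B γ ν n (obs B n f₀ ε) =
        (seqPost ν (snr γ n) fun i => √(n : ℝ) * obs B n f₀ ε i).map (series B γ))
    (hen : ∫⁻ g, energy γ g ∂(seqPost ν (snr γ n) fun i => √(n : ℝ) * obs B n f₀ ε i) < ∞) (r : ℝ) :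
    post B γ ν n (obs B n f₀ ε) (credBall B γ δ ν n (obs B n f₀ ε) r) =
      kernelBall (sobolevWeight (-1 / 2) δ) (localKernel B γ ν n f₀) ε r := by
  have hs := sqrt_pos_of_one_le hn
  have h1 : Measurable fun f : L2 => hNorm B δ (f - postMean B γ ν n (obs B n f₀ ε)) :=
    (measurable_sobolevNorm B (-1 / 2) δ).comp (measurable_id.sub_const _)
  have h2 : Measurable fun u : WaveletIndex J₀ m → ℝ => ENNReal.ofReal (√(n : ℝ))⁻¹ *
      wnorm (sobolevWeight (-1 / 2) δ) (u - kernelMean (localKernel B γ ν n f₀) ε) :=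
    ((measurable_wnorm _).comp (measurable_id.sub_const _)).const_mul _
  have h := congrArg (fun μ => μ (Iic (ENNReal.ofReal (r / √(n : ℝ)))))
    (map_hNorm_sub_postMean hn δ hpost hen)
  simp only [Measure.map_apply h1 measurableSet_Iic, Measure.map_apply h2 measurableSet_Iic] at h
  refine h.trans ?_
  rw [kernelBall]
  congr 1
  ext u
  exact ofReal_inv_mul_le_iff hs _ r

theorem mem_credBall_iff (hn : 1 ≤ n) (δ : ℝ)
    (hpost : post B γ ν n (obs B n f₀ ε) =
        (seqPost ν (snr γ n) fun i => √(n : ℝ) * obs B n f₀ ε i).map (series B γ))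
    (hen : ∫⁻ g, energy γ g ∂(seqPost ν (snr γ n) fun i => √(n : ℝ) * obs B n f₀ ε i) < ∞) (r : ℝ) :
    f₀ ∈ credBall B γ δ ν n (obs B n f₀ ε) r ↔
      wnorm (sobolevWeight (-1 / 2) δ) (ε + kernelMean (localKernel B γ ν n f₀) ε) ≤
        ENNReal.ofReal r := by
  rw [credBall, mem_ofPred_eq, hNorm_sub_postMean hn δ hpost hen]
  exact ofReal_inv_mul_le_iff (sqrt_pos_of_one_le hn) _ r

theorem wnorm_coef_ne_top {w : WaveletIndex J₀ m → ℝ} (hw : ∀ i, 0 ≤ w i)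
    (hws : ∑' i, ENNReal.ofReal (w i) ≠ ∞) (f : L2) : wnorm w (coef B f) ≠ ∞ := by
  rw [wnorm_ne_top_iff]
  refine ne_top_of_le_ne_top ?_ (ENNReal.tsum_le_tsum fun i => ?_)
    (b := ∑' i, (∑' j, ENNReal.ofReal (w j)) * ENNReal.ofReal (coef B f i ^ 2))
  · rw [ENNReal.tsum_mul_left, tsum_ofReal_coef_sq]
    finiteness
  · rw [ENNReal.ofReal_mul (hw i)]
    exact mul_le_mul' (ENNReal.le_tsum (f := fun i => ENNReal.ofReal (w i)) i) le_rfl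

/-- The credible radius exists. -/
theorem exists_radius (hn : 1 ≤ n) (δ : ℝ) {φ : ℝ → ℝ}
    (hν : ν = volume.withDensity fun x => ENNReal.ofReal (φ x))
    (hws : ∑' i : WaveletIndex J₀ m, ENNReal.ofReal (sobolevWeight (-1 / 2) δ i) ≠ ∞)
    [Nonempty (WaveletIndex J₀ m)]
    (hpost : post B γ ν n (obs B n f₀ ε) =
        (seqPost ν (snr γ n) fun i => √(n : ℝ) * obs B n f₀ ε i).map (series B γ))
    (hen : ∫⁻ g, energy γ g ∂(seqPost ν (snr γ n) fun i => √(n : ℝ) * obs B n f₀ ε i) < ∞)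
    {p : ℝ≥0∞} (hp0 : 0 < p) (hp1 : p < 1) :
    ∃ r : ℝ, 0 ≤ r ∧ post B γ ν n (obs B n f₀ ε) (credBall B γ δ ν n (obs B n f₀ ε) r) = p := by
  have hs := sqrt_pos_of_one_le hn
  have hs' : ENNReal.ofReal (√(n : ℝ))⁻¹ ≠ 0 := by simpa using hs
  set v := kernelMean (localKernel B γ ν n f₀) ε
  have h1 : Measurable fun f : L2 => hNorm B δ (f - postMean B γ ν n (obs B n f₀ ε)) :=
    (measurable_sobolevNorm B (-1 / 2) δ).comp (measurable_id.sub_const _)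
  have hT : Measurable fun u : WaveletIndex J₀ m → ℝ =>
      wnorm (sobolevWeight (-1 / 2) δ) (u - v) :=
    (measurable_wnorm _).comp (measurable_id.sub_const _)
  -- Every element of `L²` has finite H-norm, so `∞` carries no posterior mass; the identity of laws
  -- transfers this to sequences.
  have hfin : ∀ᵐ u ∂(prodKernel (localKernel B γ ν n f₀) ε),
      wnorm (sobolevWeight (-1 / 2) δ) (u - v) ≠ ∞ := by
    have h := congrArg (fun μ => μ {∞}) (map_hNorm_sub_postMean hn δ hpost hen)
    simp only [Measure.map_apply h1 (measurableSet_singleton _)] at h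
    rw [show (fun f : L2 => hNorm B δ (f - postMean B γ ν n (obs B n f₀ ε))) ⁻¹' {∞} = ∅ from
      eq_empty_of_forall_notMem fun f hf => wnorm_coef_ne_top (fun i =>
        (sobolevWeight_pos _ _ i).le) hws _ hf, measure_empty] at h
    rw [ae_iff]
    refine measure_mono_null (fun u hu => ?_) ((Measure.map_apply (hT.const_mul _)
      (measurableSet_singleton ∞)).symm.trans h.symm)
    simp only [not_not, mem_ofPred_eq] at hu
    simp [hu, ENNReal.mul_top hs']
  -- One atomless coordinate is enough; its law is an affine image of a tilt of `ν`, which has a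
  -- Lebesgue density.
  have hatom : ∀ c, c ≠ ∞ → prodKernel (localKernel B γ ν n f₀) ε
      {u | wnorm (sobolevWeight (-1 / 2) δ) (u - v) = c} = 0 := by
    intro c hc
    obtain ⟨j⟩ := ‹Nonempty (WaveletIndex J₀ m)›
    have : NullSingletonClass (localKernel B γ ν n f₀ j (ε j)) := by
      refine ⟨fun a => ?_⟩
      change coordLaw ν (snr γ n j) (rescaled B γ f₀ j) (ε j) {a} = 0
      rw [coordLaw, Measure.map_apply (by fun_prop) (measurableSet_singleton _)]
      refine (tilt_absolutelyContinuous ν _ _) ?_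
      rw [hν]
      refine withDensity_absolutelyContinuous _ _ ?_
      refine measure_mono_null (t := {(a + ε j) / snr γ n j + rescaled B γ f₀ j})
        (fun g hg => ?_) (measure_singleton _)
      have ht := (snr_pos γ hn j).ne'
      simp only [mem_preimage, mem_singleton_iff] at hg ⊢
      rw [← hg]
      field_simp
      ring
    exact infinitePi_wnorm_eq_null (fun i => localKernel B γ ν n f₀ i (ε i))
      (sobolevWeight_pos _ _ j) v hc
  obtain ⟨r, hr, hrp⟩ := exists_measure_le_eq hT hatom hfin hp0 hp1
  exact ⟨r, hr.le, (post_credBall hn δ hpost hen r).trans hrp⟩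

end Local

/-! ### Sums over levels -/

section Weights

variable {J₀ m : ℕ}

theorem two_rpow_le_charSeq (l : ℕ) : (2 : ℝ) ^ (l : ℝ) ≤ charSeq l := by
  rw [Real.rpow_natCast]; exact le_max_right _ _

theorem charSeq_le (l : ℕ) : charSeq l ≤ 2 * (2 : ℝ) ^ (l : ℝ) := by
  rw [Real.rpow_natCast]
  have : (1 : ℝ) ≤ 2 ^ l := one_le_pow₀ (by norm_num)
  exact max_le (by linarith) (by linarith)

theorem le_log_charSeq (l : ℕ) : Real.log 2 / 2 * (l + 1) ≤ Real.log (charSeq l) := by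
  have h2 : 0 < Real.log 2 := Real.log_pos (by norm_num)
  rcases Nat.eq_zero_or_pos l with rfl | hl
  · have : Real.log 2 ≤ Real.log (charSeq 0) := Real.log_le_log (by norm_num) (two_le_charSeq 0)
    simp only [Nat.cast_zero, zero_add, mul_one]
    linarith
  · have h1 : (1 : ℝ) ≤ l := by exact_mod_cast hl
    have : Real.log ((2 : ℝ) ^ (l : ℝ)) ≤ Real.log (charSeq l) :=
      Real.log_le_log (by positivity) (two_rpow_le_charSeq l)
    rw [Real.log_rpow (by norm_num)] at this
    nlinarith

theorem log_charSeq_le (l : ℕ) : Real.log (charSeq l) ≤ l + 1 := by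
  have h : Real.log (charSeq l) ≤ Real.log (2 * (2 : ℝ) ^ (l : ℝ)) :=
    Real.log_le_log (charSeq_pos l) (charSeq_le l)
  rw [Real.log_mul (by norm_num) (by positivity), Real.log_rpow (by norm_num)] at h
  have h2 : Real.log 2 ≤ 1 := by linarith [Real.log_two_lt_d9]
  have h3 : (l : ℝ) * Real.log 2 ≤ l * 1 := by gcongr
  linarith

theorem log_two_half_pos : 0 < Real.log 2 / 2 := by
  have : 0 < Real.log 2 := Real.log_pos (by norm_num)
  positivity

theorem sobolevWeight_neg_half_le {δ : ℝ} (hδ : 0 ≤ δ) (i : WaveletIndex J₀ m) :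
    sobolevWeight (-1 / 2) δ i ≤ ((Real.log 2 / 2) ^ (2 * δ))⁻¹ *
      ((2 : ℝ) ^ (-(i.1.1 : ℝ)) * ((i.1.1 : ℝ) + 1) ^ (-(2 * δ))) := by
  have h1 : charSeq i.1.1 ^ (2 * (-1 / 2) : ℝ) ≤ (2 : ℝ) ^ (-(i.1.1 : ℝ)) := by
    rw [show (2 * (-1 / 2) : ℝ) = -1 by norm_num, Real.rpow_neg_one, Real.rpow_neg (by norm_num)]
    exact inv_anti₀ (by positivity) (two_rpow_le_charSeq _)
  have h2 : (Real.log 2 / 2) ^ (2 * δ) * ((i.1.1 : ℝ) + 1) ^ (2 * δ) ≤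
      Real.log (charSeq i.1.1) ^ (2 * δ) := by
    rw [← Real.mul_rpow log_two_half_pos.le (by positivity)]
    exact Real.rpow_le_rpow (mul_nonneg log_two_half_pos.le (by positivity)) (le_log_charSeq _)
      (by positivity)
  have hp := Real.rpow_pos_of_pos log_two_half_pos (2 * δ)
  calc sobolevWeight (-1 / 2) δ i
      ≤ (2 : ℝ) ^ (-(i.1.1 : ℝ)) / ((Real.log 2 / 2) ^ (2 * δ) * ((i.1.1 : ℝ) + 1) ^ (2 * δ)) := by
        unfold sobolevWeight
        gcongr
    _ = _ := by
        rw [Real.rpow_neg (by positivity : (0 : ℝ) ≤ (i.1.1 : ℝ) + 1)]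
        field_simp

theorem tsum_nat_succ_rpow_ne_top {p : ℝ} (hp : 1 < p) :
    ∑' l : ℕ, ENNReal.ofReal (((l : ℝ) + 1) ^ (-p)) ≠ ∞ := by
  rw [tsum_ofReal_ne_top_iff fun l => by positivity]
  have h := (summable_nat_add_iff 1).2 (Real.summable_nat_rpow.2 (by linarith : -p < -1))
  simpa using h

theorem two_pow_mul_ofReal_neg (l : ℕ) (x : ℝ) :
    (2 : ℝ≥0∞) ^ l * ENNReal.ofReal ((2 : ℝ) ^ (-(l : ℝ)) * x) = ENNReal.ofReal x := by
  rw [two_pow_mul_ofReal, ← mul_assoc, ← Real.rpow_add (by norm_num)]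
  simp

/-- The `2 ^ l` indices at level `l` cancel the weight `2 ^ (-l)` and leave `∑ (l + 1) ^ (-2δ)`,
which is where `δ > 1 / 2` enters. -/
theorem tsum_sobolevWeight_ne_top {δ : ℝ} (hδ : 1 / 2 < δ) :
    ∑' i : WaveletIndex J₀ m, ENNReal.ofReal (sobolevWeight (-1 / 2) δ i) ≠ ∞ := by
  set c := ((Real.log 2 / 2) ^ (2 * δ))⁻¹
  have hc : 0 ≤ c := inv_nonneg.2 (Real.rpow_nonneg log_two_half_pos.le _)
  refine ne_top_of_le_ne_top ?_ (ENNReal.tsum_le_tsum fun i =>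
    (ENNReal.ofReal_le_ofReal (sobolevWeight_neg_half_le (by linarith) i)).trans_eq
      (ENNReal.ofReal_mul hc))
  rw [ENNReal.tsum_mul_left]
  refine ENNReal.mul_ne_top ENNReal.ofReal_ne_top (ne_top_of_le_ne_top ?_ (tsum_level_le fun l =>
    ENNReal.ofReal ((2 : ℝ) ^ (-(l : ℝ)) * ((l : ℝ) + 1) ^ (-(2 * δ)))))
  simp_rw [two_pow_mul_ofReal_neg]
  exact ENNReal.mul_ne_top (by finiteness) (tsum_nat_succ_rpow_ne_top (by linarith))

theorem sobolevWeight_mul_scale_sq_le {γ : ℝ} (hγ : 0 < γ) (i : WaveletIndex J₀ m) :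
    sobolevWeight γ 1 i * scale γ i ^ 2 ≤ 2 ^ (2 * γ) * ((Real.log 2 / 2) ^ (2 : ℝ))⁻¹ *
      ((2 : ℝ) ^ (-(i.1.1 : ℝ)) * ((i.1.1 : ℝ) + 1) ^ (-2 : ℝ)) := by
  have h1 : charSeq i.1.1 ^ (2 * γ) ≤ 2 ^ (2 * γ) * (2 : ℝ) ^ ((i.1.1 : ℝ) * (2 * γ)) := by
    rw [Real.rpow_mul (by norm_num : (0 : ℝ) ≤ 2) (i.1.1 : ℝ), ← Real.mul_rpow (by norm_num)
      (by positivity)]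
    exact Real.rpow_le_rpow (charSeq_pos _).le (charSeq_le _) (by positivity)
  have h2 : (Real.log 2 / 2) ^ (2 : ℝ) * ((i.1.1 : ℝ) + 1) ^ (2 : ℝ) ≤
      Real.log (charSeq i.1.1) ^ (2 * 1 : ℝ) := by
    rw [← Real.mul_rpow log_two_half_pos.le (by positivity), mul_one]
    exact Real.rpow_le_rpow (mul_nonneg log_two_half_pos.le (by positivity)) (le_log_charSeq _)
      (by positivity)
  have hp := Real.rpow_pos_of_pos log_two_half_pos 2
  have e : (2 : ℝ) ^ ((i.1.1 : ℝ) * (2 * γ)) * (2 : ℝ) ^ (-((i.1.1 : ℝ) * (2 * γ + 1))) =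
      (2 : ℝ) ^ (-(i.1.1 : ℝ)) := by
    rw [← Real.rpow_add (by norm_num)]
    congr 1; ring
  rw [scale_sq, ← e]
  calc _ ≤ 2 ^ (2 * γ) * (2 : ℝ) ^ ((i.1.1 : ℝ) * (2 * γ)) /
        ((Real.log 2 / 2) ^ (2 : ℝ) * ((i.1.1 : ℝ) + 1) ^ (2 : ℝ)) *
          (2 : ℝ) ^ (-((i.1.1 : ℝ) * (2 * γ + 1))) := by
        unfold sobolevWeight
        gcongr
    _ = _ := by
        rw [Real.rpow_neg (by positivity : (0 : ℝ) ≤ (i.1.1 : ℝ) + 1)]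
        field_simp

/-- At the smoothness of the prior all powers of two cancel; convergence comes from the factor `(l +
1) ^ (-2)` alone, supplied by the logarithmic exponent `1` of the norm. -/
theorem tsum_sobolevWeight_mul_scale_sq_ne_top {γ : ℝ} (hγ : 0 < γ) :
    ∑' i : WaveletIndex J₀ m, ENNReal.ofReal (sobolevWeight γ 1 i * scale γ i ^ 2) ≠ ∞ := by
  set c := (2 : ℝ) ^ (2 * γ) * ((Real.log 2 / 2) ^ (2 : ℝ))⁻¹
  have hc : 0 ≤ c := mul_nonneg (by positivity) (inv_nonneg.2
    (Real.rpow_nonneg log_two_half_pos.le _))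
  refine ne_top_of_le_ne_top ?_ (ENNReal.tsum_le_tsum fun i =>
    (ENNReal.ofReal_le_ofReal (sobolevWeight_mul_scale_sq_le hγ i)).trans_eq
      (ENNReal.ofReal_mul hc))
  rw [ENNReal.tsum_mul_left]
  refine ENNReal.mul_ne_top ENNReal.ofReal_ne_top (ne_top_of_le_ne_top ?_ (tsum_level_le fun l =>
    ENNReal.ofReal ((2 : ℝ) ^ (-(l : ℝ)) * ((l : ℝ) + 1) ^ (-2 : ℝ))))
  simp_rw [two_pow_mul_ofReal_neg]
  exact ENNReal.mul_ne_top (by finiteness) (tsum_nat_succ_rpow_ne_top (by norm_num))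

theorem inv_snr_sq {γ : ℝ} {n : ℕ} (i : WaveletIndex J₀ m) :
    (snr γ n i)⁻¹ ^ 2 = (2 : ℝ) ^ ((i.1.1 : ℝ) * (2 * γ + 1)) / n := by
  rw [snr, inv_pow, mul_pow, scale_sq, Real.sq_sqrt (Nat.cast_nonneg n),
    Real.rpow_neg (by norm_num)]
  field_simp

/-- The variance reduction at level `l` is at most of the order `√((l + 1) / log n)`. -/
theorem min_inv_snr_sq_le {γ : ℝ} (hγ : 0 < γ) {n : ℕ} (hn : 2 ≤ n) (i : WaveletIndex J₀ m) :
    min 1 ((snr γ n i)⁻¹ ^ 2) ≤ √(2 * (2 * γ + 1)) *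
      (((i.1.1 : ℝ) + 1) ^ (1 / 2 : ℝ) * Real.log n ^ (-(1 / 2) : ℝ)) := by
  have hn' : (2 : ℝ) ≤ n := by exact_mod_cast hn
  have hlog : 0 < Real.log n := Real.log_pos (by linarith)
  rw [inv_snr_sq, Real.rpow_neg hlog.le, ← Real.sqrt_eq_rpow, ← Real.sqrt_eq_rpow,
    ← Real.sqrt_inv, ← Real.sqrt_mul (by positivity), ← Real.sqrt_mul (by positivity)]
  refine Real.le_sqrt_of_sq_le ?_
  set x := (2 : ℝ) ^ ((i.1.1 : ℝ) * (2 * γ + 1)) with hx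
  have hx0 : 0 < x := by positivity
  have hm0 : 0 ≤ min 1 (x / n) := le_min zero_le_one (by positivity)
  have hm1 : min 1 (x / n) ^ 2 ≤ 1 := pow_le_one₀ hm0 (min_le_left _ _)
  -- If `x ≤ √n`, the ratio is at most `n ^ (-1/2)`, which is below `(log n) ^ (-1/2)`. Otherwise
  -- the level is at least of order `log n`, and the right side is at least `1`.
  by_cases h : x ^ 2 ≤ n
  · have h1 : min 1 (x / n) ^ 2 ≤ (n : ℝ)⁻¹ := by
      calc _ ≤ (x / n) ^ 2 := by gcongr; exact min_le_right _ _
        _ = x ^ 2 / n * (n : ℝ)⁻¹ := by field_simp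
        _ ≤ 1 * (n : ℝ)⁻¹ := by
            gcongr
            rw [div_le_one (by linarith)]
            exact h
        _ = _ := one_mul _
    have h2 : (n : ℝ)⁻¹ ≤ (Real.log n)⁻¹ :=
      inv_anti₀ hlog (by linarith [Real.log_le_sub_one_of_pos (by linarith : (0 : ℝ) < n)])
    have h3 : 0 ≤ (i.1.1 : ℝ) := Nat.cast_nonneg _
    have h4 : 0 ≤ (Real.log n)⁻¹ := by positivity
    refine (h1.trans h2).trans ?_
    rw [← mul_assoc]
    refine le_mul_of_one_le_left h4 ?_
    nlinarith
  · have h1 : Real.log n < 2 * ((i.1.1 : ℝ) * (2 * γ + 1)) := by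
      have h2 := Real.log_lt_log (by linarith) (not_le.1 h)
      rw [Real.log_pow, hx, Real.log_rpow (by norm_num)] at h2
      have h3 : Real.log 2 ≤ 1 := by linarith [Real.log_two_lt_d9]
      have h4 : 0 ≤ (i.1.1 : ℝ) * (2 * γ + 1) := by positivity
      push_cast at h2
      nlinarith
    refine hm1.trans ?_
    rw [← mul_assoc, ← div_eq_mul_inv, one_le_div hlog]
    nlinarith

/-- The weighted sum of the variance reductions decays like `(log n) ^ (-1/2)`. -/
theorem exists_tsum_min_inv_snr_sq_le {γ : ℝ} (hγ : 0 < γ) :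
    ∃ K : ℝ≥0∞, K ≠ ∞ ∧ ∀ n : ℕ, 2 ≤ n →
      ∑' i : WaveletIndex J₀ m, ENNReal.ofReal (sobolevWeight γ 1 i * scale γ i ^ 2) *
        ENNReal.ofReal (min 1 ((snr γ n i)⁻¹ ^ 2)) ≤
      K * ENNReal.ofReal (Real.log n ^ (-(1 / 2) : ℝ)) := by
  set c := (2 : ℝ) ^ (2 * γ) * ((Real.log 2 / 2) ^ (2 : ℝ))⁻¹ with hc_def
  have hc : 0 ≤ c := mul_nonneg (by positivity) (inv_nonneg.2
    (Real.rpow_nonneg log_two_half_pos.le _))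
  set d := √(2 * (2 * γ + 1))
  -- The factor `√(l + 1)` weakens the decay from `(l + 1) ^ (-2)` to `(l + 1) ^ (-3/2)`, which is
  -- still summable.
  refine ⟨ENNReal.ofReal (c * d) * ((m + 1) * ∑' l : ℕ,
    ENNReal.ofReal (((l : ℝ) + 1) ^ (-(3 / 2) : ℝ))), ?_, fun n hn => ?_⟩
  · exact ENNReal.mul_ne_top ENNReal.ofReal_ne_top (ENNReal.mul_ne_top (by finiteness)
      (tsum_nat_succ_rpow_ne_top (by norm_num)))
  · have hlog : 0 ≤ Real.log n := Real.log_natCast_nonneg n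
    have hl : 0 ≤ Real.log n ^ (-(1 / 2) : ℝ) := Real.rpow_nonneg hlog _
    have h1 : ∀ i : WaveletIndex J₀ m, ENNReal.ofReal (sobolevWeight γ 1 i * scale γ i ^ 2) *
        ENNReal.ofReal (min 1 ((snr γ n i)⁻¹ ^ 2)) ≤
        ENNReal.ofReal (Real.log n ^ (-(1 / 2) : ℝ)) * ENNReal.ofReal (c * d) *
          ENNReal.ofReal ((2 : ℝ) ^ (-(i.1.1 : ℝ)) * ((i.1.1 : ℝ) + 1) ^ (-(3 / 2) : ℝ)) := by
      intro i
      have hcd : 0 ≤ c * d := mul_nonneg hc (Real.sqrt_nonneg _)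
      have hw : 0 ≤ sobolevWeight γ 1 i * scale γ i ^ 2 :=
        mul_nonneg (sobolevWeight_pos _ _ _).le (sq_nonneg _)
      rw [← ENNReal.ofReal_mul hw, ← ENNReal.ofReal_mul hl,
        ← ENNReal.ofReal_mul (mul_nonneg hl hcd)]
      refine ENNReal.ofReal_le_ofReal ((mul_le_mul (sobolevWeight_mul_scale_sq_le hγ i)
        (min_inv_snr_sq_le hγ hn i) (le_min zero_le_one (sq_nonneg _))
        (mul_nonneg hc (by positivity))).trans (le_of_eq ?_))
      have e : ((i.1.1 : ℝ) + 1) ^ (-(3 / 2) : ℝ) =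
          ((i.1.1 : ℝ) + 1) ^ (-2 : ℝ) * ((i.1.1 : ℝ) + 1) ^ (1 / 2 : ℝ) := by
        rw [← Real.rpow_add (by positivity)]
        norm_num
      rw [e]
      ring
    refine (ENNReal.tsum_le_tsum h1).trans ?_
    rw [ENNReal.tsum_mul_left, mul_assoc, mul_comm]
    refine mul_le_mul' (mul_le_mul' le_rfl ((tsum_level_le fun l => ENNReal.ofReal
      ((2 : ℝ) ^ (-(l : ℝ)) * ((l : ℝ) + 1) ^ (-(3 / 2) : ℝ))).trans ?_)) le_rfl
    simp_rw [two_pow_mul_ofReal_neg]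
    rfl

end Weights

/-! ### Contraction in the logarithmic Sobolev norm -/

section Contraction

variable {S J₀ m : ℕ} (B : RegularBasis S J₀ m) (γ : ℝ) (ν : Measure ℝ) [IsProbabilityMeasure ν]

/-- The posterior risk for the squared norm `‖·‖_{γ,2,1}`, as a function of the noise. -/
def sobolevRisk (n : ℕ) (f₀ : L2) (ε : WaveletIndex J₀ m → ℝ) : ℝ≥0∞ :=
  ∫⁻ g, ∑' i, ENNReal.ofReal (sobolevWeight γ 1 i *
    (scale γ i * g i - coef B f₀ i) ^ 2) ∂(seqPost ν (snr γ n) fun i => √(n : ℝ) * obs B n f₀ ε i)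

theorem measurable_sobolevRisk (n : ℕ) (f₀ : L2) : Measurable (sobolevRisk B γ ν n f₀) := by
  have h1 : Measurable fun y : WaveletIndex J₀ m → ℝ => ∫⁻ g, ∑' i,
      ENNReal.ofReal (sobolevWeight γ 1 i * (scale γ i * g i - coef B f₀ i) ^ 2)
        ∂(seqPost ν (snr γ n) y) := Measurable.lintegral_kernel (by fun_prop)
  have h2 : Measurable fun ε : WaveletIndex J₀ m → ℝ => fun i => √(n : ℝ) * obs B n f₀ ε i :=
    measurable_pi_lambda _ fun i =>
      ((measurable_pi_apply i).comp (measurable_obs B n f₀)).const_mul _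
  exact h1.comp h2

/-- A weighted squared norm is additive over coordinates, so Tonelli's theorem and the product form
of noise and posterior reduce the risk to single coefficients. -/
theorem lintegral_sobolevRisk {n : ℕ} (hn : 1 ≤ n) (f₀ : L2) :
    ∫⁻ ε, sobolevRisk B γ ν n f₀ ε ∂(stdGaussian (WaveletIndex J₀ m)) =
      ∑' i : WaveletIndex J₀ m, ENNReal.ofReal (sobolevWeight γ 1 i * scale γ i ^ 2) *
        tiltRisk ν (snr γ n i) (rescaled B γ f₀ i) := by
  have hs := sqrt_pos_of_one_le hn
  set A : WaveletIndex J₀ m → ℝ → ℝ≥0∞ := fun i ε => ∫⁻ g,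
    ENNReal.ofReal ((g - rescaled B γ f₀ i) ^ 2)
      ∂(tilt ν (snr γ n i) (snr γ n i * rescaled B γ f₀ i + ε)) with hA
  have hAm : ∀ i, Measurable (A i) := fun i => by
    have h : Measurable fun y => ∫⁻ g, ENNReal.ofReal ((g - rescaled B γ f₀ i) ^ 2)
        ∂(tilt ν (snr γ n i) y) := Measurable.lintegral_kernel (by fun_prop)
    exact h.comp (by fun_prop : Measurable fun ε => snr γ n i * rescaled B γ f₀ i + ε)
  have hAm' : ∀ i, Measurable fun ε : WaveletIndex J₀ m → ℝ => A i (ε i) := fun i =>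
    (hAm i).comp (measurable_pi_apply i)
  have h1 : ∀ ε, sobolevRisk B γ ν n f₀ ε = ∑' i : WaveletIndex J₀ m,
      ENNReal.ofReal (sobolevWeight γ 1 i * scale γ i ^ 2) * A i (ε i) := by
    intro ε
    rw [sobolevRisk, lintegral_tsum fun i => (Measurable.aemeasurable (by fun_prop))]
    refine tsum_congr fun i => ?_
    have e := sqrt_mul_obs B γ hn f₀ ε i
    have hw : 0 ≤ sobolevWeight γ 1 i * scale γ i ^ 2 :=
      mul_nonneg (sobolevWeight_pos _ _ _).le (sq_nonneg _)
    have e2 : ∀ g : WaveletIndex J₀ m → ℝ, ENNReal.ofReal (sobolevWeight γ 1 i *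
        (scale γ i * g i - coef B f₀ i) ^ 2) = ENNReal.ofReal (sobolevWeight γ 1 i *
          scale γ i ^ 2) * ENNReal.ofReal ((g i - rescaled B γ f₀ i) ^ 2) := by
      intro g
      rw [← ENNReal.ofReal_mul hw, ← scale_mul_rescaled B γ f₀ i]
      congr 1; ring
    simp_rw [e2]
    rw [lintegral_const_mul' _ _ ENNReal.ofReal_ne_top, seqPost_apply,
      lintegral_infinitePi_eval (fun i => tilt ν (snr γ n i) (√(n : ℝ) * obs B n f₀ ε i)) i
        (f := fun g => ENNReal.ofReal ((g - rescaled B γ f₀ i) ^ 2)) (by fun_prop), e]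
  simp_rw [h1]
  rw [lintegral_tsum fun i => ((hAm' i).const_mul _).aemeasurable]
  refine tsum_congr fun i => ?_
  rw [lintegral_const_mul' _ _ ENNReal.ofReal_ne_top]
  congr 1
  exact lintegral_infinitePi_eval (fun _ : WaveletIndex J₀ m => gaussianReal 0 1) i (hAm i)

variable {B γ ν}

/-- The expected posterior risk decays like `(log n) ^ (-1/2)`. -/
theorem exists_lintegral_sobolevRisk_le (hγ : 0 < γ) {f₀ : L2} {K : ℝ≥0∞} (hK : K ≠ ∞)
    (hrisk : ∀ n : ℕ, 1 ≤ n → ∀ i : WaveletIndex J₀ m,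
      tiltRisk ν (snr γ n i) (rescaled B γ f₀ i) ≤ K * ENNReal.ofReal (min 1 ((snr γ n i)⁻¹ ^ 2))) :
    ∃ K' : ℝ≥0∞, K' ≠ ∞ ∧ ∀ n : ℕ, 2 ≤ n →
      ∫⁻ ε, sobolevRisk B γ ν n f₀ ε ∂(stdGaussian (WaveletIndex J₀ m)) ≤
        K' * ENNReal.ofReal (Real.log n ^ (-(1 / 2) : ℝ)) := by
  obtain ⟨K', hK', h⟩ := exists_tsum_min_inv_snr_sq_le (J₀ := J₀) (m := m) hγ
  refine ⟨K * K', ENNReal.mul_ne_top hK hK', fun n hn => ?_⟩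
  rw [lintegral_sobolevRisk B γ ν (by omega) f₀, mul_assoc]
  refine (ENNReal.tsum_le_tsum fun i => ?_).trans ((ENNReal.tsum_mul_left).trans_le
    (mul_le_mul' le_rfl (h n hn)))
  rw [mul_left_comm]
  exact mul_le_mul' le_rfl (hrisk n (by omega) i)

/-- Markov's inequality for the squared norm under the posterior. -/
theorem post_le_sobolevRisk {f₀ : L2} {n : ℕ} {ε : WaveletIndex J₀ m → ℝ}
    (hpost : post B γ ν n (obs B n f₀ ε) =
        (seqPost ν (snr γ n) fun i => √(n : ℝ) * obs B n f₀ ε i).map (series B γ))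
    (hen : ∫⁻ g, energy γ g ∂(seqPost ν (snr γ n) fun i => √(n : ℝ) * obs B n f₀ ε i) < ∞)
    {d : ℝ≥0∞} (hd : d ≠ 0) (hdt : d ≠ ∞) :
    post B γ ν n (obs B n f₀ ε) {f | d ≤ sobolevNorm B γ 1 (f - f₀)} ≤
      (d ^ 2)⁻¹ * sobolevRisk B γ ν n f₀ ε := by
  have hS := measurable_series B γ
  have hm : Measurable fun f : L2 => sobolevNorm B γ 1 (f - f₀) :=
    (measurable_sobolevNorm B γ 1).comp (measurable_id.sub_const _)
  rw [hpost, Measure.map_apply hS (measurableSet_le measurable_const hm), mul_comm,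
    ← div_eq_mul_inv, sobolevRisk]
  refine le_trans (measure_mono_ae ?_) (meas_ge_le_lintegral_div
    (Measurable.aemeasurable (by fun_prop)) (by positivity) (by finiteness))
  filter_upwards [ae_lt_top (measurable_energy γ) hen.ne] with g hg hgd
  have h1 : d ≤ wnorm (sobolevWeight γ 1) (coef B (series B γ g - f₀)) := hgd
  rw [le_wnorm_iff] at h1
  simp_rw [coef_sub, coef_series hg.ne] at h1
  exact h1

theorem sobolevNorm_sub_comm (s δ : ℝ) (f g : L2) :
    sobolevNorm B s δ (f - g) = sobolevNorm B s δ (g - f) := by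
  have h : coef B (f - g) = -coef B (g - f) := by
    ext i
    simp [coef_sub]
  rw [sobolevNorm_eq, sobolevNorm_eq, h, wnorm_neg]

theorem sobolevNorm_le_add (s δ : ℝ) (f g : L2) :
    sobolevNorm B s δ f ≤ sobolevNorm B s δ g + sobolevNorm B s δ (f - g) := by
  have h : coef B (f - g) = coef B f - coef B g := funext fun i => coef_sub B f g i
  rw [sobolevNorm_eq, sobolevNorm_eq, sobolevNorm_eq, h]
  exact wnorm_le_add_sub (fun i => (sobolevWeight_pos s δ i).le) _ _

theorem abs_coef_le_of_holderNorm {f₀ : L2} (h : holderNorm B γ f₀ ≠ ∞) (i : WaveletIndex J₀ m) :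
    |rescaled B γ f₀ i| ≤ (holderNorm B γ f₀).toReal := by
  rw [rescaled, abs_mul, abs_of_pos (by positivity)]
  refine (ENNReal.ofReal_le_iff_le_toReal h).1 ?_
  exact le_iSup (fun i : WaveletIndex J₀ m => ENNReal.ofReal ((2 : ℝ) ^ ((i.1.1 : ℝ) *
    (γ + 1 / 2)) * |coef B f₀ i|)) i

/-- The Hölder bound makes the coefficients of `f₀` at most a constant times `scale`, so the series
that bounds the prior draws bounds `f₀` as well. -/
theorem sobolevNorm_ne_top (hγ : 0 < γ) {f₀ : L2} (h : holderNorm B γ f₀ ≠ ∞) :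
    sobolevNorm B γ 1 f₀ ≠ ∞ := by
  rw [sobolevNorm_eq, wnorm_ne_top_iff]
  refine ne_top_of_le_ne_top (b := ∑' i : WaveletIndex J₀ m,
    ENNReal.ofReal (sobolevWeight γ 1 i * scale γ i ^ 2) *
      ENNReal.ofReal ((holderNorm B γ f₀).toReal ^ 2)) ?_ (ENNReal.tsum_le_tsum fun i => ?_)
  · rw [ENNReal.tsum_mul_right]
    exact ENNReal.mul_ne_top (tsum_sobolevWeight_mul_scale_sq_ne_top hγ) ENNReal.ofReal_ne_top
  · have hw := (sobolevWeight_pos γ 1 i).le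
    rw [← ENNReal.ofReal_mul (mul_nonneg hw (sq_nonneg _)), ← scale_mul_rescaled B γ f₀ i, mul_pow,
      ← mul_assoc]
    refine ENNReal.ofReal_le_ofReal (mul_le_mul_of_nonneg_left ?_ (mul_nonneg hw (sq_nonneg _)))
    rw [← sq_abs (rescaled B γ f₀ i)]
    exact pow_le_pow_left₀ (abs_nonneg _) (abs_coef_le_of_holderNorm h i) 2

/-- What a small posterior mass away from `f₀` says about the bound `M_n`. -/
theorem normBound_of_post_le {f₀ : L2} {n : ℕ} {x : WaveletIndex J₀ m → ℝ} {η : ℝ} (hη : 0 < η)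
    [IsProbabilityMeasure (post B γ ν n x)] (hf₀ : sobolevNorm B γ 1 f₀ ≠ ∞)
    (hlog : 16 < Real.log n)
    (hpost : post B γ ν n x {f | ENNReal.ofReal (η / 2) ≤ sobolevNorm B γ 1 (f - f₀)} ≤
      ENNReal.ofReal (Real.log n ^ (-(1 / 4) : ℝ))) :
    normBound B γ η ν n x ≤ sobolevNorm B γ 1 f₀ + ENNReal.ofReal (η / 2) ∧
      sobolevNorm B γ 1 f₀ ≤ normBound B γ η ν n x + ENNReal.ofReal (2 * η) := by
  set N := (sobolevNorm B γ 1 f₀).toReal with hN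
  have hN0 : 0 ≤ N := ENNReal.toReal_nonneg
  have hNe : sobolevNorm B γ 1 f₀ = ENNReal.ofReal N := (ENNReal.ofReal_toReal hf₀).symm
  set E := {f : L2 | ENNReal.ofReal (η / 2) ≤ sobolevNorm B γ 1 (f - f₀)} with hE
  have hEm : MeasurableSet E := measurableSet_le measurable_const
    ((measurable_sobolevNorm B γ 1).comp (measurable_id.sub_const _))
  set ρ := Real.log n ^ (-(1 / 4) : ℝ) with hρ
  have hρ0 : 0 ≤ ρ := Real.rpow_nonneg (by linarith) _
  -- Below `1 / 2`, a set of mass at least `1 - ρ` cannot lie inside one of mass at most `ρ`. The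
  -- threshold `16` comes from `16 ^ (1/4) = 2`.
  have hρ1 : ρ < 1 / 2 := by
    have h1 : (16 : ℝ) ^ (1 / 4 : ℝ) = 2 := by
      rw [show (16 : ℝ) = 2 ^ (4 : ℝ) by norm_num, ← Real.rpow_mul (by norm_num)]
      norm_num
    have h2 : (16 : ℝ) ^ (1 / 4 : ℝ) < Real.log n ^ (1 / 4 : ℝ) :=
      Real.rpow_lt_rpow (by norm_num) hlog (by norm_num)
    rw [hρ, Real.rpow_neg (by linarith), one_div 2]
    exact inv_strictAnti₀ (by norm_num) (by linarith)
  have hEr : (post B γ ν n x).real E ≤ ρ := by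
    rw [measureReal_def]
    exact ENNReal.toReal_le_of_le_ofReal hρ0 hpost
  have hnear : ∀ f ∉ E, sobolevNorm B γ 1 f ≠ ∞ ∧
      |(sobolevNorm B γ 1 f).toReal - N| ≤ η / 2 := by
    intro f hf
    have hf' : sobolevNorm B γ 1 (f - f₀) ≤ ENNReal.ofReal (η / 2) := (not_le.1 hf).le
    have h1 : sobolevNorm B γ 1 f ≤ ENNReal.ofReal (N + η / 2) := by
      rw [ENNReal.ofReal_add hN0 (by positivity), ← hNe]
      exact (sobolevNorm_le_add γ 1 f f₀).trans (add_le_add le_rfl hf')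
    have h2 : sobolevNorm B γ 1 f ≠ ∞ := ne_top_of_le_ne_top ENNReal.ofReal_ne_top h1
    have h3 := ENNReal.toReal_le_of_le_ofReal (by positivity) h1
    have h4 : N ≤ (sobolevNorm B γ 1 f).toReal + η / 2 := by
      refine (ENNReal.ofReal_le_ofReal_iff (by positivity)).1 ?_
      rw [← hNe, ENNReal.ofReal_add ENNReal.toReal_nonneg (by positivity),
        ENNReal.ofReal_toReal h2]
      refine (sobolevNorm_le_add γ 1 f₀ f).trans (add_le_add le_rfl ?_)
      rwa [sobolevNorm_sub_comm]
    exact ⟨h2, abs_le.2 ⟨by linarith, by linarith⟩⟩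
  have hcompl : 1 - ρ ≤ (post B γ ν n x).real Eᶜ := by
    rw [probReal_compl_eq_one_sub hEm]
    linarith
  constructor
  · rw [hNe, ← ENNReal.ofReal_add hN0 (by positivity)]
    -- The shift by `η / 2` keeps the candidate positive even when `N = 0`; norms within `η / 2` of
    -- `N` are still within `η` of it.
    refine sInf_le ⟨N + η / 2, ⟨by positivity, hcompl.trans (measureReal_mono fun f hf => ?_)⟩, rfl⟩
    obtain ⟨h1, h2⟩ := hnear f hf
    rw [abs_le] at h2
    exact ⟨h1, abs_le.2 ⟨by linarith, by linarith⟩⟩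
  · refine (tsub_le_iff_right).1 (le_sInf ?_)
    rintro _ ⟨M, ⟨hM0, hM⟩, rfl⟩
    rw [tsub_le_iff_right, hNe, ← ENNReal.ofReal_add hM0.le (by positivity)]
    refine ENNReal.ofReal_le_ofReal ?_
    -- The norm of a common point is within `η` of `M` and within `η / 2` of `N`, so `N ≤ M + 2 η`.
    obtain ⟨f, hf, hfE⟩ : ∃ f, f ∈ {f | sobolevNorm B γ 1 f ≠ ∞ ∧
        |(sobolevNorm B γ 1 f).toReal - M| ≤ η} ∧ f ∉ E := by
      by_contra! hcon
      have h : (post B γ ν n x).real {f | sobolevNorm B γ 1 f ≠ ∞ ∧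
        |(sobolevNorm B γ 1 f).toReal - M| ≤ η} ≤ (post B γ ν n x).real E :=
        measureReal_mono hcon
      linarith
    have h2 := abs_le.1 (hnear f hfE).2
    have h3 := abs_le.1 hf.2
    linarith

end Contraction

/-! ### Interpolation of the `L²` norm -/

section Interpolation

variable {S J₀ m : ℕ} {B : RegularBasis S J₀ m}

/-- Interpolation coordinate by coordinate: once a combination of the two weights dominates `1`,
Parseval's sum is dominated by the same combination of the two squared norms. -/
theorem norm_sq_le_of_wnorm_le {w q : WaveletIndex J₀ m → ℝ} (hw : ∀ i, 0 ≤ w i)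
    (hq : ∀ i, 0 ≤ q i) {A D : ℝ} (hA : 0 ≤ A) (hD : 0 ≤ D) (h1 : ∀ i, 1 ≤ A * w i + D * q i)
    {f : L2} {a d : ℝ} (ha : wnorm w (coef B f) ≤ ENNReal.ofReal a)
    (hd : wnorm q (coef B f) ≤ ENNReal.ofReal d) (ha0 : 0 ≤ a) (hd0 : 0 ≤ d) :
    ‖f‖ ^ 2 ≤ A * a ^ 2 + D * d ^ 2 := by
  rw [wnorm_le_iff, ← ENNReal.ofReal_pow ha0] at ha
  rw [wnorm_le_iff, ← ENNReal.ofReal_pow hd0] at hd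
  refine (ENNReal.ofReal_le_ofReal_iff (by positivity)).1 ?_
  rw [← tsum_ofReal_coef_sq B]
  calc ∑' i, ENNReal.ofReal (coef B f i ^ 2)
      ≤ ∑' i, (ENNReal.ofReal A * ENNReal.ofReal (w i * coef B f i ^ 2) +
          ENNReal.ofReal D * ENNReal.ofReal (q i * coef B f i ^ 2)) := by
        refine ENNReal.tsum_le_tsum fun i => ?_
        have e1 := mul_nonneg (hw i) (sq_nonneg (coef B f i))
        have e2 := mul_nonneg (hq i) (sq_nonneg (coef B f i))
        rw [← ENNReal.ofReal_mul hA, ← ENNReal.ofReal_mul hD,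
          ← ENNReal.ofReal_add (by positivity) (by positivity)]
        refine ENNReal.ofReal_le_ofReal ?_
        nlinarith [mul_le_mul_of_nonneg_right (h1 i) (sq_nonneg (coef B f i))]
    _ = ENNReal.ofReal A * ∑' i, ENNReal.ofReal (w i * coef B f i ^ 2) +
          ENNReal.ofReal D * ∑' i, ENNReal.ofReal (q i * coef B f i ^ 2) := by
        rw [ENNReal.tsum_add, ENNReal.tsum_mul_left, ENNReal.tsum_mul_left]
    _ ≤ ENNReal.ofReal A * ENNReal.ofReal (a ^ 2) + ENNReal.ofReal D * ENNReal.ofReal (d ^ 2) := by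
        gcongr
    _ = ENNReal.ofReal (A * a ^ 2 + D * d ^ 2) := by
        rw [← ENNReal.ofReal_mul hA, ← ENNReal.ofReal_mul hD,
          ← ENNReal.ofReal_add (by positivity) (by positivity)]

theorem one_le_mul_sobolevWeight_of_le {δ L : ℝ} (hδ : 0 ≤ δ) (i : WaveletIndex J₀ m)
    (hi : (i.1.1 : ℝ) ≤ L) :
    1 ≤ 2 * (2 : ℝ) ^ L * (L + 1) ^ (2 * δ) * sobolevWeight (-1 / 2) δ i := by
  have hl : 0 ≤ (i.1.1 : ℝ) := Nat.cast_nonneg _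
  have h1 : charSeq i.1.1 ≤ 2 * (2 : ℝ) ^ L :=
    (charSeq_le _).trans (by gcongr; norm_num)
  have h2 : Real.log (charSeq i.1.1) ^ (2 * δ) ≤ (L + 1) ^ (2 * δ) :=
    Real.rpow_le_rpow (log_charSeq_pos _).le ((log_charSeq_le _).trans (by linarith))
      (by positivity)
  have h3 := charSeq_pos i.1.1
  have h4 := Real.rpow_pos_of_pos (log_charSeq_pos i.1.1) (2 * δ)
  rw [sobolevWeight, show (2 * (-1 / 2) : ℝ) = -1 by norm_num, Real.rpow_neg_one]
  calc (1 : ℝ) = charSeq i.1.1 * Real.log (charSeq i.1.1) ^ (2 * δ) *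
        ((charSeq i.1.1)⁻¹ / Real.log (charSeq i.1.1) ^ (2 * δ)) := by field_simp
    _ ≤ _ := by gcongr

theorem one_le_mul_sobolevWeight_of_ge {γ L : ℝ} (hγ : 0 < γ) (hL : 0 ≤ L)
    (i : WaveletIndex J₀ m) (hi : L ≤ (i.1.1 : ℝ)) :
    1 ≤ (1 + (γ * Real.log 2)⁻¹) ^ 2 * (2 : ℝ) ^ (-(2 * γ * L)) * (L + 1) ^ 2 *
      sobolevWeight γ 1 i := by
  have hlog : 0 < Real.log 2 := Real.log_pos (by norm_num)
  set l : ℝ := (i.1.1 : ℝ) with hl_def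
  set c := γ * Real.log 2 with hc_def
  have hc : 0 < c := by positivity
  have hk : 0 ≤ l - L := by linarith
  -- Exponential growth above the cut pays for the logarithm: `l + 1 ≤ (L + 1) (l - L + 1)`, and the
  -- second factor is absorbed by `2 ^ (γ (l - L))`.
  have h0 : l - L + 1 ≤ (1 + c⁻¹) * (2 : ℝ) ^ (γ * (l - L)) := by
    have e : (2 : ℝ) ^ (γ * (l - L)) = Real.exp (c * (l - L)) := by
      rw [Real.rpow_def_of_pos (by norm_num)]
      congr 1; rw [hc_def]; ring
    have h1 := Real.add_one_le_exp (c * (l - L))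
    have h2 : 1 ≤ Real.exp (c * (l - L)) := Real.one_le_exp (by positivity)
    rw [e, add_mul, one_mul]
    have h3 : l - L ≤ c⁻¹ * Real.exp (c * (l - L)) := by
      rw [← div_eq_inv_mul, le_div_iff₀ hc]
      linarith
    linarith
  have h1 : l + 1 ≤ (L + 1) * ((1 + c⁻¹) * (2 : ℝ) ^ (γ * (l - L))) := by
    refine le_trans ?_ (mul_le_mul_of_nonneg_left h0 (by linarith))
    nlinarith
  have h2 : (2 : ℝ) ^ (2 * γ * l) ≤ charSeq i.1.1 ^ (2 * γ) := by
    rw [mul_comm, Real.rpow_mul (by norm_num)]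
    exact Real.rpow_le_rpow (by positivity) (two_rpow_le_charSeq _) (by positivity)
  have h3 : Real.log (charSeq i.1.1) ^ (2 * 1 : ℝ) ≤
      ((L + 1) * ((1 + c⁻¹) * (2 : ℝ) ^ (γ * (l - L)))) ^ 2 := by
    rw [mul_one, Real.rpow_two]
    exact pow_le_pow_left₀ (log_charSeq_pos _).le ((log_charSeq_le _).trans h1) 2
  have h4 : 0 < Real.log (charSeq i.1.1) ^ (2 * 1 : ℝ) :=
    Real.rpow_pos_of_pos (log_charSeq_pos _) _
  have e : (2 : ℝ) ^ (-(2 * γ * L)) * (2 : ℝ) ^ (2 * γ * l) = ((2 : ℝ) ^ (γ * (l - L))) ^ 2 := by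
    rw [← Real.rpow_add (by norm_num), ← Real.rpow_natCast, ← Real.rpow_mul (by norm_num)]
    congr 1; push_cast; ring
  rw [sobolevWeight, ← mul_div_assoc, one_le_div h4]
  refine h3.trans ?_
  calc _ = (1 + c⁻¹) ^ 2 * (2 : ℝ) ^ (-(2 * γ * L)) * (L + 1) ^ 2 * (2 : ℝ) ^ (2 * γ * l) := by
        rw [mul_pow, mul_pow, ← e]; ring
    _ ≤ _ := by gcongr

/-- Interpolation between the norms `‖·‖_H` and `‖·‖_{γ,2,1}` at the rate `1 / √n`. -/
theorem exists_norm_le_of_sobolevNorm_le {γ δ : ℝ} (hγ : 0 < γ) (hδ : 0 ≤ δ) :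
    ∃ C : ℝ, 0 ≤ C ∧ ∀ n : ℕ, 3 ≤ n → ∀ (f : L2) (r D : ℝ), 0 ≤ r → 0 ≤ D →
      hNorm B δ f ≤ ENNReal.ofReal (r / √(n : ℝ)) → sobolevNorm B γ 1 f ≤ ENNReal.ofReal D →
      ‖f‖ ≤ C * (r + D) * ((n : ℝ) ^ (-(γ / (2 * γ + 1))) * Real.log n ^ (max δ 1)) := by
  have hlog2 : 0 < Real.log 2 := Real.log_pos (by norm_num)
  set a := 2 * γ + 1 with ha_def
  have ha : 0 < a := by positivity
  set c₁ := (a * Real.log 2)⁻¹ + 1 with hc₁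
  have hc₁0 : 0 < c₁ := by positivity
  set C₁ := 2 * c₁ ^ (2 * δ) + (1 + (γ * Real.log 2)⁻¹) ^ 2 * c₁ ^ 2 with hC₁
  have hC₁0 : 0 ≤ C₁ := by positivity
  refine ⟨√C₁, Real.sqrt_nonneg _, fun n hn f r D hr hD h1 h2 => ?_⟩
  have hn' : (3 : ℝ) ≤ n := by exact_mod_cast hn
  have hn0 : (0 : ℝ) < n := by linarith
  have hs : 0 < √(n : ℝ) := Real.sqrt_pos.2 hn0
  set Λ := Real.log n with hΛ
  -- Since `n ≥ 3 > e`, powers of `log n` increase with the exponent, so `κ = max δ 1` serves both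
  -- weights.
  have hΛ1 : 1 ≤ Λ := by
    rw [hΛ, Real.le_log_iff_exp_le hn0]
    linarith [Real.exp_one_lt_d9]
  -- The cut level balances the two norms: `2 ^ L = n ^ (1 / (2γ + 1))` makes `2 ^ L / n` and `2 ^
  -- (-2γL)` both equal to the squared rate.
  set L := Λ / (a * Real.log 2) with hL
  have hL0 : 0 ≤ L := by positivity
  have hL1 : L + 1 ≤ c₁ * Λ := by
    rw [hL, hc₁, add_mul, one_mul, div_eq_inv_mul]
    linarith
  have hpow : (2 : ℝ) ^ L = (n : ℝ) ^ a⁻¹ := by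
    rw [Real.rpow_def_of_pos (by norm_num), Real.rpow_def_of_pos hn0, ← hΛ, hL]
    congr 1; field_simp
  set κ := max δ 1 with hκ
  have hκ1 : (2 : ℝ) ≤ 2 * κ := by have := le_max_right δ 1; linarith
  have hκδ : 2 * δ ≤ 2 * κ := by have := le_max_left δ 1; linarith
  set A := 2 * (2 : ℝ) ^ L * (L + 1) ^ (2 * δ) with hA
  set E := (1 + (γ * Real.log 2)⁻¹) ^ 2 * (2 : ℝ) ^ (-(2 * γ * L)) * (L + 1) ^ 2 with hE
  have hA0 : 0 ≤ A := by positivity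
  have hE0 : 0 ≤ E := by positivity
  set β := γ / a with hβ
  have hnA : (n : ℝ) ^ a⁻¹ * (n : ℝ)⁻¹ = ((n : ℝ) ^ (-β)) ^ 2 := by
    rw [← Real.rpow_neg_one (n : ℝ), ← Real.rpow_add hn0, ← Real.rpow_natCast,
      ← Real.rpow_mul hn0.le]
    congr 1
    rw [hβ, ha_def]
    push_cast
    field_simp
    ring
  have hnE : (2 : ℝ) ^ (-(2 * γ * L)) = ((n : ℝ) ^ (-β)) ^ 2 := by
    rw [show -(2 * γ * L) = L * (-(2 * γ)) by ring, Real.rpow_mul (by norm_num), hpow,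
      ← Real.rpow_mul hn0.le, ← Real.rpow_natCast, ← Real.rpow_mul hn0.le]
    congr 1
    rw [hβ]
    push_cast
    field_simp
  have hlogκ : (Λ ^ κ) ^ 2 = Λ ^ (2 * κ) := by
    rw [← Real.rpow_natCast, ← Real.rpow_mul (by linarith)]
    congr 1; push_cast; ring
  have hLδ : (L + 1) ^ (2 * δ) ≤ c₁ ^ (2 * δ) * (Λ ^ κ) ^ 2 := by
    rw [hlogκ]
    calc _ ≤ (c₁ * Λ) ^ (2 * δ) := Real.rpow_le_rpow (by positivity) hL1 (by positivity)
      _ = c₁ ^ (2 * δ) * Λ ^ (2 * δ) := Real.mul_rpow hc₁0.le (by linarith)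
      _ ≤ _ := by gcongr
  have hL2 : (L + 1) ^ 2 ≤ c₁ ^ 2 * (Λ ^ κ) ^ 2 := by
    rw [hlogκ]
    calc _ ≤ (c₁ * Λ) ^ 2 := pow_le_pow_left₀ (by positivity) hL1 2
      _ = c₁ ^ 2 * Λ ^ (2 : ℝ) := by rw [mul_pow, Real.rpow_two]
      _ ≤ _ := by gcongr
  have hcover : ∀ i : WaveletIndex J₀ m,
      1 ≤ A * sobolevWeight (-1 / 2) δ i + E * sobolevWeight γ 1 i := by
    intro i
    have hw := mul_nonneg hA0 (sobolevWeight_pos (-1 / 2) δ i).le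
    have hq := mul_nonneg hE0 (sobolevWeight_pos γ 1 i).le
    rcases le_total (i.1.1 : ℝ) L with hi | hi
    · linarith [one_le_mul_sobolevWeight_of_le hδ i hi]
    · linarith [one_le_mul_sobolevWeight_of_ge hγ hL0 i hi]
  have h3 := norm_sq_le_of_wnorm_le (fun i => (sobolevWeight_pos (-1 / 2) δ i).le)
    (fun i => (sobolevWeight_pos γ 1 i).le) hA0 hE0 hcover h1 h2 (by positivity) hD
  set X := (n : ℝ) ^ (-β) with hX
  set Y := Λ ^ κ with hY
  have hX0 : 0 ≤ X := by positivity
  have hY0 : 0 ≤ Y := by positivity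
  have h4 : A * (r / √(n : ℝ)) ^ 2 ≤ 2 * c₁ ^ (2 * δ) * (r * (X * Y)) ^ 2 := by
    rw [hA, hpow, div_pow, Real.sq_sqrt hn0.le, div_eq_mul_inv]
    calc _ = 2 * ((n : ℝ) ^ a⁻¹ * (n : ℝ)⁻¹) * r ^ 2 * (L + 1) ^ (2 * δ) := by ring
      _ ≤ 2 * ((n : ℝ) ^ a⁻¹ * (n : ℝ)⁻¹) * r ^ 2 * (c₁ ^ (2 * δ) * Y ^ 2) := by gcongr
      _ = _ := by rw [hnA]; ring
  have h5 : E * D ^ 2 ≤ (1 + (γ * Real.log 2)⁻¹) ^ 2 * c₁ ^ 2 * (D * (X * Y)) ^ 2 := by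
    rw [hE, hnE]
    calc _ ≤ (1 + (γ * Real.log 2)⁻¹) ^ 2 * X ^ 2 * (c₁ ^ 2 * Y ^ 2) * D ^ 2 := by gcongr
      _ = _ := by ring
  have h6 : ‖f‖ ^ 2 ≤ (√C₁ * (r + D) * (X * Y)) ^ 2 := by
    rw [mul_pow, mul_pow, Real.sq_sqrt hC₁0]
    have h7 : r ^ 2 ≤ (r + D) ^ 2 := pow_le_pow_left₀ hr (by linarith) 2
    have h8 : D ^ 2 ≤ (r + D) ^ 2 := pow_le_pow_left₀ hD (by linarith) 2
    calc _ ≤ 2 * c₁ ^ (2 * δ) * (r * (X * Y)) ^ 2 +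
          (1 + (γ * Real.log 2)⁻¹) ^ 2 * c₁ ^ 2 * (D * (X * Y)) ^ 2 := h3.trans (add_le_add h4 h5)
      _ = 2 * c₁ ^ (2 * δ) * (r ^ 2 * (X * Y) ^ 2) +
          (1 + (γ * Real.log 2)⁻¹) ^ 2 * c₁ ^ 2 * (D ^ 2 * (X * Y) ^ 2) := by ring
      _ ≤ 2 * c₁ ^ (2 * δ) * ((r + D) ^ 2 * (X * Y) ^ 2) +
          (1 + (γ * Real.log 2)⁻¹) ^ 2 * c₁ ^ 2 * ((r + D) ^ 2 * (X * Y) ^ 2) := by gcongr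
      _ = _ := by rw [hC₁]; ring
  exact (pow_le_pow_iff_left₀ (norm_nonneg _) (by positivity) two_ne_zero).1 h6

end Interpolation

/-! ### The credible sets -/

section Credible

variable {S J₀ m : ℕ} {B : RegularBasis S J₀ m}

instance : Nonempty (WaveletIndex J₀ m) :=
  ⟨⟨(J₀, 0), by simp, by simp⟩⟩

theorem sobolevNorm_sub_le (s δ : ℝ) (f g : L2) :
    sobolevNorm B s δ (f - g) ≤ sobolevNorm B s δ f + sobolevNorm B s δ g := by
  have h : coef B (f - g) = coef B f - coef B g := funext fun i => coef_sub B f g i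
  rw [sobolevNorm_eq, sobolevNorm_eq, sobolevNorm_eq, h]
  exact wnorm_sub_le (fun i => (sobolevWeight_pos s δ i).le) _ _

/-- The radii are arbitrary functions of the data, so the events need not be measurable. Since `obs`
is a measurable isomorphism, probabilities of arbitrary sets transfer to the noise. -/
theorem measurableEmbedding_obs (B : RegularBasis S J₀ m) {n : ℕ} (hn : 1 ≤ n) (f : L2) :
    MeasurableEmbedding (obs B n f) := by
  have hs := sqrt_pos_of_one_le hn
  let e : (WaveletIndex J₀ m → ℝ) ≃ᵐ (WaveletIndex J₀ m → ℝ) :=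
    { toFun := obs B n f
      invFun := fun x i => √(n : ℝ) * (x i - coef B f i)
      left_inv := fun ε => by ext i; simp only [obs]; field_simp; ring
      right_inv := fun x => by ext i; simp only [obs]; field_simp; ring
      measurable_toFun := measurable_obs B n f
      measurable_invFun := by simp only [Equiv.coe_fn_symm_mk]; fun_prop }
  exact e.measurableEmbedding

theorem whiteNoise_eq (B : RegularBasis S J₀ m) {n : ℕ} (hn : 1 ≤ n) (f : L2)
    (A : Set (WaveletIndex J₀ m → ℝ)) :
    whiteNoise B n f A = stdGaussian (WaveletIndex J₀ m) {ε | obs B n f ε ∈ A} := by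
  rw [whiteNoise_apply, (measurableEmbedding_obs B hn f).map_apply]
  rfl

theorem tendsto_whiteNoise {f : L2} {A : ℕ → Set (WaveletIndex J₀ m → ℝ)} {p : ℝ≥0∞}
    (h : Tendsto (fun n => stdGaussian (WaveletIndex J₀ m) {ε | obs B n f ε ∈ A n}) atTop (𝓝 p)) :
    Tendsto (fun n => whiteNoise B n f (A n)) atTop (𝓝 p) :=
  h.congr' ((eventually_ge_atTop 1).mono fun _ hn => (whiteNoise_eq B hn f _).symm)

/-- The exceptional sets have vanishing probability, so one constant `K` serves every error level.
-/
theorem isBigOP_of_tendsto {f : L2} {Y : ℕ → (WaveletIndex J₀ m → ℝ) → ℝ≥0∞} {r : ℕ → ℝ} {K : ℝ}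
    {s : ℕ → Set (WaveletIndex J₀ m → ℝ)}
    (hs : Tendsto (fun n => stdGaussian (WaveletIndex J₀ m) (s n)) atTop (𝓝 0))
    (h : ∀ᶠ n in atTop, ∀ᵐ ε ∂(stdGaussian (WaveletIndex J₀ m)), ε ∉ s n →
      Y n (obs B n f ε) ≤ ENNReal.ofReal (K * r n)) :
    IsBigOP (fun n => whiteNoise B n f) Y r := by
  intro e he
  refine ⟨K, (ENNReal.tendsto_nhds_zero.1 (tendsto_whiteNoise (B := B) (f := f)
    (A := fun n => {x | ENNReal.ofReal (K * r n) < Y n x})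
    (tendsto_measure_zero_of_ae_imp hs (h.mono fun n hn => ?_)) )) e he⟩
  filter_upwards [hn] with ε h1 h2
  by_contra h3
  exact absurd (h1 h3) (not_le.2 h2)

variable {γ : ℝ} {ν : Measure ℝ} [IsProbabilityMeasure ν] {f₀ : L2}

/-- The noises for which the posterior has much mass away from `f₀`. -/
def farSet (B : RegularBasis S J₀ m) (γ η : ℝ) (ν : Measure ℝ) [IsProbabilityMeasure ν] (n : ℕ)
    (f₀ : L2) : Set (WaveletIndex J₀ m → ℝ) :=
  {ε | ENNReal.ofReal (Real.log n ^ (-(1 / 4) : ℝ)) < post B γ ν n (obs B n f₀ ε)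
    {f | ENNReal.ofReal (η / 2) ≤ sobolevNorm B γ 1 (f - f₀)}}

theorem tendsto_log_rpow_neg {p : ℝ} (hp : 0 < p) :
    Tendsto (fun n : ℕ => Real.log n ^ (-p)) atTop (𝓝 0) :=
  (tendsto_rpow_neg_atTop hp).comp (Real.tendsto_log_atTop.comp tendsto_natCast_atTop_atTop)

/-- The expected posterior risk, of order `(log n) ^ (-1/2)`, is split evenly by a second use of
Markov's inequality: one factor `(log n) ^ (-1/4)` is the threshold for the posterior mass, the
other bounds the probability of exceeding it. This matches the exponent in the definition of `M_n`.
-/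
theorem tendsto_farSet (hγ : 0 < γ) (hν2 : MemLp (fun x : ℝ => x) 2 ν) {η : ℝ} (hη : 0 < η)
    {K : ℝ≥0∞} (hK : K ≠ ∞)
    (hrisk : ∀ n : ℕ, 1 ≤ n → ∀ i : WaveletIndex J₀ m,
      tiltRisk ν (snr γ n i) (rescaled B γ f₀ i) ≤ K * ENNReal.ofReal (min 1 ((snr γ n i)⁻¹ ^ 2))) :
    Tendsto (fun n => stdGaussian (WaveletIndex J₀ m) (farSet B γ η ν n f₀)) atTop (𝓝 0) := by
  obtain ⟨K', hK', h⟩ := exists_lintegral_sobolevRisk_le hγ hK hrisk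
  have hd : ENNReal.ofReal (η / 2) ≠ 0 := by simpa using hη
  have hdt : ENNReal.ofReal (η / 2) ≠ ∞ := ENNReal.ofReal_ne_top
  set c := (ENNReal.ofReal (η / 2) ^ 2)⁻¹ with hc
  have hct : c ≠ ∞ := ENNReal.inv_ne_top.2 (by positivity)
  have hlim : Tendsto (fun n : ℕ => c * K' * ENNReal.ofReal (Real.log n ^ (-(1 / 4) : ℝ))) atTop
      (𝓝 0) := by
    have h1 := ENNReal.Tendsto.const_mul (a := c * K') (ENNReal.tendsto_ofReal
      (tendsto_log_rpow_neg (p := 1 / 4) (by norm_num))) (Or.inr (ENNReal.mul_ne_top hct hK'))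
    simpa using h1
  refine tendsto_of_tendsto_of_tendsto_of_le_of_le' tendsto_const_nhds hlim
    (Eventually.of_forall fun _ => bot_le) ?_
  filter_upwards [eventually_ge_atTop 2] with n hn
  have hn' : (2 : ℝ) ≤ n := by exact_mod_cast hn
  have hlog : 0 < Real.log n := Real.log_pos (by linarith)
  have hl0 : ENNReal.ofReal (Real.log n ^ (-(1 / 4) : ℝ)) ≠ 0 := by
    simpa using Real.rpow_pos_of_pos hlog _
  calc stdGaussian (WaveletIndex J₀ m) (farSet B γ η ν n f₀)
      ≤ stdGaussian (WaveletIndex J₀ m) {ε | ENNReal.ofReal (Real.log n ^ (-(1 / 4) : ℝ)) ≤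
          c * sobolevRisk B γ ν n f₀ ε} := by
        refine measure_mono_ae ?_
        filter_upwards [ae_post_eq B ν hγ hν2 (by omega : 1 ≤ n) f₀] with ε hε hfar
        exact (le_of_lt hfar).trans (post_le_sobolevRisk hε.1 hε.2 hd hdt)
    _ ≤ (∫⁻ ε, c * sobolevRisk B γ ν n f₀ ε ∂(stdGaussian (WaveletIndex J₀ m))) /
          ENNReal.ofReal (Real.log n ^ (-(1 / 4) : ℝ)) :=
        meas_ge_le_lintegral_div ((measurable_sobolevRisk B γ ν n f₀).const_mul _).aemeasurable
          hl0 ENNReal.ofReal_ne_top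
    _ ≤ c * K' * ENNReal.ofReal (Real.log n ^ (-(1 / 4) : ℝ)) := by
        rw [lintegral_const_mul' _ _ hct]
        refine ENNReal.div_le_of_le_mul ((mul_le_mul' le_rfl (h n hn)).trans (le_of_eq ?_))
        rw [mul_assoc, mul_assoc, ← ENNReal.ofReal_mul (Real.rpow_nonneg hlog.le _),
          ← Real.rpow_add hlog]
        norm_num

theorem tendsto_snr (γ : ℝ) (i : WaveletIndex J₀ m) :
    Tendsto (fun n => snr γ n i) atTop atTop :=
  (Real.tendsto_sqrt_atTop.comp tendsto_natCast_atTop_atTop).atTop_mul_const (scale_pos γ i)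

end Credible

end WhiteNoise

end

/-! ### The theorem: coverage, credibility and diameter -/

open WhiteNoise in
theorem corollary2p2 {S J₀ m : ℕ} (hJ₀ : 1 ≤ J₀) (B : RegularBasis S J₀ m)
    (γ : ℝ) (hγ : 0 < γ) (hS : max γ (1 / 2) < (S : ℝ))
    (δ : ℝ) (hδ : 1 / 2 < δ) (η : ℝ) (hη : 0 < η) (α : ℝ) (hα : α ∈ Ioo (0 : ℝ) 1)
    -- the law of the coefficients: density `φ`, finite variance
    (φ : ℝ → ℝ) (hφ_meas : Measurable φ) (hφ_pos : ∀ x, 0 < φ x) (hφ_bdd : ∃ C, ∀ x, φ x ≤ C)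
    (ν : Measure ℝ) [IsProbabilityMeasure ν]
    (hν : ν = volume.withDensity fun x => ENNReal.ofReal (φ x))
    (hν_var : MemLp (fun x : ℝ => x) 2 ν)
    -- the true function, continuous on `[0,1]`, in the Hölder-type class of order `γ`
    (f : C(I, ℝ)) (f₀ : L2) (hf₀ : f₀ = ContinuousMap.toLp 2 volume ℝ f)
    (hf₀_holder : holderNorm B γ f₀ ≠ ∞)
    -- `φ` is bounded below around the rescaled true coefficients and continuous at each of them;
    -- both hold when `φ` is continuous
    (hφ_low : ∃ τ c : ℝ, holderNorm B γ f₀ < ENNReal.ofReal τ ∧ 0 < c ∧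
      ∀ x, |x| < τ → c ≤ φ x)
    (hφ_cont : ∀ i : WaveletIndex J₀ m,
      ContinuousAt φ ((2 : ℝ) ^ ((i.1.1 : ℝ) * (γ + 1 / 2)) * coef B f₀ i)) :
    -- the posterior mean and the radius exist almost surely
    (∀ n : ℕ, 1 ≤ n → ∀ᵐ x ∂(whiteNoise B n f₀),
      Integrable (fun g : L2 => g) (post B γ ν n x) ∧
      ∃ r : ℝ, 0 ≤ r ∧ (post B γ ν n x).real (credBall B γ δ ν n x r) = 1 - α) ∧
    -- for every choice of the radii `R_n`
    ∀ R : ℕ → (WaveletIndex J₀ m → ℝ) → ℝ,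
      (∀ n : ℕ, 1 ≤ n → ∀ᵐ x ∂(whiteNoise B n f₀),
        0 ≤ R n x ∧ (post B γ ν n x).real (credBall B γ δ ν n x (R n x)) = 1 - α) →
      Tendsto (fun n => (whiteNoise B n f₀).real {x | f₀ ∈ credSet B γ δ η ν n x (R n x)})
        atTop (𝓝 (1 - α)) ∧
      TendstoInProb (fun n => whiteNoise B n f₀)
        (fun n x => (post B γ ν n x).real (credSet B γ δ η ν n x (R n x))) (1 - α) ∧
      (∃ κ : ℝ, 0 < κ ∧ IsBigOP (fun n => whiteNoise B n f₀)
        (fun n x => Metric.ediam (credSet B γ δ η ν n x (R n x)))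
        (fun n => (n : ℝ) ^ (-(γ / (2 * γ + 1))) * Real.log n ^ κ)) ∧
      IsBigOP (fun n => whiteNoise B n f₀) (fun n x => normBound B γ η ν n x) (fun _ => 1) ∧
      IsBigOP (fun n => whiteNoise B n f₀) (fun n x => ENNReal.ofReal (R n x)) (fun _ => 1) := by
  obtain ⟨C, hC⟩ := hφ_bdd
  obtain ⟨τ, c, hτ, hc, hlow⟩ := hφ_low
  have hws := tsum_sobolevWeight_ne_top (J₀ := J₀) (m := m) hδ
  have hw : ∀ i : WaveletIndex J₀ m, 0 ≤ sobolevWeight (-1 / 2) δ i := fun i =>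
    (sobolevWeight_pos _ _ i).le
  obtain ⟨j⟩ := (inferInstance : Nonempty (WaveletIndex J₀ m))
  have hj := sobolevWeight_pos (-1 / 2) δ j
  set p := ENNReal.ofReal (1 - α) with hp
  have hα1 : 0 < 1 - α := by linarith [hα.2]
  have hp0 : 0 < p := ENNReal.ofReal_pos.2 hα1
  have hp1 : p < 1 := ENNReal.ofReal_lt_one.2 (by linarith [hα.1])
  have hppost : ∀ n, 1 ≤ n → ∀ᵐ ε ∂(stdGaussian (WaveletIndex J₀ m)),
      IsProbabilityMeasure (post B γ ν n (obs B n f₀ ε)) := fun n hn => by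
    filter_upwards [ae_post_eq B ν hγ hν_var hn f₀] with ε hε
    rw [hε.1]
    exact Measure.isProbabilityMeasure_map (measurable_series B γ).aemeasurable
  -- the risk of the coordinates
  have hbτ : (holderNorm B γ f₀).toReal < τ := ENNReal.toReal_lt_of_lt_ofReal hτ
  obtain ⟨K, hK, hKrisk⟩ := tiltRisk_le hφ_meas hν hC hν_var hbτ hc hlow
  have hrisk : ∀ n : ℕ, 1 ≤ n → ∀ i : WaveletIndex J₀ m,
      tiltRisk ν (snr γ n i) (rescaled B γ f₀ i) ≤
        K * ENNReal.ofReal (min 1 ((snr γ n i)⁻¹ ^ 2)) := fun n hn i =>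
    hKrisk _ _ (snr_pos γ hn i) (abs_coef_le_of_holderNorm hf₀_holder i)
  have hρ : AsympGaussian fun n => localKernel B γ ν n f₀ :=
    asympGaussian_coordKernel hφ_meas hν hC hφ_pos (tendsto_snr γ)
      ((eventually_ge_atTop 1).mono fun n hn => snr_pos γ hn) hφ_cont hK
      ((eventually_ge_atTop 1).mono hrisk)
  have hfar := tendsto_farSet (B := B) hγ hν_var hη hK hrisk
  refine ⟨fun n hn => ?_, fun R hR => ?_⟩
  · rw [whiteNoise_apply, (measurableEmbedding_obs B hn f₀).ae_map_iff]
    filter_upwards [ae_post_eq B ν hγ hν_var hn f₀] with ε hε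
    refine ⟨integrable_post hε.1 hε.2, ?_⟩
    obtain ⟨r, hr, hrp⟩ := exists_radius hn δ hν hws hε.1 hε.2 hp0 hp1
    exact ⟨r, hr, by rw [measureReal_def, hrp, ENNReal.toReal_ofReal hα1.le]⟩
  have hR' : ∀ n, 1 ≤ n → ∀ᵐ ε ∂(stdGaussian (WaveletIndex J₀ m)),
      (post B γ ν n (obs B n f₀ ε)).real
        (credBall B γ δ ν n (obs B n f₀ ε) (R n (obs B n f₀ ε))) = 1 - α := fun n hn => by
    have h := hR n hn
    rw [whiteNoise_apply, (measurableEmbedding_obs B hn f₀).ae_map_iff] at h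
    exact h.mono fun ε hε => hε.2
  have hRk : ∀ᶠ n in atTop, ∀ᵐ ε ∂(stdGaussian (WaveletIndex J₀ m)),
      kernelBall (sobolevWeight (-1 / 2) δ) (localKernel B γ ν n f₀) ε
        (R n (obs B n f₀ ε)) = p := by
    filter_upwards [eventually_ge_atTop 1] with n hn
    filter_upwards [hR' n hn, ae_post_eq B ν hγ hν_var hn f₀, hppost n hn] with ε h1 h2 h3
    rw [← post_credBall hn δ h2.1 h2.2, hp, ← h1, ofReal_measureReal]
  -- an upper bound for the radii
  obtain ⟨q, hpq, hq1⟩ := exists_between hp1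
  obtain ⟨r, hr, hrq⟩ := exists_gaussBall_eq hw hws hj (hp0.trans hpq) hq1
  have hlarge := hρ.tendsto_lt_radius hw hws hj hRk hr (hpq.trans_eq hrq.symm)
  -- the bound `M_n`
  have hN := sobolevNorm_ne_top hγ hf₀_holder
  set N := (sobolevNorm B γ 1 f₀).toReal with hN_def
  have hN0 : 0 ≤ N := ENNReal.toReal_nonneg
  have hNe : sobolevNorm B γ 1 f₀ = ENNReal.ofReal N := (ENNReal.ofReal_toReal hN).symm
  have hlog16 : ∀ᶠ n : ℕ in atTop, 16 < Real.log n :=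
    (Real.tendsto_log_atTop.comp tendsto_natCast_atTop_atTop).eventually (eventually_gt_atTop 16)
  have hM : ∀ᶠ n in atTop, ∀ᵐ ε ∂(stdGaussian (WaveletIndex J₀ m)), ε ∉ farSet B γ η ν n f₀ →
      normBound B γ η ν n (obs B n f₀ ε) ≤ sobolevNorm B γ 1 f₀ + ENNReal.ofReal (η / 2) ∧
      sobolevNorm B γ 1 f₀ ≤ normBound B γ η ν n (obs B n f₀ ε) + ENNReal.ofReal (2 * η) := by
    filter_upwards [eventually_ge_atTop 1, hlog16] with n hn hl
    filter_upwards [hppost n hn] with ε h1 h2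
    exact normBound_of_post_le hη hN hl (not_lt.1 h2)
  refine ⟨?_, fun e he => ?_, ⟨max δ 1, lt_max_of_lt_right one_pos, ?_⟩, ?_, ?_⟩
  · -- coverage
    have hcov := hρ.tendsto_coverage hw hws hj hp1 hRk
    have hlim : Tendsto (fun n => stdGaussian (WaveletIndex J₀ m)
        {ε | obs B n f₀ ε ∈ {x | f₀ ∈ credSet B γ δ η ν n x (R n x)}}) atTop (𝓝 p) := by
      -- For large `n`, the norm constraint holds at `f₀` off `farSet`, up to a null set, so the
      -- coverage falls short of that of the ball by at most the probability of `farSet`.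
      have h1 := ENNReal.Tendsto.sub hcov hfar (Or.inr ENNReal.zero_ne_top)
      rw [tsub_zero] at h1
      refine tendsto_of_tendsto_of_tendsto_of_le_of_le' h1 hcov ?_ ?_
      · filter_upwards [hM, eventually_ge_atTop 1] with n hn hn1
        rw [tsub_le_iff_right]
        refine le_trans (measure_mono_ae ?_) (measure_union_le _ _)
        filter_upwards [hn, ae_post_eq B ν hγ hν_var hn1 f₀] with ε h2 h3 h4
        by_cases h5 : ε ∈ farSet B γ η ν n f₀
        · exact Or.inr h5
        · refine Or.inl ⟨(h2 h5).2.trans (add_le_add le_rfl (ENNReal.ofReal_le_ofReal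
            (by linarith))), (mem_credBall_iff hn1 δ h3.1 h3.2 _).2 h4⟩
      · filter_upwards [eventually_ge_atTop 1] with n hn1
        refine measure_mono_ae ?_
        filter_upwards [ae_post_eq B ν hγ hν_var hn1 f₀] with ε h3 h4
        exact (mem_credBall_iff hn1 δ h3.1 h3.2 _).1 h4.2
    have h2 := (ENNReal.tendsto_toReal (by finiteness : p ≠ ∞)).comp (tendsto_whiteNoise hlim)
    rwa [hp, ENNReal.toReal_ofReal hα1.le] at h2
  · -- posterior mass
    refine tendsto_whiteNoise (tendsto_measure_zero_of_ae_imp hfar ?_)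
    have he' := (tendsto_log_rpow_neg (p := 1 / 4) (by norm_num)).eventually (gt_mem_nhds he)
    filter_upwards [hM, eventually_ge_atTop 1, he'] with n hn hn1 hen
    filter_upwards [hn, hppost n hn1, hR' n hn1] with ε h1 h2 h3 h4
    by_contra h5
    refine absurd h4 (not_le.2 (lt_of_le_of_lt ?_ hen))
    set x := obs B n f₀ ε with hx
    have hfs : (post B γ ν n x).real {f | ENNReal.ofReal (η / 2) ≤ sobolevNorm B γ 1 (f - f₀)} ≤
        Real.log n ^ (-(1 / 4) : ℝ) := by
      rw [measureReal_def]
      exact ENNReal.toReal_le_of_le_ofReal (Real.rpow_nonneg (Real.log_natCast_nonneg n) _)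
        (not_lt.1 h5)
    -- The constraint removes from the ball only functions far from `f₀`: the slack needed is `2 η +
    -- η / 2`, below the allowed `4 η`.
    have hsub : credBall B γ δ ν n x (R n x) ⊆ credSet B γ δ η ν n x (R n x) ∪
        {f | ENNReal.ofReal (η / 2) ≤ sobolevNorm B γ 1 (f - f₀)} := by
      intro f hf
      by_cases hfar : ENNReal.ofReal (η / 2) ≤ sobolevNorm B γ 1 (f - f₀)
      · exact Or.inr hfar
      · refine Or.inl ⟨?_, hf⟩
        calc sobolevNorm B γ 1 f ≤ sobolevNorm B γ 1 f₀ + sobolevNorm B γ 1 (f - f₀) :=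
              sobolevNorm_le_add _ _ _ _
          _ ≤ normBound B γ η ν n x + ENNReal.ofReal (2 * η) + ENNReal.ofReal (η / 2) :=
              add_le_add (h1 h5).2 (not_le.1 hfar).le
          _ ≤ normBound B γ η ν n x + ENNReal.ofReal (4 * η) := by
              rw [add_assoc, ← ENNReal.ofReal_add (by positivity) (by positivity)]
              gcongr
              linarith
    have h6 := (measureReal_mono hsub (μ := post B γ ν n x)).trans (measureReal_union_le _ _)
    have h7 : (post B γ ν n x).real (credSet B γ δ η ν n x (R n x)) ≤
        (post B γ ν n x).real (credBall B γ δ ν n x (R n x)) :=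
      measureReal_mono inter_subset_right
    rw [h3] at h6 h7
    rw [abs_le]
    constructor <;> linarith [Real.rpow_nonneg (Real.log_natCast_nonneg n) (-(1 / 4) : ℝ)]
  · -- diameter
    obtain ⟨C', hC', hdiam⟩ := exists_norm_le_of_sobolevNorm_le (B := B) hγ
      (by linarith : (0 : ℝ) ≤ δ)
    have hbad := hfar.add hlarge
    rw [add_zero] at hbad
    -- Two points each within `r / √n` of the posterior mean give `2 * r`. The bound `N + 5 * η`
    -- covers `M_n + 4 η`, since `M_n ≤ N + η / 2` off `farSet`.
    refine isBigOP_of_tendsto (K := C' * (2 * r + 2 * (N + 5 * η)))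
      (s := fun n => farSet B γ η ν n f₀ ∪ {ε | r < R n (obs B n f₀ ε)})
      (tendsto_of_tendsto_of_tendsto_of_le_of_le tendsto_const_nhds hbad (fun _ => bot_le)
        fun n => measure_union_le _ _) ?_
    filter_upwards [hM, eventually_ge_atTop 3] with n hn hn3
    filter_upwards [hn] with ε h1 h2
    simp only [mem_union, mem_ofPred_eq, not_or, not_lt] at h2
    have hs := sqrt_pos_of_one_le (by omega : 1 ≤ n)
    set x := obs B n f₀ ε with hx
    refine Metric.ediam_le fun f hf g hg => ?_
    rw [edist_dist, dist_eq_norm]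
    refine ENNReal.ofReal_le_ofReal (hdiam n hn3 (f - g) (2 * r) (2 * (N + 5 * η)) (by positivity)
      (by positivity) ?_ ?_)
    · have hball : ∀ f ∈ credSet B γ δ η ν n x (R n x),
          hNorm B δ (f - postMean B γ ν n x) ≤ ENNReal.ofReal (r / √(n : ℝ)) := fun f hf =>
        le_trans hf.2 (ENNReal.ofReal_le_ofReal (by gcongr; exact h2.2))
      rw [← sub_sub_sub_cancel_right f g (postMean B γ ν n x), two_mul, add_div,
        ENNReal.ofReal_add (by positivity) (by positivity)]
      exact (sobolevNorm_sub_le _ _ _ _).trans (add_le_add (hball f hf) (hball g hg))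
    · have hbound : ∀ f ∈ credSet B γ δ η ν n x (R n x),
          sobolevNorm B γ 1 f ≤ ENNReal.ofReal (N + 5 * η) := fun f hf => by
        refine le_trans hf.1 ((add_le_add (h1 h2.1).1 le_rfl).trans ?_)
        rw [hNe, ← ENNReal.ofReal_add hN0 (by positivity),
          ← ENNReal.ofReal_add (by positivity) (by positivity)]
        exact ENNReal.ofReal_le_ofReal (by linarith)
      rw [two_mul, ENNReal.ofReal_add (by positivity) (by positivity)]
      exact (sobolevNorm_sub_le _ _ _ _).trans (add_le_add (hbound f hf) (hbound g hg))
  · refine isBigOP_of_tendsto (K := N + η / 2) hfar (hM.mono fun n hn => hn.mono fun ε h1 h2 => ?_)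
    rw [mul_one, ENNReal.ofReal_add hN0 (by positivity), ← hNe]
    exact (h1 h2).1
  · refine isBigOP_of_tendsto (K := r) hlarge (Eventually.of_forall fun n => ae_of_all _
      fun ε h1 => ENNReal.ofReal_le_ofReal ?_)
    rw [mul_one]
    exact not_lt.1 h1
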